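/- Throughout, an \emph{in-place oracle} is a family $\Pi=\{\pi_n\}_{n\in\mathbb N}$ of fixed permutations; algorithms may apply the unitaries $O_{\pi_n}|x\rangle=|\pi_n(x)\rangle$ for any $n$ (but are given no access to their inverses). Oracle verifiers are families of circuits $\{C_x\}_{x\in\{0,1\}^*}$, each an alternation of blocks of Clifford+T gates with rounds of parallel oracle queries on disjoint registers, with a witness of length polynomial in $|x|$ and ancillas initialised to $|0\rangle$, and such that a Turing machine outputs a description of $C_x$ on input $x$. In $\mathsf{QMA}_1^{\Pi}$ (quantum witnesses, completeness exactly $1$, soundness error at most $1-1/\mathrm{poly}(|x|)$) and $\mathsf{QCMA}^{\Pi}$ (classical witnesses, completeness $2/3$, soundness error $1/3$) the machine must run in polynomial time. $\mathsf{QCMA}^{\Pi}[R,q]$ is the class defined like $\mathsf{QCMA}^{\Pi}$, but where the machine is only required to halt, and the verifier makes at most $R(|x|)$ adaptive rounds of at most $q(|x|)$ parallel queries. $\mathsf{QMA}_1^{\Pi}[R,q]$ is the class defined like $\mathsf{QMA}_1^{\Pi}$ (polynomial-time uniformity included) with the same restriction on queries. Fix an integer $l\ge 4$ and real numbers $\alpha\in(0,\tfrac12)$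 and $\beta\ge0$ with $\beta+5\alpha<l-2$. For $n\in\mathbb N$ let $N=2^n$, $M=2^{ln}$, $b=b(n)=\lceil 2^{\alpha n}\rceil$ and $B=2\lfloor\frac{M-N}{2(b-1)}\rfloor$ (with $B=0$ when $b=1$, i.e. $n=0$), and let $I_1=\{1,\dots,N\}$ and $I_i=\{N+(i-2)B+1,\dots,N+(i-1)B\}$ for $2\le i\le b$. An \emph{instance of permutation pointer chasing} (of size $n$) consists of injections $f_i\colon[N]\to I_i$ ($1\le i\le b$) with images $S_i$ and the permutation $\pi_n$ of $[M]$ with $\pi_n(f_i(j))=f_{i+1}(j)$ for $i<b$, $\pi_n(f_b(j))=j$, and $\pi_n(x)=x$ for $x\notin\bigcup_iS_i$, such that either all $N$ elements of $S_b=\pi_n^{-1}([N])$ are even (a YES instance) or at most $N/2$ of them are even (a NO instance). The element $x\in[M]$ is encoded as the $ln$-bit string of value $x-1$. For a family $\Pi=\{\pi_n\}$ of such instances let $L_\Pi=\{1^n:\pi_n\text{ is a YES instance}\}$. \textbf{Theorem.} \begin{enumerate} \item There is a polynomial-time uniform verifier $V$, making at most one query (one round of one query), with a witness of $ln$ qubits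 on inputs of length $n$, such that for every family $\Pi$ of instances: if $\pi_n$ is a YES instance, then $V^{\Pi}$ accepts $1^n$ with probability exactly $1$ on the uniform state $N^{-1/2}\sum_{x\in\pi_n^{-1}([N])}|x\rangle$; and for every string $x\notin L_\Pi$ and every witness state, $V^{\Pi}$ accepts $x$ with probability at most $9/10$. In particular $L_\Pi\in\mathsf{QMA}_1^{\Pi}[1,1]$ for every family $\Pi$ of instances. \item There is a family $\Pi=\{\pi_n\}$ of instances such that $L_\Pi\notin\mathsf{QCMA}^{\Pi}[\,b(n)-2,\,q(n)]$ for every $q\colon\mathbb N\to\mathbb N$ with $q(n)\le2^{\beta n}$ for all $n$ (where $b(n)-2$ is read as $0$ for $n=0$), and moreover $L_\Pi\in\mathsf{QMA}_1^{\Pi}\setminus\mathsf{QCMA}^{\Pi}$. In particular, there is a deterministic forward-only in-place permutation oracle $\Pi$ with $\mathsf{QMA}_1^{\Pi}\not\subseteq\mathsf{QCMA}^{\Pi}$. \end{enumerate} -/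

import Mathlib

/-! ### Quantum states and gates -/

namespace InPlaceSep

/-- Computational basis labels of `k` qubits. -/
abbrev Bits (k : ℕ) : Type := Fin k → Fin 2

/-- Amplitude vectors on `k` qubits. -/
abbrev QState (k : ℕ) : Type := Bits k → ℂ

/-- Normalised amplitude vectors. -/
def QState.IsUnit {k : ℕ} (ψ : QState k) : Prop := ∑ y, ‖ψ y‖ ^ 2 = 1

/-- The computational basis state `|w⟩`. -/
def basisState {k : ℕ} (w : Bits k) : QState k := fun y => if y = w then 1 else 0

/-- The uniform superposition of the basis states of `k` qubits whose (binary) value lies in `S`. -/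
noncomputable def uniformState (k : ℕ) (S : Finset ℕ) : QState k := fun y =>
  if (finFunctionFinEquiv y : ℕ) ∈ S then 1 / (Real.sqrt (S.card : ℝ) : ℂ) else 0

/-- The gate set on `W` wires: Clifford+T, given by Hadamard, T, X, CNOT and Toffoli. -/
inductive Gate (W : ℕ) : Type
  | H (i : Fin W) : Gate W
  | T (i : Fin W) : Gate W
  | X (i : Fin W) : Gate W
  | CNOT (c t : Fin W) (h : c ≠ t) : Gate W
  | Toffoli (c₁ c₂ t : Fin W) (h : c₁ ≠ c₂) (h₁ : c₁ ≠ t) (h₂ : c₂ ≠ t) : Gate W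

/-- The unitary of a gate, acting on amplitude vectors. -/
noncomputable def Gate.apply {W : ℕ} : Gate W → QState W → QState W
  | .H i, ψ => fun y => (1 / (Real.sqrt 2 : ℂ)) *
      (ψ (Function.update y i 0) + (-1) ^ (y i : ℕ) * ψ (Function.update y i 1))
  | .T i, ψ => fun y => Complex.exp (Complex.I * Real.pi / 4) ^ (y i : ℕ) * ψ y
  | .X i, ψ => fun y => ψ (Function.update y i (y i + 1))
  | .CNOT c t _, ψ => fun y => ψ (Function.update y t (y t + y c))
  | .Toffoli c₁ c₂ t _ _ _, ψ => fun y => ψ (Function.update y t (y t + y c₁ * y c₂))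

/-! ### Forward in-place oracles and circuits querying them -/

/-- A deterministic in-place oracle: for every `m` a permutation `π_m` of the basis states of
`len m` qubits.  Circuits can apply `|x⟩ ↦ |π_m x⟩`, never its inverse. -/
abbrev PermOracle (len : ℕ → ℕ) : Type := ∀ m : ℕ, Equiv.Perm (Fin (2 ^ len m))

/-- One query to the `m`-th oracle, applied to the listed wires. -/
structure Query (len : ℕ → ℕ) (W : ℕ) where
  m : ℕ
  wires : Fin (len m) ↪ Fin W

/-- `|x⟩ ↦ |π_m x⟩` on the query register: the new amplitude at `y` is the old amplitude at the
label obtained from `y` by replacing the content of the query register by its `π_m`-preimage. -/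
noncomputable def Query.apply {len : ℕ → ℕ} {W : ℕ} (O : PermOracle len) (Q : Query len W)
    (ψ : QState W) : QState W := fun y =>
  ψ (Function.extend Q.wires
    (finFunctionFinEquiv.symm ((O Q.m).symm (finFunctionFinEquiv fun j => y (Q.wires j)))) y)

/-- A round of parallel queries: the queries act on pairwise disjoint sets of wires. -/
structure QueryLayer (len : ℕ → ℕ) (W : ℕ) where
  queries : List (Query len W)
  disjoint : queries.Pairwise fun Q Q' => Disjoint (Set.range Q.wires) (Set.range Q'.wires)

/-- Apply a list of gates, the head of the list first. -/
noncomputable def applyGates {W : ℕ} (gs : List (Gate W)) (ψ : QState W) : QState W :=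
  gs.foldl (fun φ g => g.apply φ) ψ

/-- Apply all queries of a round. -/
noncomputable def QueryLayer.apply {len : ℕ → ℕ} {W : ℕ} (O : PermOracle len)
    (L : QueryLayer len W) (ψ : QState W) : QState W :=
  L.queries.foldl (fun φ Q => Q.apply O φ) ψ

/-- An oracle circuit `U_R O^{⊗q} U_{R-1} ⋯ U_1 O^{⊗q} U_0` on `k` witness qubits (the first wires)
and a number of ancilla qubits that start in `|0⟩`; the wire `out` is measured at the end. -/
structure Circuit (len : ℕ → ℕ) (k : ℕ) where
  ancillas : ℕ
  out : Fin (k + ancillas)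
  init : List (Gate (k + ancillas))
  rounds : List (QueryLayer len (k + ancillas) × List (Gate (k + ancillas)))

/-- The state `|ψ⟩|0⋯0⟩`. -/
def withAncillas {k : ℕ} (a : ℕ) (ψ : QState k) : QState (k + a) := fun y =>
  if ∀ j : Fin a, y (Fin.natAdd k j) = 0 then ψ (fun i => y (Fin.castAdd a i)) else 0

/-- The final state of the circuit on witness `ψ`. -/
noncomputable def Circuit.run {len : ℕ → ℕ} {k : ℕ} (O : PermOracle len) (C : Circuit len k)
    (ψ : QState k) : QState (k + C.ancillas) :=
  C.rounds.foldl (fun φ r => applyGates r.2 (r.1.apply O φ))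
    (applyGates C.init (withAncillas C.ancillas ψ))

/-- The probability that the output wire is measured to be `1`. -/
noncomputable def Circuit.acceptProb {len : ℕ → ℕ} {k : ℕ} (O : PermOracle len) (C : Circuit len k)
    (ψ : QState k) : ℝ :=
  ∑ y, if y C.out = 1 then ‖C.run O ψ y‖ ^ 2 else 0

/-! ### Descriptions of circuits as bit strings -/

/-- A gate as a list of numbers: a nonzero code, then the wires. -/
def Gate.code {W : ℕ} : Gate W → List ℕ
  | .H i => [1, i]
  | .T i => [2, i]
  | .X i => [3, i]
  | .CNOT c t _ => [4, c, t]
  | .Toffoli c₁ c₂ t _ _ _ => [5, c₁, c₂, t]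

/-- A gate list, terminated by `0`. -/
def gatesCode {W : ℕ} (gs : List (Gate W)) : List ℕ := gs.flatMap Gate.code ++ [0]

/-- A query: the index of the oracle, then the wires of its register. -/
def Query.code {len : ℕ → ℕ} {W : ℕ} (Q : Query len W) : List ℕ :=
  Q.m :: List.ofFn fun j => (Q.wires j : ℕ)

/-- A round of queries: each query is preceded by `1`, and the list is terminated by `0`. -/
def QueryLayer.code {len : ℕ → ℕ} {W : ℕ} (L : QueryLayer len W) : List ℕ :=
  (L.queries.flatMap fun Q => 1 :: Q.code) ++ [0]

/-- A circuit as a list of numbers. -/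
def Circuit.code {len : ℕ → ℕ} {k : ℕ} (C : Circuit len k) : List ℕ :=
  C.ancillas :: (C.out : ℕ) :: (gatesCode C.init ++
    ((C.rounds.flatMap fun r => 1 :: (r.1.code ++ gatesCode r.2)) ++ [0]))

/-- The description of a circuit as a bit string: each number of its code is written in unary. -/
def Circuit.encode {len : ℕ → ℕ} {k : ℕ} (C : Circuit len k) : List Bool :=
  C.code.flatMap fun n => List.replicate n true ++ [false]

/-! ### Uniform verifiers and oracle classes -/

/-- A family of verification circuits, one for each input string, with a witness of polynomial
length `wit`. -/
structure Verifier (len : ℕ → ℕ) where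
  wit : Polynomial ℕ
  circ : ∀ x : List Bool, Circuit len (wit.eval x.length)

/-- `Pr[V^O(x, ψ) = 1]`. -/
noncomputable def Verifier.acceptProb {len : ℕ → ℕ} (V : Verifier len) (O : PermOracle len)
    (x : List Bool) (ψ : QState (V.wit.eval x.length)) : ℝ :=
  (V.circ x).acceptProb O ψ

/-- Some Turing machine maps `x` to the description of the circuit for `x`. -/
def Verifier.Uniform {len : ℕ → ℕ} (V : Verifier len) : Prop :=
  Nonempty (Turing.TM2Computable (id : List Bool → List Bool) (id : List Bool → List Bool)
    fun x => (V.circ x).encode)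

/-- Some polynomial-time Turing machine maps `x` to the description of the circuit for `x`. -/
def Verifier.PolyTimeUniform {len : ℕ → ℕ} (V : Verifier len) : Prop :=
  Nonempty (Turing.TM2ComputableInPolyTime (id : List Bool → List Bool)
    (id : List Bool → List Bool) fun x => (V.circ x).encode)

/-- On inputs of length `n` the verifier makes at most `R n` adaptive rounds of at most `q n`
parallel queries. -/
def Verifier.QueryBound {len : ℕ → ℕ} (V : Verifier len) (R q : ℕ → ℕ) : Prop :=
  ∀ x : List Bool, (V.circ x).rounds.length ≤ R x.length ∧
    ∀ r ∈ (V.circ x).rounds, r.1.queries.length ≤ q x.length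

/-- Perfect completeness and soundness error `1 - 1/poly`, with quantum witnesses. -/
def Verifier.VerifiesQMA1 {len : ℕ → ℕ} (V : Verifier len) (O : PermOracle len)
    (L : Set (List Bool)) : Prop :=
  (∀ x ∈ L, ∃ ψ, QState.IsUnit ψ ∧ V.acceptProb O x ψ = 1) ∧
  ∃ r : Polynomial ℕ, ∀ x ∉ L, ∀ ψ, QState.IsUnit ψ →
    V.acceptProb O x ψ ≤ 1 - 1 / (((r.eval x.length : ℕ) : ℝ) + 1)

/-- Completeness `2/3` and soundness `1/3`, with classical witnesses. -/
def Verifier.VerifiesQCMA {len : ℕ → ℕ} (V : Verifier len) (O : PermOracle len)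
    (L : Set (List Bool)) : Prop :=
  (∀ x ∈ L, ∃ w, 2 / 3 ≤ V.acceptProb O x (basisState w)) ∧
  ∀ x ∉ L, ∀ w, V.acceptProb O x (basisState w) ≤ 1 / 3

/-- `QMA₁^O`. -/
def QMA1 {len : ℕ → ℕ} (O : PermOracle len) : Set (Set (List Bool)) :=
  {L | ∃ V : Verifier len, V.PolyTimeUniform ∧ V.VerifiesQMA1 O L}

/-- `QMA₁^O[R, q]`, with polynomial-time uniform verifiers. -/
def QMA1Bounded {len : ℕ → ℕ} (O : PermOracle len) (R q : ℕ → ℕ) : Set (Set (List Bool)) :=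
  {L | ∃ V : Verifier len, V.PolyTimeUniform ∧ V.QueryBound R q ∧ V.VerifiesQMA1 O L}

/-- `QCMA^O`. -/
def QCMA {len : ℕ → ℕ} (O : PermOracle len) : Set (Set (List Bool)) :=
  {L | ∃ V : Verifier len, V.PolyTimeUniform ∧ V.VerifiesQCMA O L}

/-- `QCMA^O[R, q]`: uniform verifiers with bounded queries and polynomial witness length, but with
no bound on their running time. -/
def QCMABounded {len : ℕ → ℕ} (O : PermOracle len) (R q : ℕ → ℕ) : Set (Set (List Bool)) :=
  {L | ∃ V : Verifier len, V.Uniform ∧ V.QueryBound R q ∧ V.VerifiesQCMA O L}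

/-! ### Permutation pointer chasing -/

/-- The number of buckets `b = ⌈2^{αn}⌉`. -/
noncomputable def numBuckets (α : ℝ) (n : ℕ) : ℕ := ⌈(2 : ℝ) ^ (α * n)⌉₊

/-- The bucket size `B = 2⌊(M - N) / (2(b - 1))⌋`, where `M = 2^{ln}` and `N = 2^n`. -/
noncomputable def bucketSize (l : ℕ) (α : ℝ) (n : ℕ) : ℕ :=
  2 * ((2 ^ (l * n) - 2 ^ n) / (2 * (numBuckets α n - 1)))

/-- The bucket `I_i ⊆ {1, …, M}`, for `1 ≤ i ≤ b`. -/
noncomputable def bucket (l : ℕ) (α : ℝ) (n i : ℕ) : Finset ℕ :=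
  if i = 1 then Finset.Icc 1 (2 ^ n)
  else Finset.Icc (2 ^ n + (i - 2) * bucketSize l α n + 1)
    (2 ^ n + (i - 1) * bucketSize l α n)

/-- The element of `[M] = {1, …, M}` that corresponds to an element of `Fin M`. -/
def label {M : ℕ} (x : Fin M) : ℕ := x + 1

/-- A chain of injections `f_1, …, f_b` of `[N]` into the buckets (so `f_i` is a bijection onto its
image `S_i`), together with the permutation `π` of `[M]` that they define.  The indices `i : Fin b`
and `j : Fin N` stand for `i + 1` and `j + 1`. -/
structure PointerChain (l : ℕ) (α : ℝ) (n : ℕ) where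
  f : Fin (numBuckets α n) → Fin (2 ^ n) → Fin (2 ^ (l * n))
  f_injective : ∀ i, Function.Injective (f i)
  f_mem : ∀ (i : Fin (numBuckets α n)) (j : Fin (2 ^ n)), label (f i j) ∈ bucket l α n ((i : ℕ) + 1)
  perm : Equiv.Perm (Fin (2 ^ (l * n)))
  perm_step : ∀ (i : ℕ) (h : i + 1 < numBuckets α n) (j : Fin (2 ^ n)),
    perm (f ⟨i, Nat.lt_of_succ_lt h⟩ j) = f ⟨i + 1, h⟩ j
  perm_last : ∀ (i : Fin (numBuckets α n)) (j : Fin (2 ^ n)), (i : ℕ) + 1 = numBuckets α n →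
    label (perm (f i j)) = label j
  perm_fixed : ∀ x, (∀ i j, x ≠ f i j) → perm x = x

/-- `|S_b^{even}|`: the number of even elements of `S_b`. -/
noncomputable def PointerChain.evenCount {l : ℕ} {α : ℝ} {n : ℕ} (P : PointerChain l α n) : ℕ :=
  {x : Fin (2 ^ (l * n)) | (∃ (i : Fin (numBuckets α n)) (j : Fin (2 ^ n)),
    (i : ℕ) + 1 = numBuckets α n ∧ P.f i j = x) ∧
    Even (label x)}.ncard

/-- YES instances: `|S_b^{even}| = N`. -/
def PointerChain.IsYes {l : ℕ} {α : ℝ} {n : ℕ} (P : PointerChain l α n) : Prop :=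
  P.evenCount = 2 ^ n

/-- NO instances: `|S_b^{even}| ≤ N/2`. -/
def PointerChain.IsNo {l : ℕ} {α : ℝ} {n : ℕ} (P : PointerChain l α n) : Prop :=
  2 * P.evenCount ≤ 2 ^ n

/-- Instances of the promise problem permutation pointer chasing. -/
structure PCInstance (l : ℕ) (α : ℝ) (n : ℕ) extends PointerChain l α n where
  promise : toPointerChain.IsYes ∨ toPointerChain.IsNo

/-- The binary values of the basis states in `π⁻¹([N])`. -/
def PointerChain.preimage {l : ℕ} {α : ℝ} {n : ℕ} (P : PointerChain l α n) : Finset ℕ :=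
  (Finset.univ.filter fun x : Fin (2 ^ (l * n)) => label (P.perm x) ≤ 2 ^ n).image Fin.val

/-- The in-place oracle `{π_n}` of a family of instances. -/
def oracle {l : ℕ} {α : ℝ} (P : ∀ n, PCInstance l α n) : PermOracle (fun n => l * n) :=
  fun n => (P n).perm

/-- The unary language `{1^n : π_n is a YES instance}`. -/
def lang {l : ℕ} {α : ℝ} (P : ∀ n, PCInstance l α n) : Set (List Bool) :=
  {x | ∃ n, x = List.replicate n true ∧ (P n).IsYes}

end InPlaceSep

/-! Upper bound. An even label has lowest bit `1`, so one CNOT copies the parity of the witness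
label into a flag. The forward query then carries the uniform state on `S_b` to the uniform state on
`[N]` and leaves no record of the preimage, and Hadamard gates on `n` wires take that state to
`|0⟩`. Testing the flag and the zero label accepts with probability `2^{-n} |∑ ψ(x)|²`, summed over
the even `x` with `π(x) ∈ [N]` (`verifier_acceptProb`). This is `1` for a YES instance and the
uniform state, and at most `1/2` for a NO instance by Cauchy–Schwarz.

Lower bound. It is enough to use instances in which every position (level, chain) owns a private
pool of `d = numValues` even and `d` odd points. A forward query at a point reveals only the next
level of its chain, so each round reveals one level, and fewer than `c = b - 1` rounds do not reach
the ends of the chains except by guessing. Inverse queries would expose the ends at once.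

A classical witness of `k` bits is removed by pigeonhole: some witness serves a family of all-even
configurations of density at least `2^{-k}`. The hybrid argument (`hybrid_invariant`) keeps a
subfamily and one state close to the run on all its members. Before each round, `exists_spread`
fixes the chains about which the family says too much. Each fixed chain at least doubles the
relative density and each round at most halves it, so after `R` rounds at most `k + R` chains are
fixed. On the other chains the points are spread, hence for half of the family the round puts weight
`O(q / d)` on the unrevealed points. Ending every unfixed chain in an odd point of least accumulated
weight also goes unnoticed (`exists_indistinguishable`). The result is a NO instance accepted with
nearly the same probability, the error being of order `R √((8 + R) q / d)`, which the inequality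
between `l`, `α` and `β` makes small (`small_error`).

Diagonalization. A verifier with bounded queries thus fails at every large length, whatever the rest
of the oracle is. Only countably many verifiers are uniform (`countable_setOf_uniform`), because
stack machines reduce to finite tables and a description determines its circuit. So
`exists_diagonal` defeats all of them in one family. Polynomial-time verifiers are covered because
their descriptions, hence their rounds and queries, are polynomially bounded (`exists_length_le`).
Uniformity of the one-query verifier is shown with a small loop language compiled to stack machines.
-/

namespace InPlaceSep

/-! ### Pointer chains given by configurations -/

/-- The cyclic embedding of levels and chains given by the points `P`: level `0` of chain `j` is
`P (inl j)`, and level `i + 1` is selected by the configuration `u`. -/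
def chainEmb {c N M d : ℕ} (P : Fin N ⊕ ((Fin c × Fin N) × Fin d × Bool) ↪ Fin M)
    (u : Fin c × Fin N → Fin d × Bool) : Fin (c + 1) × Fin N ↪ Fin M where
  toFun p := Fin.cases (P (Sum.inl p.2)) (fun i => P (Sum.inr ((i, p.2), u (i, p.2)))) p.1
  inj' := by
    rintro ⟨a, j⟩ ⟨a', j'⟩ h
    induction a using Fin.cases with
    | zero =>
      induction a' using Fin.cases with
      | zero => simpa using h
      | succ i' => simp at h
    | succ i =>
      induction a' using Fin.cases with
      | zero => simp at h
      | succ i' =>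
        have h' : ((i, j), u (i, j)) = ((i', j'), u (i', j')) := Sum.inr_injective (P.injective h)
        have h1 := congrArg Prod.fst h'
        simp only [Prod.mk.injEq] at h1
        rw [h1.1, h1.2]

@[simp] lemma chainEmb_zero {c N M d : ℕ} (P : Fin N ⊕ ((Fin c × Fin N) × Fin d × Bool) ↪ Fin M)
    (u : Fin c × Fin N → Fin d × Bool) (j : Fin N) : chainEmb P u (0, j) = P (Sum.inl j) := rfl

@[simp] lemma chainEmb_succ {c N M d : ℕ} (P : Fin N ⊕ ((Fin c × Fin N) × Fin d × Bool) ↪ Fin M)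
    (u : Fin c × Fin N → Fin d × Bool) (i : Fin c) (j : Fin N) :
    chainEmb P u (i.succ, j) = P (Sum.inr ((i, j), u (i, j))) := rfl

/-- The permutation that moves every chain one level up, cyclically. -/
noncomputable def chainPerm {c N M d : ℕ} (P : Fin N ⊕ ((Fin c × Fin N) × Fin d × Bool) ↪ Fin M)
    (u : Fin c × Fin N → Fin d × Bool) : Equiv.Perm (Fin M) :=
  Equiv.Perm.viaEmbedding (Equiv.prodCongr (finRotate (c + 1)) (Equiv.refl (Fin N))) (chainEmb P u)

lemma chainPerm_apply {c N M d : ℕ} (P : Fin N ⊕ ((Fin c × Fin N) × Fin d × Bool) ↪ Fin M)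
    (u : Fin c × Fin N → Fin d × Bool) (a : Fin (c + 1)) (j : Fin N) :
    chainPerm P u (chainEmb P u (a, j)) = chainEmb P u (finRotate (c + 1) a, j) := by
  simp [chainPerm, Equiv.Perm.viaEmbedding_apply]

lemma chainPerm_apply_of_notMem {c N M d : ℕ}
    (P : Fin N ⊕ ((Fin c × Fin N) × Fin d × Bool) ↪ Fin M)
    (u : Fin c × Fin N → Fin d × Bool) (x : Fin M) (h : x ∉ Set.range (chainEmb P u)) :
    chainPerm P u x = x :=
  Equiv.Perm.viaEmbedding_apply_of_notMem _ _ _ h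

/-- The positions above level `t` of the chains outside `K`. -/
def unknown {c N : ℕ} (t : ℕ) (K : Finset (Fin N)) : Finset (Fin c × Fin N) :=
  Finset.univ.filter fun p => t ≤ (p.1 : ℕ) ∧ p.2 ∉ K

@[simp] lemma mem_unknown {c N : ℕ} {t : ℕ} {K : Finset (Fin N)} {p : Fin c × Fin N} :
    p ∈ unknown t K ↔ t ≤ (p.1 : ℕ) ∧ p.2 ∉ K := by simp [unknown]

/-- The image of a chain point is the next point of the same chain. If that next position lies in
`unknown (t + 1) K`, the point itself lies at a position of `unknown t K`, which `hx` excludes. Here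
forward access matters: preimages of level `0` would depend on the last level. -/
lemma chainPerm_eq_of_agree_of_mem {c N M d : ℕ}
    (P : Fin N ⊕ ((Fin c × Fin N) × Fin d × Bool) ↪ Fin M)
    (u u' : Fin c × Fin N → Fin d × Bool) (t : ℕ) (K : Finset (Fin N))
    (hag : ∀ p, p ∉ unknown (t + 1) K → u p = u' p) (x : Fin M)
    (hx : ∀ p ∈ unknown t K, x ≠ P (Sum.inr (p, u p)))
    (hr : x ∈ Set.range (chainEmb P u)) : chainPerm P u x = chainPerm P u' x := by
  obtain ⟨⟨a, j⟩, rfl⟩ := hr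
  have hmono : ∀ p, p ∉ unknown t K → u p = u' p := fun p hp => hag p fun h => hp (by
    simp only [mem_unknown] at h ⊢; exact ⟨by omega, h.2⟩)
  have e1 : chainEmb P u (a, j) = chainEmb P u' (a, j) := by
    induction a using Fin.cases with
    | zero => rfl
    | succ i =>
      have : (i, j) ∉ unknown t K := fun h => hx _ h rfl
      simp [hmono _ this]
  rw [chainPerm_apply, e1, chainPerm_apply]
  generalize hb : finRotate (c + 1) a = b
  induction b using Fin.cases with
  | zero => rfl
  | succ i =>
    suffices h : (i, j) ∉ unknown (t + 1) K by simp [hag _ h]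
    intro h
    -- Position `i` of a configuration is level `i + 1` of the chain, so its predecessor is level
    -- `i`.
    have ha : (a : ℕ) = i := by
      have h1 : finRotate (c + 1) i.castSucc = i.succ := by simp
      have : a = i.castSucc := (finRotate (c + 1)).injective (hb.trans h1.symm)
      simp [this]
    induction a using Fin.cases with
    | zero => simp only [mem_unknown] at h; simp at ha; omega
    | succ k =>
      have hk : (k, j) ∈ unknown t K := by
        simp only [mem_unknown, Fin.val_succ] at h ha ⊢
        exact ⟨by omega, h.2⟩
      exact hx _ hk rfl

/-- Two configurations that agree on all positions up to level `t + 1` and on the chains in `K`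
give permutations that differ only on points at the positions in `unknown t K`. -/
lemma chainPerm_eq_of_agree {c N M d : ℕ}
    (P : Fin N ⊕ ((Fin c × Fin N) × Fin d × Bool) ↪ Fin M)
    (u u' : Fin c × Fin N → Fin d × Bool) (t : ℕ) (K : Finset (Fin N))
    (hag : ∀ p, p ∉ unknown (t + 1) K → u p = u' p) (x : Fin M)
    (hx : ∀ p ∈ unknown t K, x ≠ P (Sum.inr (p, u p)))
    (hx' : ∀ p ∈ unknown t K, x ≠ P (Sum.inr (p, u' p))) : chainPerm P u x = chainPerm P u' x := by
  by_cases h : x ∈ Set.range (chainEmb P u)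
  · exact chainPerm_eq_of_agree_of_mem P u u' t K hag x hx h
  by_cases h' : x ∈ Set.range (chainEmb P u')
  · exact (chainPerm_eq_of_agree_of_mem P u' u t K (fun p hp => (hag p hp).symm) x hx' h').symm
  rw [chainPerm_apply_of_notMem P u x h, chainPerm_apply_of_notMem P u' x h']

/-! ### Counting -/

/-- All members of `Y` agree on `S`. -/
def AgreeOn {ι : Type*} {d : ℕ} (Y : Finset (ι → Fin d)) (S : Finset ι) : Prop :=
  ∀ f ∈ Y, ∀ g ∈ Y, ∀ p ∈ S, f p = g p

/-- Pigeonhole over the `d ^ S.card` restrictions to `S`, keeping the most frequent one. It serves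
both to fix a chain and to reveal a level. -/
lemma exists_agreeOn {ι : Type*} [Fintype ι] [DecidableEq ι] {d : ℕ} (Y : Finset (ι → Fin d))
    (S : Finset ι) (hY : Y.Nonempty) :
    ∃ Y' ⊆ Y, Y'.Nonempty ∧ AgreeOn Y' S ∧ Y.card ≤ Y'.card * d ^ S.card := by
  classical
  obtain ⟨f₀, hf₀⟩ := hY
  let r : (ι → Fin d) → (S → Fin d) := fun f p => f p
  obtain ⟨b, -, hb⟩ := Finset.exists_max_image (Finset.univ : Finset (S → Fin d))
    (fun b => (Y.filter fun f => r f = b).card) ⟨r f₀, Finset.mem_univ _⟩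
  have hcard : Y.card ≤ (Y.filter fun f => r f = b).card * d ^ S.card := by
    refine (Finset.card_le_mul_card_image Y _ fun x _ => hb x (Finset.mem_univ x)).trans ?_
    refine Nat.mul_le_mul_left _ ((Finset.card_le_univ _).trans ?_)
    simp
  refine ⟨Y.filter fun f => r f = b, Finset.filter_subset _ _, ?_, ?_, hcard⟩
  · rw [← Finset.card_pos]
    by_contra h
    have h0 : (Y.filter fun f => r f = b).card = 0 := by omega
    rw [h0, zero_mul] at hcard
    exact absurd (Finset.card_pos.2 ⟨f₀, hf₀⟩) (by omega)
  · intro f hf g hg p hp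
    have h1 := (Finset.mem_filter.1 hf).2.trans (Finset.mem_filter.1 hg).2.symm
    exact congrFun h1 ⟨p, hp⟩

/-- Restriction to `S` is injective on such a family. Against a lower bound on the density, this
limits the number of fixed chains. -/
lemma card_le_of_agreeOn {ι : Type*} [Fintype ι] [DecidableEq ι] {d : ℕ} (Y : Finset (ι → Fin d))
    (S : Finset ι) (h : AgreeOn Y Sᶜ) : Y.card ≤ d ^ S.card := by
  have : Y.card ≤ (Finset.univ : Finset (S → Fin d)).card := by
    refine Finset.card_le_card_of_injOn (fun f p => f p) (fun _ _ => by simp) ?_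
    intro f hf g hg hfg
    funext p
    by_cases hp : p ∈ S
    · exact congrFun hfg ⟨p, hp⟩
    · exact h f hf g hg p (by simpa using hp)
  simpa using this

/-- No value at a position in `U` is taken by more than a `2 / d` fraction of `Y`. -/
def Spread {ι : Type*} {d : ℕ} (Y : Finset (ι → Fin d)) (U : Finset ι) : Prop :=
  ∀ p ∈ U, ∀ x, d * (Y.filter fun f => f p = x).card ≤ 2 * Y.card

/-- Density increment. If some value at a free position is too frequent, that value and then the
remaining free positions of its chain are fixed, and the chain joins `K`. Conditioning keeps more
than a `2 / d` fraction while the free space shrinks by `d`, so the relative density doubles and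
pays for the factor `2 ^ K.card`. -/
lemma exists_spread {c N d : ℕ} (t A : ℕ) (K : Finset (Fin N))
    (Y : Finset (Fin c × Fin N → Fin d)) (hY : Y.Nonempty) (hag : AgreeOn Y (unknown t K)ᶜ)
    (hA : 2 ^ K.card * d ^ (unknown (c := c) t K).card ≤ A * Y.card) :
    ∃ K', K ⊆ K' ∧ ∃ Y' ⊆ Y, Y'.Nonempty ∧ AgreeOn Y' (unknown t K')ᶜ ∧ Spread Y' (unknown t K') ∧
      2 ^ K'.card * d ^ (unknown (c := c) t K').card ≤ A * Y'.card := by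
  by_cases hS : Spread Y (unknown t K)
  · exact ⟨K, subset_rfl, Y, subset_rfl, hY, hag, hS, hA⟩
  simp only [Spread, not_forall, not_le] at hS
  obtain ⟨p, hp, x, hx⟩ := hS
  set Y₁ := Y.filter fun f => f p = x with hY₁
  have hpK := (mem_unknown.1 hp).2
  have hY₁n : Y₁.Nonempty := by
    rw [← Finset.card_pos]; by_contra h
    have : Y₁.card = 0 := by omega
    rw [this] at hx; omega
  have hd : 0 < d := x.pos
  -- The free positions of the offending chain. Fixing those other than `p` costs at most `d` per
  -- position, which the smaller free space compensates.
  set C := (unknown t K).filter fun q : Fin c × Fin N => q.2 = p.2 with hC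
  have hpC : p ∈ C := by simp [hC, mem_unknown.1 hp]
  obtain ⟨Y₂, hY₂, hY₂n, hag₂, hcard₂⟩ := exists_agreeOn Y₁ (C.erase p) hY₁n
  have hsplit : (unknown (c := c) t K).card = (unknown (c := c) t (insert p.2 K)).card
      + ((C.erase p).card + 1) := by
    rw [Finset.card_erase_add_one hpC, hC, ← Finset.card_filter_add_card_filter_not (fun q => q.2 = p.2),
      add_comm]
    congr 2
    ext q
    simp only [Finset.mem_filter, mem_unknown, Finset.mem_insert, not_or]
    tauto
  have hag' : AgreeOn Y₂ (unknown t (insert p.2 K))ᶜ := by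
    intro f hf g hg q hq
    have hf₁ := Finset.mem_filter.1 (hY₂ hf)
    have hg₁ := Finset.mem_filter.1 (hY₂ hg)
    by_cases hqK : q ∈ unknown t K
    · by_cases hqp : q = p
      · rw [hqp, hf₁.2, hg₁.2]
      · refine hag₂ f hf g hg q ?_
        rw [Finset.mem_erase, hC, Finset.mem_filter]
        refine ⟨hqp, hqK, ?_⟩
        simp only [Finset.mem_compl, mem_unknown, Finset.mem_insert, not_or, not_and, not_not] at hq hqK
        by_contra h
        exact hqK.2 (hq hqK.1 h)
    · exact hag f hf₁.1 g hg₁.1 q (by simpa using hqK)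
  have hA' : 2 ^ (insert p.2 K).card * d ^ (unknown (c := c) t (insert p.2 K)).card
      ≤ A * Y₂.card := by
    rw [Finset.card_insert_of_notMem hpK]
    rw [hsplit] at hA
    set s := (C.erase p).card
    set m := (unknown (c := c) t (insert p.2 K)).card
    refine Nat.le_of_mul_le_mul_right (c := d ^ (s + 1)) ?_ (by positivity)
    calc 2 ^ (K.card + 1) * d ^ m * d ^ (s + 1) = 2 * (2 ^ K.card * d ^ (m + (s + 1))) := by ring
      _ ≤ 2 * (A * Y.card) := Nat.mul_le_mul_left _ hA
      _ = A * (2 * Y.card) := by ring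
      _ ≤ A * (d * (Y₂.card * d ^ s)) :=
        Nat.mul_le_mul_left _ (hx.le.trans (Nat.mul_le_mul_left _ hcard₂))
      _ = A * Y₂.card * d ^ (s + 1) := by ring
  obtain ⟨K', hK', Y', hY', h1, h2, h3, h4⟩ := exists_spread t A (insert p.2 K) Y₂ hY₂n hag' hA'
  exact ⟨K', (Finset.subset_insert _ _).trans hK', Y',
    hY'.trans (hY₂.trans (Finset.filter_subset _ _)), h1, h2, h3, h4⟩
termination_by N - K.card
decreasing_by
  have h1 : (insert p.2 K).card ≤ N := by simpa using Finset.card_le_univ (insert p.2 K)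
  have h2 : (insert p.2 K).card = K.card + 1 := Finset.card_insert_of_notMem (mem_unknown.1 hp).2
  omega

/-- At least half of a spread family puts little weight on the points at the positions in `U`. -/
lemma card_le_two_mul_card_light {ι : Type*} [Fintype ι] [DecidableEq ι] {d M : ℕ} (hd : 0 < d)
    (Y : Finset (ι → Fin d)) (U : Finset ι) (hS : Spread Y U) (pt : ι × Fin d → Fin M)
    (hpt : pt.Injective) (W : Fin M → ℝ) (hW : ∀ x, 0 ≤ W x) (q : ℝ) (hq : 0 < q)
    (hWq : ∑ x, W x ≤ q) :
    Y.card ≤ 2 * (Y.filter fun f => ∑ p ∈ U, W (pt (p, f p)) ≤ 4 * q / d).card := by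
  have hd' : (0 : ℝ) < d := by exact_mod_cast hd
  -- Double counting: each point is used by at most a `2 / d` fraction of `Y`, and the total weight
  -- is at most `q`, so the average is at most `2 * q / d`. Markov's inequality at twice this
  -- average leaves one half.
  have htot : ∑ f ∈ Y, ∑ p ∈ U, W (pt (p, f p)) ≤ 2 * Y.card * q / d := by
    calc ∑ f ∈ Y, ∑ p ∈ U, W (pt (p, f p))
        = ∑ p ∈ U, ∑ x : Fin d, W (pt (p, x)) * (Y.filter fun f => f p = x).card := by
          rw [Finset.sum_comm]
          refine Finset.sum_congr rfl fun p _ => ?_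
          rw [← Finset.sum_fiberwise Y (fun f => f p)]
          refine Finset.sum_congr rfl fun x _ => ?_
          rw [Finset.sum_congr rfl (g := fun _ => W (pt (p, x)))]
          · simp [mul_comm]
          · intro f hf; rw [(Finset.mem_filter.1 hf).2]
      _ ≤ ∑ p ∈ U, ∑ x : Fin d, W (pt (p, x)) * (2 * Y.card / d) := by
          refine Finset.sum_le_sum fun p hp => Finset.sum_le_sum fun x _ => ?_
          refine mul_le_mul_of_nonneg_left ?_ (hW _)
          rw [le_div_iff₀ hd', mul_comm]
          exact_mod_cast hS p hp x
      _ = (∑ z ∈ U ×ˢ (Finset.univ : Finset (Fin d)), W (pt z)) * (2 * Y.card / d) := by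
          rw [Finset.sum_product, Finset.sum_mul]
          refine Finset.sum_congr rfl fun p _ => ?_
          rw [Finset.sum_mul]
      _ ≤ q * (2 * Y.card / d) := by
          refine mul_le_mul_of_nonneg_right ?_ (by positivity)
          refine le_trans ?_ hWq
          rw [← Finset.sum_image (f := W) (g := pt) (fun _ _ _ _ h => hpt h)]
          exact Finset.sum_le_sum_of_subset_of_nonneg (Finset.subset_univ _) fun x _ _ => hW x
      _ = 2 * Y.card * q / d := by ring
  set Y₂ := Y.filter fun f => ∑ p ∈ U, W (pt (p, f p)) ≤ 4 * q / d
  set Y₃ := Y.filter fun f => ¬ ∑ p ∈ U, W (pt (p, f p)) ≤ 4 * q / d with hY₃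
  have hadd : Y₂.card + Y₃.card = Y.card := Finset.card_filter_add_card_filter_not _
  have h3 : Y₃.card * (4 * q / d) ≤ 2 * Y.card * q / d := by
    refine le_trans ?_ htot
    rw [← nsmul_eq_mul]
    refine le_trans (Finset.card_nsmul_le_sum Y₃ (fun f => ∑ p ∈ U, W (pt (p, f p))) _ ?_) ?_
    · intro f hf; exact (not_le.1 (Finset.mem_filter.1 hf).2).le
    · exact Finset.sum_le_sum_of_subset_of_nonneg (Finset.filter_subset _ _)
        fun f _ _ => Finset.sum_nonneg fun p _ => hW _
  have h4 : (2 * Y₃.card : ℝ) ≤ Y.card := by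
    have : 2 * (q / d) * (2 * Y₃.card) ≤ 2 * (q / d) * Y.card := by
      calc 2 * (q / d) * (2 * Y₃.card) = Y₃.card * (4 * q / d) := by ring
        _ ≤ _ := h3
        _ = _ := by ring
    exact le_of_mul_le_mul_left this (by positivity)
  have h5 : 2 * Y₃.card ≤ Y.card := by exact_mod_cast h4
  omega

end InPlaceSep

namespace InPlaceSep

/-! ### The hybrid argument -/

/-- The configuration with even points `f`, except for the odd points `w` on the last level of the
chains in `E`. -/
def flipped {c N d : ℕ} (f : Fin c × Fin N → Fin d) (E : Finset (Fin N)) (w : Fin N → Fin d) :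
    Fin c × Fin N → Fin d × Bool := fun p =>
  if (p.1 : ℕ) + 1 = c ∧ p.2 ∈ E then (w p.2, true) else (f p, false)

/-- A step of an algorithm that depends on a permutation and whose sensitivity to changes of the
permutation is controlled by the weights `W`. -/
structure QueryStep (M : ℕ) (H : Type*) [NormedAddCommGroup H] (q : ℝ) where
  op : Equiv.Perm (Fin M) → H → H
  W : H → Fin M → ℝ
  norm_op : ∀ π φ, ‖op π φ‖ = ‖φ‖
  norm_sub : ∀ π φ φ', ‖op π φ - op π φ'‖ = ‖φ - φ'‖
  W_nonneg : ∀ φ x, 0 ≤ W φ x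
  sum_W : ∀ φ, ‖φ‖ = 1 → ∑ x, W φ x ≤ q
  diff : ∀ π π' φ, ‖op π φ - op π' φ‖ ^ 2 ≤
    4 * ∑ x ∈ Finset.univ.filter fun x => π x ≠ π' x, W φ x

/-- Run the steps of an algorithm, the head of the list first. -/
def runSteps {M : ℕ} {H : Type*} [NormedAddCommGroup H] {q : ℝ} (rs : List (QueryStep M H q))
    (π : Equiv.Perm (Fin M)) (φ : H) : H :=
  rs.foldl (fun φ r => r.op π φ) φ

/-- The two permutations differ only at points on unknown positions of one of the configurations:
even points of `f` or `g`, or flipped ends `w`. As `t + 1 < c`, the last level is still unknown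
after this round, so flipping it does not break the agreement required by `chainPerm_eq_of_agree`.
-/
lemma sum_bad_le {c N M d : ℕ} (P : Fin N ⊕ ((Fin c × Fin N) × Fin d × Bool) ↪ Fin M)
    (f g : Fin c × Fin N → Fin d) (t : ℕ) (K E : Finset (Fin N)) (w : Fin N → Fin d)
    (hag : ∀ p, p ∉ unknown (t + 1) K → f p = g p) (ht : t + 1 < c) (hE : ∀ j ∈ E, j ∉ K)
    (W : Fin M → ℝ) (hW : ∀ x, 0 ≤ W x) (last : Fin c) (hlast : (last : ℕ) + 1 = c) :
    ∑ x ∈ Finset.univ.filter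
        (fun x => chainPerm P (flipped f E w) x ≠ chainPerm P (flipped g ∅ w) x), W x ≤
      ∑ p ∈ unknown t K, W (P (Sum.inr (p, (f p, false)))) +
      ∑ p ∈ unknown t K, W (P (Sum.inr (p, (g p, false)))) +
      ∑ j ∈ E, W (P (Sum.inr ((last, j), (w j, true)))) := by
  classical
  set A₁ := (unknown t K).image fun p => P (Sum.inr (p, (f p, false)))
  set A₂ := (unknown t K).image fun p => P (Sum.inr (p, (g p, false)))
  set A₃ := E.image fun j => P (Sum.inr ((last, j), (w j, true)))
  have hsub : (Finset.univ.filter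
      fun x => chainPerm P (flipped f E w) x ≠ chainPerm P (flipped g ∅ w) x) ⊆ A₁ ∪ A₂ ∪ A₃ := by
    intro x hx
    by_contra hn
    simp only [Finset.mem_union, not_or] at hn
    refine (Finset.mem_filter.1 hx).2 (chainPerm_eq_of_agree P _ _ t K ?_ x ?_ ?_)
    · intro p hp
      have h1 : ¬ ((p.1 : ℕ) + 1 = c ∧ p.2 ∈ E) := fun h => hp (by
        rw [mem_unknown]; exact ⟨by omega, hE _ h.2⟩)
      simp [flipped, h1, hag p hp]
    · intro p hp hxp
      by_cases h1 : (p.1 : ℕ) + 1 = c ∧ p.2 ∈ E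
      · refine hn.2 (Finset.mem_image.2 ⟨p.2, h1.2, ?_⟩)
        have : p = (last, p.2) := Prod.ext (Fin.ext (by simpa using by omega)) rfl
        rw [hxp, ← this]; simp [flipped, h1]
      · refine hn.1.1 (Finset.mem_image.2 ⟨p, hp, ?_⟩)
        rw [hxp]; simp [flipped, h1]
    · intro p hp hxp
      refine hn.1.2 (Finset.mem_image.2 ⟨p, hp, ?_⟩)
      rw [hxp]; simp [flipped]
  have him : ∀ {κ : Type} [DecidableEq κ] (s : Finset κ) (e : κ → Fin M), e.Injective →
      ∑ x ∈ s.image e, W x = ∑ k ∈ s, W (e k) := fun s e he =>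
    Finset.sum_image fun _ _ _ _ h => he h
  have hun : ∀ s t : Finset (Fin M), ∑ x ∈ s ∪ t, W x ≤ ∑ x ∈ s, W x + ∑ x ∈ t, W x := fun s t => by
    rw [← Finset.sum_union_inter]
    exact le_add_of_nonneg_right (Finset.sum_nonneg fun x _ => hW x)
  calc _ ≤ ∑ x ∈ A₁ ∪ A₂ ∪ A₃, W x :=
        Finset.sum_le_sum_of_subset_of_nonneg hsub fun x _ _ => hW x
    _ ≤ ∑ x ∈ A₁, W x + ∑ x ∈ A₂, W x + ∑ x ∈ A₃, W x :=
        (hun _ _).trans (add_le_add_left (hun _ _) _)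
    _ = _ := by
        rw [him _ _ ?_, him _ _ ?_, him _ _ ?_]
        · intro j j' h
          exact congrArg (fun z => z.1.2) (Sum.inr_injective (P.injective h))
        · intro j j' h; exact (Prod.mk.inj (Sum.inr_injective (P.injective h))).1
        · intro j j' h; exact (Prod.mk.inj (Sum.inr_injective (P.injective h))).1

/-- A single state `ψ` stands for all members of `Y` and all odd flips outside `K`. The flips stay
quantified because a good `w` can only be chosen at the end, from the accumulated weights `Wt`. Each
round reveals one level and costs a factor `2` in density. -/
lemma hybrid_invariant {c N M d : ℕ} (hd : 0 < d)
    (P : Fin N ⊕ ((Fin c × Fin N) × Fin d × Bool) ↪ Fin M)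
    {H : Type*} [NormedAddCommGroup H] {q : ℝ} (hq : 0 < q) (φ₀ : H) (hφ₀ : ‖φ₀‖ = 1)
    (last : Fin c) (hlast : (last : ℕ) + 1 = c) (A : ℕ)
    (Y₀ : Finset (Fin c × Fin N → Fin d)) (hY₀ : Y₀.Nonempty) (hA : d ^ (c * N) ≤ A * Y₀.card)
    (rs : List (QueryStep M H q)) (hrs : rs.length < c) :
    ∃ Y ⊆ Y₀, ∃ (K : Finset (Fin N)) (ψ : H) (Wt : Fin M → ℝ), Y.Nonempty ∧
      AgreeOn Y (unknown rs.length K)ᶜ ∧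
      2 ^ K.card * d ^ (unknown (c := c) rs.length K).card ≤ A * 2 ^ rs.length * Y.card ∧
      ‖ψ‖ = 1 ∧ (∀ x, 0 ≤ Wt x) ∧ ∑ x, Wt x ≤ rs.length * q ∧
      ∀ f ∈ Y, ∀ E : Finset (Fin N), (∀ j ∈ E, j ∉ K) → ∀ w : Fin N → Fin d,
        ‖runSteps rs (chainPerm P (flipped f E w)) φ₀ - ψ‖ ≤
          rs.length * (2 * √(8 * q / d + ∑ j ∈ E, Wt (P (Sum.inr ((last, j), (w j, true)))))) := by
  classical
  induction rs using List.reverseRecOn with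
  | nil =>
    refine ⟨Y₀, subset_rfl, ∅, φ₀, 0, hY₀, ?_, ?_, hφ₀, fun _ => le_rfl, by simp, ?_⟩
    · intro f _ g _ p hp; simp at hp
    · have : (unknown (c := c) 0 (∅ : Finset (Fin N))) = Finset.univ := by ext; simp
      simpa [this] using hA
    · intro f _ E _ w; simp [runSteps]
  | append_singleton rs r ih =>
    rw [List.length_append, List.length_singleton] at hrs ⊢
    set t := rs.length with ht
    obtain ⟨Y, hYs, K, ψ, Wt, hYn, hag, hcard, hψ, hWt, hWtq, hrun⟩ := ih (by omega)
    -- One round: spread the family, keep the half with little query weight on its own unknown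
    -- points, then fix the positions `D` that the round may reveal.
    obtain ⟨K', hKK', Y₁, hY₁, hY₁n, hag₁, hsp, hcard₁⟩ := exists_spread t _ K Y hYn hag hcard
    have hpt : (fun z : (Fin c × Fin N) × Fin d => P (Sum.inr (z.1, (z.2, false)))).Injective := by
      intro z z' h
      have := Sum.inr_injective (P.injective h)
      simp only [Prod.mk.injEq, and_true] at this
      exact Prod.ext this.1 this.2
    have hhalf := card_le_two_mul_card_light hd Y₁ (unknown t K') hsp _ hpt (r.W ψ)
      (r.W_nonneg ψ) q hq (r.sum_W ψ hψ)
    set Y₂ := Y₁.filter fun f => ∑ p ∈ unknown t K', r.W ψ (P (Sum.inr (p, (f p, false))))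
      ≤ 4 * q / d with hY₂
    have hY₂n : Y₂.Nonempty := by
      rw [← Finset.card_pos] at hY₁n ⊢; omega
    set D := (unknown (c := c) t K') \ unknown (t + 1) K'
    obtain ⟨Y₃, hY₃, hY₃n, hag₃, hcard₃⟩ := exists_agreeOn Y₂ D hY₂n
    have hDs : unknown (c := c) (t + 1) K' ⊆ unknown t K' := fun p hp => by
      rw [mem_unknown] at hp ⊢; exact ⟨by omega, hp.2⟩
    have hD : (unknown (c := c) t K').card = D.card + (unknown (c := c) (t + 1) K').card :=
      (Finset.card_sdiff_add_card_eq_card hDs).symm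
    obtain ⟨g, hg⟩ := hY₃n
    have hY₃Y : Y₃ ⊆ Y := hY₃.trans ((Finset.filter_subset _ _).trans hY₁)
    have hagn : AgreeOn Y₃ (unknown (t + 1) K')ᶜ := by
      intro f hf g hg p hp
      by_cases h : p ∈ unknown t K'
      · exact hag₃ f hf g hg p (Finset.mem_sdiff.2 ⟨h, by simpa using hp⟩)
      · exact hag₁ f ((Finset.filter_subset _ _) (hY₃ hf)) g ((Finset.filter_subset _ _) (hY₃ hg)) p
          (by simpa using h)
    -- The new reference state uses the permutation of an arbitrary survivor `g`. For `E = ∅` the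
    -- odd points play no role, so they are filled with `0`.
    refine ⟨Y₃, hY₃Y.trans hYs, K', r.op (chainPerm P (flipped g ∅ fun _ => ⟨0, hd⟩)) ψ,
      Wt + r.W ψ, ⟨g, hg⟩, hagn, ?_, (r.norm_op _ _).trans hψ,
      fun x => add_nonneg (hWt x) (r.W_nonneg ψ x), ?_, ?_⟩
    · rw [hD] at hcard₁
      refine Nat.le_of_mul_le_mul_right (c := d ^ D.card) ?_ (by positivity)
      calc 2 ^ K'.card * d ^ (unknown (c := c) (t + 1) K').card * d ^ D.card
          = 2 ^ K'.card * d ^ (D.card + (unknown (c := c) (t + 1) K').card) := by ring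
        _ ≤ A * 2 ^ t * Y₁.card := hcard₁
        _ ≤ A * 2 ^ t * (2 * (Y₃.card * d ^ D.card)) :=
          Nat.mul_le_mul_left _ (hhalf.trans (Nat.mul_le_mul_left _ hcard₃))
        _ = A * 2 ^ (t + 1) * Y₃.card * d ^ D.card := by ring
    · simp only [Pi.add_apply, Finset.sum_add_distrib]
      push_cast
      have := r.sum_W ψ hψ
      linarith
    · intro f hf E hE w
      have hold := hrun f (hY₃Y hf) E (fun j hj hjK => hE j hj (hKK' hjK)) w
      have hbad := sum_bad_le P f g t K' E w (fun p hp => hagn f hf g hg p (by simpa using hp))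
        (by omega) hE (r.W ψ) (r.W_nonneg ψ) last hlast
      have hf4 := (Finset.mem_filter.1 (hY₃ hf)).2
      have hg4 := (Finset.mem_filter.1 (hY₃ hg)).2
      have hdiff := r.diff (chainPerm P (flipped f E w)) (chainPerm P (flipped g ∅ w)) ψ
      have hempty : flipped g ∅ w = flipped g ∅ fun _ => ⟨0, hd⟩ := by
        funext p; simp [flipped]
      rw [hempty] at hbad hdiff
      set S₁ := ∑ j ∈ E, Wt (P (Sum.inr ((last, j), (w j, true)))) with hS₁
      set S₂ := ∑ j ∈ E, r.W ψ (P (Sum.inr ((last, j), (w j, true)))) with hS₂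
      have hS₁0 : 0 ≤ S₁ := Finset.sum_nonneg fun _ _ => hWt _
      have hS₂0 : 0 ≤ S₂ := Finset.sum_nonneg fun _ _ => r.W_nonneg _ _
      have hsum : ∑ j ∈ E, (Wt + r.W ψ) (P (Sum.inr ((last, j), (w j, true)))) = S₁ + S₂ := by
        simp [Finset.sum_add_distrib, hS₁, hS₂]
      rw [hsum]
      -- One share `4 * q / d` is for the points of `f`, the other for those of the reference `g`.
      have h8 : 8 * q / d = 4 * q / d + 4 * q / d := by ring
      set R := √(8 * q / d + (S₁ + S₂)) with hR
      have hpos : 0 ≤ 8 * q / d + (S₁ + S₂) := by positivity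
      have hnew : ‖r.op (chainPerm P (flipped f E w)) ψ
          - r.op (chainPerm P (flipped g ∅ fun _ => ⟨0, hd⟩)) ψ‖ ≤ 2 * R := by
        refine abs_le_of_sq_le_sq' ?_ (by positivity) |>.2
        rw [mul_pow, hR, Real.sq_sqrt hpos]
        refine hdiff.trans ?_
        nlinarith
      have hold' : ‖runSteps rs (chainPerm P (flipped f E w)) φ₀ - ψ‖ ≤ t * (2 * R) := by
        refine hold.trans ?_
        have : √(8 * q / d + S₁) ≤ R := Real.sqrt_le_sqrt (by linarith)
        gcongr
      have hstep : runSteps (rs ++ [r]) (chainPerm P (flipped f E w)) φ₀ =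
          r.op (chainPerm P (flipped f E w)) (runSteps rs (chainPerm P (flipped f E w)) φ₀) := by
        simp [runSteps]
      rw [hstep]
      calc _ ≤ ‖r.op (chainPerm P (flipped f E w)) (runSteps rs (chainPerm P (flipped f E w)) φ₀)
              - r.op (chainPerm P (flipped f E w)) ψ‖ +
            ‖r.op (chainPerm P (flipped f E w)) ψ
              - r.op (chainPerm P (flipped g ∅ fun _ => ⟨0, hd⟩)) ψ‖ :=
            norm_sub_le_norm_sub_add_norm_sub _ _ _
        _ ≤ t * (2 * R) + 2 * R := by rw [r.norm_sub]; exact add_le_add hold' hnew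
        _ = _ := by push_cast; ring

/-- In every dense family of configurations there is one that an algorithm of fewer than `c` steps
cannot distinguish from a configuration with odd last points on almost all chains. -/
theorem exists_indistinguishable {c N M d : ℕ} (hd : 0 < d)
    (P : Fin N ⊕ ((Fin c × Fin N) × Fin d × Bool) ↪ Fin M)
    {H : Type*} [NormedAddCommGroup H] {q : ℝ} (hq : 0 < q) (φ₀ : H) (hφ₀ : ‖φ₀‖ = 1) (a : ℕ)
    (Y₀ : Finset (Fin c × Fin N → Fin d)) (hA : d ^ (c * N) ≤ 2 ^ a * Y₀.card)
    (rs : List (QueryStep M H q)) (hrs : rs.length < c) :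
    ∃ f ∈ Y₀, ∃ (E : Finset (Fin N)) (w : Fin N → Fin d), N ≤ E.card + (a + rs.length) ∧
      ‖runSteps rs (chainPerm P (flipped f ∅ w)) φ₀ -
        runSteps rs (chainPerm P (flipped f E w)) φ₀‖ ≤
      4 * rs.length * √((8 + rs.length) * q / d) := by
  classical
  have hd' : (0 : ℝ) < d := by exact_mod_cast hd
  have hY₀ : Y₀.Nonempty := by
    rw [← Finset.card_pos]
    by_contra h
    have h0 : Y₀.card = 0 := by omega
    rw [h0, mul_zero] at hA
    have : 0 < d ^ (c * N) := by positivity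
    omega
  let last : Fin c := ⟨c - 1, by omega⟩
  have hlast : (last : ℕ) + 1 = c := by simp only [last]; omega
  obtain ⟨Y, hYs, K, ψ, Wt, ⟨f, hf⟩, hag, hcard, -, hWt, hWtq, hrun⟩ :=
    hybrid_invariant hd P hq φ₀ hφ₀ last hlast (2 ^ a) Y₀ hY₀ hA rs hrs
  -- A family that is constant off the free positions has at most `d ^ |unknown|` members, so the
  -- density bound leaves `2 ^ K.card ≤ 2 ^ (a + R)` for `R` rounds.
  have hKcard : K.card ≤ a + rs.length := by
    have h1 := card_le_of_agreeOn Y (unknown rs.length K) hag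
    have h2 := hcard.trans (Nat.mul_le_mul_left _ h1)
    have h3 := Nat.le_of_mul_le_mul_right h2 (by positivity)
    rw [← pow_add] at h3
    exact (Nat.pow_le_pow_iff_right (by norm_num)).1 h3
  -- An odd end of least weight carries at most the average over the `d` choices on its chain, so
  -- all chosen ends together carry at most a `1 / d` fraction of the total weight.
  have hmin : ∀ j : Fin N, ∃ x : Fin d, ∀ y : Fin d,
      Wt (P (Sum.inr ((last, j), (x, true)))) ≤ Wt (P (Sum.inr ((last, j), (y, true)))) := fun j => by
    obtain ⟨x, -, hx⟩ := Finset.exists_min_image (Finset.univ : Finset (Fin d))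
      (fun y => Wt (P (Sum.inr ((last, j), (y, true))))) ⟨⟨0, hd⟩, Finset.mem_univ _⟩
    exact ⟨x, fun y => hx y (Finset.mem_univ _)⟩
  choose w hw using hmin
  have hsum : ∀ E : Finset (Fin N), ∑ j ∈ E, Wt (P (Sum.inr ((last, j), (w j, true)))) ≤
      rs.length * q / d := by
    intro E
    rw [le_div_iff₀ hd', Finset.sum_mul]
    calc ∑ j ∈ E, Wt (P (Sum.inr ((last, j), (w j, true)))) * d
        ≤ ∑ j ∈ E, ∑ y : Fin d, Wt (P (Sum.inr ((last, j), (y, true)))) := by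
          refine Finset.sum_le_sum fun j _ => ?_
          have := Finset.card_nsmul_le_sum (Finset.univ : Finset (Fin d))
            (fun y => Wt (P (Sum.inr ((last, j), (y, true))))) _ fun y _ => hw j y
          simpa [mul_comm] using this
      _ = ∑ z ∈ E ×ˢ (Finset.univ : Finset (Fin d)),
            Wt (P (Sum.inr ((last, z.1), (z.2, true)))) := by rw [Finset.sum_product]
      _ ≤ ∑ x, Wt x := by
          rw [← Finset.sum_image (f := Wt)
            (g := fun z : Fin N × Fin d => P (Sum.inr ((last, z.1), (z.2, true))))]
          · exact Finset.sum_le_sum_of_subset_of_nonneg (Finset.subset_univ _) fun x _ _ => hWt x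
          · intro z _ z' _ h
            have := Sum.inr_injective (P.injective h)
            simp only [Prod.mk.injEq, and_true, true_and] at this
            exact Prod.ext this.1 this.2
      _ ≤ _ := hWtq
  -- Flip every unfixed chain. The runs for `E = ∅` and `E = Kᶜ` are both close to the same `ψ`.
  refine ⟨f, hYs hf, Kᶜ, w, ?_, ?_⟩
  · have := Finset.card_add_card_compl K
    rw [Fintype.card_fin] at this
    omega
  · have hb : ∀ E : Finset (Fin N), (∀ j ∈ E, j ∉ K) →
        ‖runSteps rs (chainPerm P (flipped f E w)) φ₀ - ψ‖ ≤
          rs.length * (2 * √((8 + rs.length) * q / d)) := by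
      intro E hE
      refine (hrun f hf E hE w).trans ?_
      have h1 := hsum E
      have h2 : (8 + rs.length) * q / d = 8 * q / d + rs.length * q / d := by ring
      rw [h2]
      gcongr
    have h1 := hb ∅ (by simp)
    have h2 := hb Kᶜ (fun j hj => by simpa using hj)
    rw [norm_sub_rev] at h2
    calc _ ≤ _ := norm_sub_le_norm_sub_add_norm_sub _ ψ _
      _ ≤ _ := add_le_add h1 h2
      _ = _ := by ring

end InPlaceSep

namespace InPlaceSep

/-! ### Gates and query rounds as norm-preserving maps -/

/-- The squared norm of an amplitude vector. -/
noncomputable def normSq {k : ℕ} (ψ : QState k) : ℝ := ∑ y, ‖ψ y‖ ^ 2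

lemma normSq_comp_equiv {k : ℕ} (ψ : QState k) (e : Equiv.Perm (Bits k)) :
    normSq (fun y => ψ (e y)) = normSq ψ :=
  Equiv.sum_comp e fun y => ‖ψ y‖ ^ 2

lemma norm_toLp_sq {k : ℕ} (ψ : QState k) : ‖WithLp.toLp 2 ψ‖ ^ 2 = normSq ψ := by
  rw [EuclideanSpace.norm_sq_eq]; rfl

/-- Adding to the label of the wire `t` a bit that does not depend on it. -/
def addBit {W : ℕ} (t : Fin W) (g : Bits W → Fin 2) (hg : ∀ y v, g (Function.update y t v) = g y) :
    Equiv.Perm (Bits W) :=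
  Function.Involutive.toPerm (fun y => Function.update y t (y t + g y)) fun y => by
    have : ∀ a b : Fin 2, a + b + b = a := by decide
    simp [hg, this]

lemma exists_addBit_toffoli {W : ℕ} (c₁ c₂ t : Fin W) (h₁ : c₁ ≠ t) (h₂ : c₂ ≠ t) :
    ∃ e : Equiv.Perm (Bits W), ∀ y, e y = Function.update y t (y t + y c₁ * y c₂) :=
  ⟨addBit t (fun y => y c₁ * y c₂) fun y v => by simp [h₁, h₂], fun _ => rfl⟩

lemma exists_addBit_cnot {W : ℕ} (c t : Fin W) (h : c ≠ t) :
    ∃ e : Equiv.Perm (Bits W), ∀ y, e y = Function.update y t (y t + y c) :=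
  ⟨addBit t (fun y => y c) fun y v => by simp [h], fun _ => rfl⟩

lemma exists_addBit_x {W : ℕ} (t : Fin W) :
    ∃ e : Equiv.Perm (Bits W), ∀ y, e y = Function.update y t (y t + 1) :=
  ⟨addBit t (fun _ => 1) fun _ _ => rfl, fun _ => rfl⟩

lemma norm_hadamard_sq (a b : ℂ) :
    ‖(1 / (√2 : ℂ)) * (a + b)‖ ^ 2 + ‖(1 / (√2 : ℂ)) * (a + -1 * b)‖ ^ 2
      = ‖a‖ ^ 2 + ‖b‖ ^ 2 := by
  have h2 : ‖(1 / (√2 : ℂ))‖ ^ 2 = 1 / 2 := by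
    rw [norm_div, norm_one, Complex.norm_real, div_pow, Real.norm_eq_abs, sq_abs,
      Real.sq_sqrt (by norm_num), one_pow]
  rw [norm_mul, norm_mul, mul_pow, mul_pow, h2]
  have h := parallelogram_law_with_norm ℝ a b
  have h' : a + -1 * b = a - b := by ring
  rw [h']; linarith

/-- Pairing each label with the one toggled at `i` reduces this to the parallelogram law. -/
lemma normSq_hadamard {W : ℕ} (i : Fin W) (ψ : QState W) :
    normSq ((Gate.H i).apply ψ) = normSq ψ := by
  obtain ⟨e, he⟩ := exists_addBit_x i
  have h1 : ∀ φ : QState W, 2 * normSq φ = ∑ y, (‖φ y‖ ^ 2 + ‖φ (e y)‖ ^ 2) := fun φ => by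
    rw [Finset.sum_add_distrib, Equiv.sum_comp e fun y => ‖φ y‖ ^ 2, two_mul]; rfl
  suffices h : 2 * normSq ((Gate.H i).apply ψ) = 2 * normSq ψ by linarith
  rw [h1, h1]
  refine Finset.sum_congr rfl fun y _ => ?_
  simp only [Gate.apply, he, Function.update_idem, Function.update_self]
  have h01 : ∀ v : Fin 2, v = 0 ∨ v = 1 := by decide
  have key := norm_hadamard_sq (ψ (Function.update y i 0)) (ψ (Function.update y i 1))
  rcases h01 (y i) with hv | hv
  · rw [hv]
    have e0 : ψ y = ψ (Function.update y i 0) := by rw [← hv, Function.update_eq_self]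
    simpa [e0] using key
  · rw [hv]
    have e0 : ψ y = ψ (Function.update y i 1) := by rw [← hv, Function.update_eq_self]
    rw [add_comm (‖ψ y‖ ^ 2), e0]
    have : (1 : Fin 2) + 1 = 0 := rfl
    rw [this, add_comm]
    simpa using key

lemma normSq_gate {W : ℕ} (g : Gate W) (ψ : QState W) : normSq (g.apply ψ) = normSq ψ := by
  cases g with
  | H i => exact normSq_hadamard i ψ
  | T i =>
    refine Finset.sum_congr rfl fun y _ => ?_
    have : ‖Complex.exp (Complex.I * Real.pi / 4)‖ = 1 := by
      have := Complex.norm_exp_ofReal_mul_I (Real.pi / 4)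
      rw [← this]; congr 2; push_cast; ring
    simp [Gate.apply, this]
  | X i =>
    obtain ⟨e, he⟩ := exists_addBit_x i
    have h := normSq_comp_equiv ψ e
    simp only [he] at h
    exact h
  | CNOT c t h =>
    obtain ⟨e, he⟩ := exists_addBit_cnot c t h
    have h := normSq_comp_equiv ψ e
    simp only [he] at h
    exact h
  | Toffoli c₁ c₂ t h h₁ h₂ =>
    obtain ⟨e, he⟩ := exists_addBit_toffoli c₁ c₂ t h₁ h₂
    have h := normSq_comp_equiv ψ e
    simp only [he] at h
    exact h

lemma gate_sub {W : ℕ} (g : Gate W) (ψ χ : QState W) :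
    g.apply (ψ - χ) = g.apply ψ - g.apply χ := by
  cases g <;> funext y <;> simp [Gate.apply] <;> ring

lemma normSq_applyGates {W : ℕ} (gs : List (Gate W)) (ψ : QState W) :
    normSq (applyGates gs ψ) = normSq ψ := by
  induction gs generalizing ψ with
  | nil => rfl
  | cons g gs ih => exact (ih (g.apply ψ)).trans (normSq_gate g ψ)

lemma applyGates_sub {W : ℕ} (gs : List (Gate W)) (ψ χ : QState W) :
    applyGates gs (ψ - χ) = applyGates gs ψ - applyGates gs χ := by
  induction gs generalizing ψ χ with
  | nil => rfl
  | cons g gs ih =>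
    have := ih (g.apply ψ) (g.apply χ)
    rw [← gate_sub] at this
    exact this

/-! ### Queries as permutations of basis labels -/

/-- The content of the register of a query. -/
def Query.reg {len : ℕ → ℕ} {W : ℕ} (Q : Query len W) (y : Bits W) : Fin (2 ^ len Q.m) :=
  finFunctionFinEquiv fun j => y (Q.wires j)

/-- Overwrite the register of a query. -/
noncomputable def Query.setReg {len : ℕ → ℕ} {W : ℕ} (Q : Query len W) (y : Bits W)
    (v : Fin (2 ^ len Q.m)) : Bits W :=
  Function.extend Q.wires (finFunctionFinEquiv.symm v) y

lemma Query.setReg_of_notMem {len : ℕ → ℕ} {W : ℕ} (Q : Query len W) (y : Bits W)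
    (v : Fin (2 ^ len Q.m)) (i : Fin W) (h : i ∉ Set.range Q.wires) : Q.setReg y v i = y i :=
  Function.extend_apply' _ _ _ (by simpa using h)

@[simp] lemma Query.reg_setReg {len : ℕ → ℕ} {W : ℕ} (Q : Query len W) (y : Bits W)
    (v : Fin (2 ^ len Q.m)) : Q.reg (Q.setReg y v) = v := by
  simp [Query.reg, Query.setReg, Q.wires.injective.extend_apply]

@[simp] lemma Query.setReg_setReg {len : ℕ → ℕ} {W : ℕ} (Q : Query len W) (y : Bits W)
    (v v' : Fin (2 ^ len Q.m)) : Q.setReg (Q.setReg y v) v' = Q.setReg y v' := by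
  funext i
  by_cases h : i ∈ Set.range Q.wires
  · obtain ⟨j, rfl⟩ := h
    simp [Query.setReg, Q.wires.injective.extend_apply]
  · simp [Query.setReg_of_notMem _ _ _ _ h]

@[simp] lemma Query.setReg_reg {len : ℕ → ℕ} {W : ℕ} (Q : Query len W) (y : Bits W) :
    Q.setReg y (Q.reg y) = y := by
  funext i
  by_cases h : i ∈ Set.range Q.wires
  · obtain ⟨j, rfl⟩ := h
    simp [Query.setReg, Query.reg, Q.wires.injective.extend_apply]
  · simp [Query.setReg_of_notMem _ _ _ _ h]

/-- The permutation of the basis states that a query performs. -/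
noncomputable def Query.act {len : ℕ → ℕ} {W : ℕ} (O : PermOracle len) (Q : Query len W) :
    Equiv.Perm (Bits W) where
  toFun y := Q.setReg y (O Q.m (Q.reg y))
  invFun y := Q.setReg y ((O Q.m).symm (Q.reg y))
  left_inv y := by simp
  right_inv y := by simp

lemma Query.apply_eq {len : ℕ → ℕ} {W : ℕ} (O : PermOracle len) (Q : Query len W) (ψ : QState W) :
    Q.apply O ψ = fun y => ψ ((Q.act O).symm y) := rfl

/-- The permutation of the basis states performed by a list of queries. -/
noncomputable def queriesAct {len : ℕ → ℕ} {W : ℕ} (O : PermOracle len) :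
    List (Query len W) → Equiv.Perm (Bits W)
  | [] => 1
  | Q :: qs => queriesAct O qs * Q.act O

lemma QueryLayer.apply_eq {len : ℕ → ℕ} {W : ℕ} (O : PermOracle len) (L : QueryLayer len W)
    (ψ : QState W) : L.apply O ψ = fun y => ψ ((queriesAct O L.queries).symm y) := by
  rw [QueryLayer.apply]
  generalize L.queries = qs
  induction qs generalizing ψ with
  | nil => rfl
  | cons Q qs ih => rw [List.foldl_cons, ih, Query.apply_eq]; rfl

/-- Since the registers are disjoint, an earlier query of the round does not change what a later one
reads; all of them read the original label `y`. -/
lemma queriesAct_congr {len : ℕ → ℕ} {W : ℕ} (O O' : PermOracle len) (qs : List (Query len W))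
    (hd : qs.Pairwise fun Q Q' => Disjoint (Set.range Q.wires) (Set.range Q'.wires)) (y : Bits W)
    (h : ∀ Q ∈ qs, O Q.m (Q.reg y) = O' Q.m (Q.reg y)) :
    queriesAct O qs y = queriesAct O' qs y := by
  induction qs generalizing y with
  | nil => rfl
  | cons Q qs ih =>
    rw [List.pairwise_cons] at hd
    have h1 : Q.act O y = Q.act O' y := by
      change Q.setReg y _ = Q.setReg y _
      rw [h Q List.mem_cons_self]
    simp only [queriesAct, Equiv.Perm.mul_apply, ← h1]
    refine ih hd.2 _ fun Q' hQ' => ?_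
    have h2 : Q'.reg (Q.act O y) = Q'.reg y := by
      simp only [Query.reg]
      congr 1
      funext j
      exact Q.setReg_of_notMem _ _ _ fun hr =>
        Set.disjoint_left.1 (hd.1 Q' hQ') hr (Set.mem_range_self j)
    rw [h2]
    exact h Q' (List.mem_cons_of_mem _ hQ')

/-- If `e` and `e'` agree at `e.symm y`, then `e'.symm y = e.symm y` and the difference vanishes.
Otherwise they disagree at both preimages, and `‖a - b‖² ≤ 2‖a‖² + 2‖b‖²` is summed over each
permutation separately. -/
lemma normSq_comp_symm_sub_le {W : ℕ} (ψ : QState W) (e e' : Equiv.Perm (Bits W)) :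
    normSq (fun y => ψ (e.symm y) - ψ (e'.symm y)) ≤
      4 * ∑ y, if e y = e' y then 0 else ‖ψ y‖ ^ 2 := by
  have h : ∀ y, ‖ψ (e.symm y) - ψ (e'.symm y)‖ ^ 2 ≤
      2 * (if e (e.symm y) = e' (e.symm y) then 0 else ‖ψ (e.symm y)‖ ^ 2) +
      2 * (if e (e'.symm y) = e' (e'.symm y) then 0 else ‖ψ (e'.symm y)‖ ^ 2) := by
    intro y
    by_cases h1 : e (e.symm y) = e' (e.symm y)
    · have : e'.symm y = e.symm y := by
        rw [Equiv.symm_apply_eq, ← h1, Equiv.apply_symm_apply]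
      rw [this]; simp [h1]
    · have h2 : ¬ e (e'.symm y) = e' (e'.symm y) := fun h2 => h1 (by
        have : e.symm y = e'.symm y := by
          rw [Equiv.symm_apply_eq, h2, Equiv.apply_symm_apply]
        rw [this, h2])
      rw [if_neg h1, if_neg h2]
      have h3 := norm_sub_le (ψ (e.symm y)) (ψ (e'.symm y))
      nlinarith [norm_nonneg (ψ (e.symm y) - ψ (e'.symm y)), norm_nonneg (ψ (e.symm y)),
        norm_nonneg (ψ (e'.symm y)), sq_nonneg (‖ψ (e.symm y)‖ - ‖ψ (e'.symm y)‖)]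
  refine (Finset.sum_le_sum fun y _ => h y).trans (le_of_eq ?_)
  rw [Finset.sum_add_distrib, ← Finset.mul_sum, ← Finset.mul_sum,
    Equiv.sum_comp e.symm fun z => if e z = e' z then (0 : ℝ) else ‖ψ z‖ ^ 2,
    Equiv.sum_comp e'.symm fun z => if e z = e' z then (0 : ℝ) else ‖ψ z‖ ^ 2]
  ring

/-! ### Query weights and sensitivity to the oracle -/

/-- The weight that the queries to the `n`-th oracle put on the point `x`. -/
noncomputable def queryWeight {len : ℕ → ℕ} {W : ℕ} (n : ℕ) (qs : List (Query len W))
    (ψ : QState W) (x : ℕ) : ℝ :=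
  (qs.map fun Q => ∑ y, if Q.m = n ∧ (Q.reg y : ℕ) = x then ‖ψ y‖ ^ 2 else 0).sum

lemma queryWeight_nonneg {len : ℕ → ℕ} {W : ℕ} (n : ℕ) (qs : List (Query len W))
    (ψ : QState W) (x : ℕ) : 0 ≤ queryWeight n qs ψ x := by
  refine List.sum_nonneg fun a ha => ?_
  obtain ⟨Q, -, rfl⟩ := List.mem_map.1 ha
  exact Finset.sum_nonneg fun y _ => by split_ifs <;> positivity

lemma sum_queryWeight {len : ℕ → ℕ} {W : ℕ} (n : ℕ) (qs : List (Query len W)) (ψ : QState W)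
    {M : ℕ} (S : Finset (Fin M)) :
    ∑ x ∈ S, queryWeight n qs ψ x =
      (qs.map fun Q => ∑ y, if Q.m = n ∧ ∃ x ∈ S, (Q.reg y : ℕ) = x then ‖ψ y‖ ^ 2 else 0).sum := by
  classical
  induction qs with
  | nil => simp [queryWeight]
  | cons Q qs ih =>
    simp only [queryWeight, List.map_cons, List.sum_cons, Finset.sum_add_distrib] at ih ⊢
    rw [ih, Finset.sum_comm]
    congr 1
    refine Finset.sum_congr rfl fun y _ => ?_
    by_cases hm : Q.m = n
    · by_cases hx : ∃ x ∈ S, (Q.reg y : ℕ) = x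
      · rw [if_pos ⟨hm, hx⟩]
        obtain ⟨x, hxS, hx⟩ := hx
        rw [Finset.sum_eq_single_of_mem x hxS]
        · rw [if_pos ⟨hm, hx⟩]
        · intro x' _ hne
          rw [if_neg fun h => hne (Fin.ext (h.2.symm.trans hx))]
      · rw [if_neg fun h => hx h.2]
        exact Finset.sum_eq_zero fun x hxS => if_neg fun h => hx ⟨x, hxS, h.2⟩
    · simp [hm]

lemma sum_queryWeight_le {len : ℕ → ℕ} {W : ℕ} (n : ℕ) (qs : List (Query len W)) (ψ : QState W)
    {M : ℕ} (S : Finset (Fin M)) :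
    ∑ x ∈ S, queryWeight n qs ψ x ≤ qs.length * normSq ψ := by
  classical
  rw [sum_queryWeight]
  have := List.sum_le_card_nsmul (qs.map fun Q => ∑ y,
    if Q.m = n ∧ ∃ x ∈ S, (Q.reg y : ℕ) = x then ‖ψ y‖ ^ 2 else 0) (normSq ψ) (by
      intro a ha
      obtain ⟨Q, -, rfl⟩ := List.mem_map.1 ha
      exact Finset.sum_le_sum fun y _ => by split_ifs <;> first | exact le_rfl | positivity)
  simpa using this

/-- A label treated differently by the two oracles has some query register on a point where `π` and
`π'` differ. A union bound over the queries of the round gives the weight. -/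
lemma QueryLayer.normSq_apply_sub_le {len : ℕ → ℕ} {W : ℕ} (n : ℕ) (O : PermOracle len)
    (π π' : Equiv.Perm (Fin (2 ^ len n))) (L : QueryLayer len W) (ψ : QState W) :
    normSq (L.apply (Function.update O n π) ψ - L.apply (Function.update O n π') ψ) ≤
      4 * ∑ x ∈ Finset.univ.filter fun x => π x ≠ π' x, queryWeight n L.queries ψ x := by
  classical
  simp only [QueryLayer.apply_eq]
  refine (normSq_comp_symm_sub_le ψ _ _).trans ?_
  rw [sum_queryWeight]
  refine mul_le_mul_of_nonneg_left ?_ (by norm_num)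
  have hsum : ∀ (qs : List (Query len W)) (F : Query len W → Bits W → ℝ),
      (qs.map fun Q => ∑ y, F Q y).sum = ∑ y, (qs.map fun Q => F Q y).sum := by
    intro qs F
    induction qs with
    | nil => simp
    | cons Q qs ih => simp [ih, Finset.sum_add_distrib]
  rw [hsum]
  refine Finset.sum_le_sum fun y _ => ?_
  have hnn : ∀ a ∈ L.queries.map fun Q => if Q.m = n ∧ ∃ x ∈ Finset.univ.filter
      (fun x => π x ≠ π' x), (Q.reg y : ℕ) = x then ‖ψ y‖ ^ 2 else 0, 0 ≤ a := by
    intro a ha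
    obtain ⟨Q, -, rfl⟩ := List.mem_map.1 ha
    split_ifs <;> positivity
  split_ifs with h
  · exact List.sum_nonneg hnn
  · have h1 : ∃ Q ∈ L.queries, Function.update O n π Q.m (Q.reg y) ≠
        Function.update O n π' Q.m (Q.reg y) := by
      by_contra hc
      push Not at hc
      exact h (queriesAct_congr _ _ _ L.disjoint y hc)
    obtain ⟨Q, hQ, hne⟩ := h1
    have hm : Q.m = n := by
      by_contra hm
      rw [Function.update_of_ne hm, Function.update_of_ne hm] at hne
      exact hne rfl
    refine List.single_le_sum hnn _ (List.mem_map.2 ⟨Q, hQ, if_pos ⟨hm, ?_⟩⟩)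
    obtain ⟨m, wires⟩ := Q
    subst hm
    simp only [Function.update_self] at hne
    exact ⟨_, by simpa using hne, rfl⟩

/-- A round of a circuit followed by its gates, as a function of the `n`-th permutation. -/
noncomputable def roundStep {len : ℕ → ℕ} {W : ℕ} (n : ℕ) (O : PermOracle len)
    (r : QueryLayer len W × List (Gate W)) {q : ℝ} (hq : (r.1.queries.length : ℝ) ≤ q) :
    QueryStep (2 ^ len n) (EuclideanSpace ℂ (Bits W)) q where
  op π φ := WithLp.toLp 2 (applyGates r.2 (r.1.apply (Function.update O n π) φ.ofLp))
  W φ x := queryWeight n r.1.queries φ.ofLp x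
  norm_op π φ := by
    rw [← sq_eq_sq₀ (norm_nonneg _) (norm_nonneg _), norm_toLp_sq, normSq_applyGates,
      QueryLayer.apply_eq, normSq_comp_equiv, ← norm_toLp_sq]
  norm_sub π φ φ' := by
    rw [← sq_eq_sq₀ (norm_nonneg _) (norm_nonneg _), ← WithLp.toLp_sub, norm_toLp_sq,
      ← applyGates_sub, normSq_applyGates, QueryLayer.apply_eq, QueryLayer.apply_eq,
      ← WithLp.toLp_ofLp 2 (φ - φ'), norm_toLp_sq]
    exact normSq_comp_equiv (φ.ofLp - φ'.ofLp) _
  W_nonneg φ x := queryWeight_nonneg _ _ _ _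
  sum_W φ hφ := by
    refine (sum_queryWeight_le n r.1.queries φ.ofLp Finset.univ).trans ?_
    rw [← norm_toLp_sq, WithLp.toLp_ofLp, hφ]
    simpa using hq
  diff π π' φ := by
    rw [← WithLp.toLp_sub, norm_toLp_sq, ← applyGates_sub, normSq_applyGates]
    exact r.1.normSq_apply_sub_le n O π π' φ.ofLp

lemma exists_roundSteps {len : ℕ → ℕ} {W : ℕ} (n : ℕ) (O : PermOracle len) {q : ℝ}
    (rs : List (QueryLayer len W × List (Gate W)))
    (hq : ∀ r ∈ rs, (r.1.queries.length : ℝ) ≤ q) :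
    ∃ ss : List (QueryStep (2 ^ len n) (EuclideanSpace ℂ (Bits W)) q), ss.length = rs.length ∧
      ∀ π ψ, runSteps ss π (WithLp.toLp 2 ψ) = WithLp.toLp 2 (rs.foldl
        (fun φ r => applyGates r.2 (r.1.apply (Function.update O n π) φ)) ψ) := by
  induction rs with
  | nil => exact ⟨[], rfl, fun _ _ => rfl⟩
  | cons r rs ih =>
    obtain ⟨ss, h1, h2⟩ := ih fun r' hr' => hq r' (List.mem_cons_of_mem _ hr')
    refine ⟨roundStep n O r (hq r List.mem_cons_self) :: ss, by simp [h1], fun π ψ => ?_⟩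
    rw [List.foldl_cons, ← h2]
    rfl

lemma sum_withAncillas {k : ℕ} (a : ℕ) (F : ℂ → ℝ) (hF : F 0 = 0) (ψ : QState k) :
    ∑ y, F (withAncillas a ψ y) = ∑ w, F (ψ w) := by
  classical
  rw [← Equiv.sum_comp (Fin.appendEquiv (α := Fin 2) k a), Fintype.sum_prod_type]
  refine Finset.sum_congr rfl fun w _ => ?_
  rw [Finset.sum_eq_single_of_mem (0 : Fin a → Fin 2) (Finset.mem_univ _)]
  · simp [withAncillas, Fin.appendEquiv]
  · intro b _ hb
    have : ¬ ∀ j, b j = 0 := fun h => hb (funext h)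
    simp [withAncillas, Fin.appendEquiv, this, hF]

lemma normSq_withAncillas {k : ℕ} (a : ℕ) (ψ : QState k) :
    normSq (withAncillas a ψ) = normSq ψ :=
  sum_withAncillas a (fun z => ‖z‖ ^ 2) (by simp) ψ

lemma normSq_basisState {k : ℕ} (w : Bits k) : normSq (basisState w) = 1 := by
  classical
  rw [normSq, Finset.sum_eq_single w]
  · simp [basisState]
  · intro y _ hy; simp [basisState, hy]
  · simp

/-- For the norms `a, b ≤ 1` of the projected states, `a² - b² = (a - b)(a + b)`, and projecting
does not increase distance. -/
lemma abs_prob_sub_le {W : ℕ} (ψ χ : QState W) (p : Bits W → Prop) [DecidablePred p]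
    (hψ : normSq ψ = 1) (hχ : normSq χ = 1) :
    (∑ y, if p y then ‖ψ y‖ ^ 2 else 0) - (∑ y, if p y then ‖χ y‖ ^ 2 else 0) ≤
      2 * ‖WithLp.toLp 2 ψ - WithLp.toLp 2 χ‖ := by
  let R : QState W → QState W := fun φ y => if p y then φ y else 0
  have hR : ∀ φ, (∑ y, if p y then ‖φ y‖ ^ 2 else 0) = ‖WithLp.toLp 2 (R φ)‖ ^ 2 := fun φ => by
    rw [norm_toLp_sq]
    refine Finset.sum_congr rfl fun y _ => ?_
    by_cases h : p y <;> simp [R, h]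
  have hle : ∀ φ, ‖WithLp.toLp 2 (R φ)‖ ≤ ‖WithLp.toLp 2 φ‖ := fun φ => by
    rw [← sq_le_sq₀ (norm_nonneg _) (norm_nonneg _), norm_toLp_sq, norm_toLp_sq]
    refine Finset.sum_le_sum fun y _ => ?_
    by_cases h : p y <;> simp [R, h]
  have h1 : ∀ φ : QState W, normSq φ = 1 → ‖WithLp.toLp 2 (R φ)‖ ≤ 1 := fun φ h => by
    refine (hle φ).trans ?_
    rw [← sq_le_sq₀ (norm_nonneg _) (by norm_num), norm_toLp_sq, h]; norm_num
  have h2 : ‖WithLp.toLp 2 (R ψ)‖ - ‖WithLp.toLp 2 (R χ)‖ ≤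
      ‖WithLp.toLp 2 ψ - WithLp.toLp 2 χ‖ := by
    refine (norm_sub_norm_le _ _).trans ?_
    have h3 : R ψ - R χ = R (ψ - χ) := by
      funext y; by_cases h : p y <;> simp [R, h]
    rw [← WithLp.toLp_sub, ← WithLp.toLp_sub, h3]
    exact hle _
  rw [hR, hR]
  have hψ1 := h1 ψ hψ
  have hχ1 := h1 χ hχ
  have a0 := norm_nonneg (WithLp.toLp 2 (R ψ))
  have b0 := norm_nonneg (WithLp.toLp 2 (R χ))
  have c0 := norm_nonneg (WithLp.toLp 2 ψ - WithLp.toLp 2 χ)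
  nlinarith

end InPlaceSep

namespace InPlaceSep

/-! ### Pointer chains from configurations -/

/-- The number of values available at every position of a chain. -/
noncomputable def numValues (l : ℕ) (α : ℝ) (n : ℕ) : ℕ := bucketSize l α n / (2 * 2 ^ n)

lemma numBuckets_eq (α : ℝ) (n : ℕ) : numBuckets α n = numBuckets α n - 1 + 1 := by
  have : 0 < numBuckets α n := Nat.ceil_pos.2 (by positivity)
  omega

/-- The values of the points that chains can use. -/
noncomputable def pointVal (l : ℕ) (α : ℝ) (n : ℕ) :
    Fin (2 ^ n) ⊕ ((Fin (numBuckets α n - 1) × Fin (2 ^ n)) × Fin (numValues l α n) × Bool) → ℕ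
  | Sum.inl j => j
  | Sum.inr ((i, j), x, s) =>
    -- Labels are values plus one and bucket sizes are even, so for `n ≠ 0` the flag `false` gives
    -- even labels and `true` odd ones.
    2 ^ n + i * bucketSize l α n + (2 * (j * numValues l α n + x) + if s then 0 else 1)

lemma pointVal_offset_lt (l : ℕ) (α : ℝ) (n : ℕ) (j : Fin (2 ^ n)) (x : Fin (numValues l α n))
    (s : Bool) : 2 * (j * numValues l α n + x) + (if s then 0 else 1) < bucketSize l α n := by
  have h1 : (j * numValues l α n + x : ℕ) < 2 ^ n * numValues l α n := by
    calc (j * numValues l α n + x : ℕ) < j * numValues l α n + numValues l α n := by omega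
      _ = (j + 1) * numValues l α n := by ring
      _ ≤ _ := Nat.mul_le_mul_right _ j.isLt
  have h2 : numValues l α n * (2 * 2 ^ n) ≤ bucketSize l α n := Nat.div_mul_le_self _ _
  have h3 : numValues l α n * (2 * 2 ^ n) = 2 * (2 ^ n * numValues l α n) := by ring
  split_ifs <;> omega

lemma mul_bucketSize_le (l : ℕ) (α : ℝ) (n : ℕ) :
    (numBuckets α n - 1) * bucketSize l α n ≤ 2 ^ (l * n) - 2 ^ n := by
  have h := Nat.div_mul_le_self (2 ^ (l * n) - 2 ^ n) (2 * (numBuckets α n - 1))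
  unfold bucketSize
  calc _ = (2 ^ (l * n) - 2 ^ n) / (2 * (numBuckets α n - 1)) * (2 * (numBuckets α n - 1)) := by
        ring
    _ ≤ _ := h

lemma pointVal_lt (l : ℕ) (hl : 1 ≤ l) (α : ℝ) (n : ℕ) (z) :
    pointVal l α n z < 2 ^ (l * n) := by
  have h0 : 2 ^ n ≤ 2 ^ (l * n) := Nat.pow_le_pow_right (by norm_num) (Nat.le_mul_of_pos_left n hl)
  rcases z with j | ⟨⟨i, j⟩, x, s⟩
  · exact j.isLt.trans_le h0
  · have h1 := pointVal_offset_lt l α n j x s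
    have h2 := mul_bucketSize_le l α n
    have h3 : (i + 1) * bucketSize l α n ≤ (numBuckets α n - 1) * bucketSize l α n :=
      Nat.mul_le_mul_right _ i.isLt
    simp only [pointVal]
    rw [add_mul] at h3
    omega

lemma pointVal_injective (l : ℕ) (α : ℝ) (n : ℕ) : (pointVal l α n).Injective := by
  rintro (j | ⟨⟨i, j⟩, x, s⟩) (j' | ⟨⟨i', j'⟩, x', s'⟩) h
  · exact congrArg _ (Fin.ext h)
  · simp only [pointVal] at h; omega
  · simp only [pointVal] at h; omega
  · simp only [pointVal] at h
    have h1 := pointVal_offset_lt l α n j x s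
    have h2 := pointVal_offset_lt l α n j' x' s'
    have hi : (i : ℕ) = i' := by
      rcases lt_trichotomy (i : ℕ) i' with hlt | heq | hlt
      · have := Nat.mul_le_mul_right (bucketSize l α n) hlt
        rw [Nat.succ_mul] at this; omega
      · exact heq
      · have := Nat.mul_le_mul_right (bucketSize l α n) hlt
        rw [Nat.succ_mul] at this; omega
    rw [hi] at h
    have hs : s = s' := by
      cases s <;> cases s' <;> simp at h ⊢ <;> omega
    subst hs
    have hj : (j : ℕ) = j' := by
      have hx := x.isLt
      have hx' := x'.isLt
      rcases lt_trichotomy (j : ℕ) j' with hlt | heq | hlt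
      · have := Nat.mul_le_mul_right (numValues l α n) hlt
        rw [Nat.succ_mul] at this; omega
      · exact heq
      · have := Nat.mul_le_mul_right (numValues l α n) hlt
        rw [Nat.succ_mul] at this; omega
    rw [hj] at h
    have hx : (x : ℕ) = x' := by omega
    rw [Fin.ext hi, Fin.ext hj, Fin.ext hx]

/-- The points that chains can use. -/
noncomputable def point (l : ℕ) (hl : 1 ≤ l) (α : ℝ) (n : ℕ) :
    Fin (2 ^ n) ⊕ ((Fin (numBuckets α n - 1) × Fin (2 ^ n)) × Fin (numValues l α n) × Bool) ↪
      Fin (2 ^ (l * n)) where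
  toFun z := ⟨pointVal l α n z, pointVal_lt l hl α n z⟩
  inj' _ _ h := pointVal_injective l α n (congrArg Fin.val h)

/-- The pointer chain of a configuration. -/
noncomputable def configChain (l : ℕ) (hl : 1 ≤ l) (α : ℝ) (n : ℕ)
    (u : Fin (numBuckets α n - 1) × Fin (2 ^ n) → Fin (numValues l α n) × Bool) :
    PointerChain l α n where
  f i j := chainEmb (point l hl α n) u (Fin.cast (numBuckets_eq α n) i, j)
  f_injective i j j' h := by simpa using (chainEmb (point l hl α n) u).injective h
  f_mem i j := by
    generalize hi : Fin.cast (numBuckets_eq α n) i = i'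
    have hv : (i : ℕ) = i' := by rw [← hi]; rfl
    rw [hv]
    induction i' using Fin.cases with
    | zero =>
      have := j.isLt
      simp [bucket, label, point, pointVal]
    | succ i' =>
      have h := pointVal_offset_lt l α n j (u (i', j)).1 (u (i', j)).2
      have h1 : (i' : ℕ) + 1 + 1 ≠ 1 := by omega
      have h2 : (i' : ℕ) + 1 + 1 - 2 = i' := by omega
      have h3 : (i' : ℕ) + 1 + 1 - 1 = i' + 1 := by omega
      simp only [bucket, label, point, pointVal, Fin.val_succ, chainEmb_succ, if_neg h1, h2, h3,
        Finset.mem_Icc, Function.Embedding.coeFn_mk, add_mul]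
      omega
  perm := chainPerm (point l hl α n) u
  perm_step i h j := by
    rw [chainPerm_apply]
    congr 2
    have : Fin.cast (numBuckets_eq α n) ⟨i, Nat.lt_of_succ_lt h⟩ =
      Fin.castSucc ⟨i, by omega⟩ := rfl
    rw [this, finRotate_apply, Fin.coeSucc_eq_succ]
    rfl
  perm_last i j h := by
    rw [chainPerm_apply]
    have : Fin.cast (numBuckets_eq α n) i = Fin.last _ := Fin.ext (by simp; omega)
    rw [this, finRotate_last]
    rfl
  perm_fixed x hx := chainPerm_apply_of_notMem _ _ _ (by
    rintro ⟨⟨a, j⟩, rfl⟩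
    exact hx (Fin.cast (numBuckets_eq α n).symm a) j rfl)

lemma PointerChain.evenCount_eq {l : ℕ} {α : ℝ} {n : ℕ} (C : PointerChain l α n)
    (last : Fin (numBuckets α n)) (h : (last : ℕ) + 1 = numBuckets α n) :
    C.evenCount = (Finset.univ.filter fun j => Even (label (C.f last j))).card := by
  rw [PointerChain.evenCount, ← Finset.card_image_of_injective _ (C.f_injective last),
    ← Set.ncard_coe_finset]
  congr 1
  ext x
  simp only [Set.mem_ofPred_eq, Finset.coe_image, Finset.coe_filter, Finset.mem_univ, true_and,
    Set.mem_image]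
  constructor
  · rintro ⟨⟨i, j, hi, rfl⟩, hx⟩
    have : i = last := Fin.ext (by omega)
    subst this
    exact ⟨j, hx, rfl⟩
  · rintro ⟨j, hj, rfl⟩
    exact ⟨⟨last, j, h, rfl⟩, hj⟩

lemma configChain_evenCount (l : ℕ) (hl : 1 ≤ l) (α : ℝ) (n : ℕ) (hn : n ≠ 0)
    (u : Fin (numBuckets α n - 1) × Fin (2 ^ n) → Fin (numValues l α n) × Bool)
    (last : Fin (numBuckets α n - 1)) (h : (last : ℕ) + 1 = numBuckets α n - 1) :
    (configChain l hl α n u).evenCount =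
      (Finset.univ.filter fun j => (u (last, j)).2 = false).card := by
  rw [PointerChain.evenCount_eq _ (Fin.cast (numBuckets_eq α n).symm last.succ) (by simp; omega)]
  congr 1
  ext j
  simp only [Finset.mem_filter, Finset.mem_univ, true_and]
  have h1 : (configChain l hl α n u).f (Fin.cast (numBuckets_eq α n).symm last.succ) j =
    point l hl α n (Sum.inr ((last, j), u (last, j))) := rfl
  rw [h1]
  have h2 : Even (2 ^ n) := (Nat.even_pow.2 ⟨even_two, hn⟩)
  have h3 : Even (bucketSize l α n) := even_two_mul _
  rcases hu : u (last, j) with ⟨x, s⟩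
  simp only [label, point, pointVal, Function.Embedding.coeFn_mk]
  have h4 := h3.mul_left (last : ℕ)
  cases s <;> simp [Nat.even_add, h2, h4, Nat.even_add_one]

lemma numBuckets_zero (α : ℝ) : numBuckets α 0 = 1 := by simp [numBuckets]

lemma not_isNo_of_isYes {l : ℕ} {α : ℝ} {n : ℕ} (C : PointerChain l α n) (h : C.IsYes) :
    ¬ C.IsNo := by
  have : 0 < 2 ^ n := by positivity
  simp only [PointerChain.IsYes, PointerChain.IsNo] at *
  omega

/-- For `n = 0` there is a single level with the single label `1`, which is odd. -/
lemma isNo_zero {l : ℕ} (hl : 1 ≤ l) {α : ℝ} (u) : (configChain l hl α 0 u).IsNo := by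
  rw [PointerChain.IsNo, PointerChain.evenCount_eq _ ⟨0, by simp [numBuckets_zero]⟩
    (by simp [numBuckets_zero])]
  rw [Finset.card_eq_zero.2]
  · simp
  · rw [Finset.filter_eq_empty_iff]
    intro j _
    have hj : (j : ℕ) = 0 := by have := j.isLt; simp at this; omega
    change ¬ Even ((j : ℕ) + 1)
    simp

lemma one_lt_numBuckets {α : ℝ} (hα : 0 < α) {n : ℕ} (hn : n ≠ 0) : 1 < numBuckets α n := by
  rw [numBuckets, Nat.lt_ceil]
  have : 0 < α * n := by positivity
  simpa using Real.one_lt_rpow (by norm_num : (1 : ℝ) < 2) this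

lemma numBuckets_sub_one_le {α : ℝ} (n : ℕ) : ((numBuckets α n - 1 : ℕ) : ℝ) ≤ 2 ^ (α * n) := by
  have h := Nat.ceil_lt_add_one (a := (2 : ℝ) ^ (α * n)) (by positivity)
  have h2 := numBuckets_eq α n
  have h3 : (numBuckets α n : ℝ) = (numBuckets α n - 1 : ℕ) + 1 := by exact_mod_cast h2
  unfold numBuckets at h3 ⊢
  linarith

lemma numBuckets_sub_one_le_two_pow {α : ℝ} (hα : α < 1 / 2) (n : ℕ) :
    numBuckets α n - 1 ≤ 2 ^ n := by
  have h := numBuckets_sub_one_le (α := α) n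
  have h2 : (2 : ℝ) ^ (α * n) ≤ 2 ^ (n : ℝ) := by
    refine Real.rpow_le_rpow_of_exponent_le (by norm_num) ?_
    nlinarith [(Nat.cast_nonneg n : (0 : ℝ) ≤ n)]
  rw [Real.rpow_natCast] at h2
  exact_mod_cast h.trans h2

/-- Writing `c = numBuckets α n - 1`, this amounts to `2 * N * c ≤ M - N`, which follows from `c ≤
N` and `N ^ 4 ≤ M`. -/
lemma numValues_pos {l : ℕ} (hl : 4 ≤ l) {α : ℝ} (hα₀ : 0 < α) (hα : α < 1 / 2) {n : ℕ}
    (hn : n ≠ 0) : 0 < numValues l α n := by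
  have h1 := numBuckets_sub_one_le_two_pow hα n
  have h2 := one_lt_numBuckets hα₀ hn
  have h3 : 2 ^ (4 * n) ≤ 2 ^ (l * n) := Nat.pow_le_pow_right (by norm_num)
    (Nat.mul_le_mul_right _ hl)
  have h4 : 2 ^ (4 * n) = 2 ^ n * 2 ^ n * (2 ^ n * 2 ^ n) := by ring
  have h5 : 2 ≤ 2 ^ n := Nat.le_self_pow hn 2
  refine Nat.div_pos (Nat.mul_le_mul_left 2 ?_) (by positivity)
  rw [Nat.le_div_iff_mul_le (by omega)]
  have h6 : 2 ^ n * (2 * (numBuckets α n - 1)) ≤ 2 ^ n * (2 * 2 ^ n) := by gcongr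
  have h7 : 4 * (2 ^ n * 2 ^ n) ≤ 2 ^ n * 2 ^ n * (2 ^ n * 2 ^ n) :=
    Nat.mul_le_mul_right _ (Nat.mul_le_mul h5 h5)
  have h8 : 2 ^ n * (2 * 2 ^ n) = 2 * (2 ^ n * 2 ^ n) := by ring
  have h9 : 2 ^ n ≤ 2 ^ n * 2 ^ n := Nat.le_mul_of_pos_left _ (by positivity)
  omega

/-- The instance of a configuration with even points only. -/
lemma configChain_isYes (l : ℕ) (hl : 1 ≤ l) {α : ℝ} (hα : 0 < α) {n : ℕ} (hn : n ≠ 0)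
    (f : Fin (numBuckets α n - 1) × Fin (2 ^ n) → Fin (numValues l α n))
    (w : Fin (2 ^ n) → Fin (numValues l α n)) :
    (configChain l hl α n (flipped f ∅ w)).IsYes := by
  have h1 := one_lt_numBuckets hα hn
  rw [PointerChain.IsYes, configChain_evenCount l hl α n hn _ ⟨numBuckets α n - 1 - 1, by omega⟩
    (by simp only; omega)]
  simp [flipped]

lemma configChain_isNo (l : ℕ) (hl : 1 ≤ l) {α : ℝ} (hα : 0 < α) {n : ℕ} (hn : n ≠ 0)
    (f : Fin (numBuckets α n - 1) × Fin (2 ^ n) → Fin (numValues l α n)) (E : Finset (Fin (2 ^ n)))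
    (w : Fin (2 ^ n) → Fin (numValues l α n)) (hE : 2 ^ n ≤ 2 * E.card) :
    (configChain l hl α n (flipped f E w)).IsNo := by
  classical
  have h1 := one_lt_numBuckets hα hn
  rw [PointerChain.IsNo, configChain_evenCount l hl α n hn _ ⟨numBuckets α n - 1 - 1, by omega⟩
    (by simp only; omega)]
  have h2 : numBuckets α n - 1 - 1 + 1 = numBuckets α n - 1 := by omega
  have h3 : (Finset.univ.filter fun j => (flipped f E w
      (⟨numBuckets α n - 1 - 1, by omega⟩, j)).2 = false) = Eᶜ := by
    ext j
    by_cases hj : j ∈ E <;> simp [flipped, h2, hj]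
  rw [h3]
  have := Finset.card_add_card_compl E
  rw [Fintype.card_fin] at this
  omega

lemma nonempty_pcInstance {l : ℕ} (hl : 4 ≤ l) {α : ℝ} (hα₀ : 0 < α) (hα : α < 1 / 2) (n : ℕ) :
    Nonempty (PCInstance l α n) := by
  have hl1 : 1 ≤ l := by omega
  by_cases hn : n = 0
  · subst hn
    have hE : IsEmpty (Fin (numBuckets α 0 - 1)) := by rw [numBuckets_zero]; exact Fin.isEmpty
    exact ⟨⟨configChain l hl1 α 0 fun p => hE.elim p.1, Or.inr (isNo_zero hl1 _)⟩⟩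
  · have := numValues_pos hl hα₀ hα hn
    exact ⟨⟨configChain l hl1 α n (flipped (fun _ => ⟨0, this⟩) ∅ fun _ => ⟨0, this⟩),
      Or.inl (configChain_isYes l hl1 hα₀ hn _ _)⟩⟩

end InPlaceSep

namespace InPlaceSep
open Filter Topology

/-! ### Lower bound for a single input length -/

lemma Circuit.normSq_start {len : ℕ → ℕ} {k : ℕ} (C : Circuit len k) (w : Bits k) :
    normSq (applyGates C.init (withAncillas C.ancillas (basisState w))) = 1 := by
  rw [normSq_applyGates, normSq_withAncillas, normSq_basisState]

/-- A circuit with too few rounds fails on some instance, whatever the rest of the oracle is. -/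
theorem exists_hard_instance {l : ℕ} (hl : 4 ≤ l) {α : ℝ} (hα₀ : 0 < α) (hα : α < 1 / 2) {n : ℕ}
    (hn : n ≠ 0) (O : PermOracle fun n => l * n) {k : ℕ} (C : Circuit (fun n => l * n) k) {q : ℝ}
    (hq : 0 < q) (hR : C.rounds.length ≤ numBuckets α n - 2)
    (hqC : ∀ r ∈ C.rounds, (r.1.queries.length : ℝ) ≤ q)
    (hK : 2 * (k + C.rounds.length) ≤ 2 ^ n)
    (hsmall : (8 * C.rounds.length) ^ 2 * ((8 + C.rounds.length) * q / numValues l α n) < 1 / 9) :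
    ∃ P : PCInstance l α n,
      (P.IsYes ∧ ∀ w, C.acceptProb (Function.update O n P.perm) (basisState w) < 2 / 3) ∨
      (P.IsNo ∧ ∃ w, 1 / 3 < C.acceptProb (Function.update O n P.perm) (basisState w)) := by
  classical
  by_contra hcon
  push Not at hcon
  have hl1 : 1 ≤ l := by omega
  have hd := numValues_pos hl hα₀ hα hn
  have hb := one_lt_numBuckets hα₀ hn
  let w₀ : Fin (2 ^ n) → Fin (numValues l α n) := fun _ => ⟨0, hd⟩
  have hyes : ∀ f, ∃ w, 2 / 3 ≤ C.acceptProb (Function.update O n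
      (chainPerm (point l hl1 α n) (flipped f ∅ w₀))) (basisState w) := fun f =>
    (hcon ⟨configChain l hl1 α n (flipped f ∅ w₀),
      Or.inl (configChain_isYes l hl1 hα₀ hn f w₀)⟩).1 (configChain_isYes l hl1 hα₀ hn f w₀)
  choose wit hwit using hyes
  -- Here the witness must be classical: there are only `2 ^ k` of them, so one serves a `2 ^ (-k)`
  -- fraction of all even configurations.
  obtain ⟨w, -, hw⟩ := Finset.exists_max_image (Finset.univ : Finset (Bits k))
    (fun w => (Finset.univ.filter fun f => wit f = w).card) ⟨0, Finset.mem_univ _⟩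
  have hcard := Finset.card_le_mul_card_image (Finset.univ) _ (f := wit)
    fun x _ => hw x (Finset.mem_univ x)
  have hcard' : numValues l α n ^ ((numBuckets α n - 1) * 2 ^ n) ≤
      2 ^ k * (Finset.univ.filter fun f => wit f = w).card := by
    have h1 : (Finset.univ.image wit).card ≤ 2 ^ k := (Finset.card_le_univ _).trans (by simp)
    have h2 := hcard.trans (Nat.mul_le_mul_left _ h1)
    rw [mul_comm] at h2
    simpa using h2
  obtain ⟨ss, hss, hrun⟩ := exists_roundSteps n O C.rounds hqC
  set start := applyGates C.init (withAncillas C.ancillas (basisState w)) with hstart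
  have hstart1 : normSq start = 1 := C.normSq_start w
  have hφ₀ : ‖WithLp.toLp 2 start‖ = 1 := by
    have := norm_toLp_sq start
    rw [hstart1] at this
    exact (pow_eq_one_iff_of_nonneg (norm_nonneg _) two_ne_zero).1 this
  obtain ⟨f, hf, E, v, hE, hdist⟩ := exists_indistinguishable hd (point l hl1 α n) hq _ hφ₀ k _ hcard'
    ss (by omega)
  have hNo := configChain_isNo l hl1 hα₀ hn f E v (by omega)
  have hNo' := (hcon ⟨configChain l hl1 α n (flipped f E v), Or.inr hNo⟩).2 hNo w
  have hYes' := hwit f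
  rw [(Finset.mem_filter.1 hf).2] at hYes'
  have hempty : flipped f ∅ w₀ = flipped f ∅ v := by funext p; simp [flipped]
  rw [hempty] at hYes'
  change C.acceptProb (Function.update O n (chainPerm (point l hl1 α n) (flipped f E v))) _ ≤ _ at hNo'
  rw [hrun, hrun, hss] at hdist
  have hn1 : ∀ π, normSq (C.run (Function.update O n π) (basisState w)) = 1 := fun π => by
    have h1 := hrun π start
    have h2 : ∀ (ss : List (QueryStep (2 ^ (l * n)) (EuclideanSpace ℂ (Bits (k + C.ancillas))) q)) φ,
        ‖runSteps ss π φ‖ = ‖φ‖ := by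
      intro ss
      induction ss with
      | nil => intro φ; rfl
      | cons s ss ih => intro φ; exact (ih _).trans (s.norm_op _ _)
    have h3 := h2 ss (WithLp.toLp 2 start)
    rw [h1] at h3
    rw [← norm_toLp_sq, ← hstart1, ← norm_toLp_sq]
    exact congrArg (· ^ 2) h3
  have hdiff := abs_prob_sub_le _ _ (fun y => y C.out = 1) (hn1 (chainPerm (point l hl1 α n)
    (flipped f ∅ v))) (hn1 (chainPerm (point l hl1 α n) (flipped f E v)))
  -- The constant is `8 = 2 * 4`, with `2` for passing from norms to probabilities and `4` from
  -- `exists_indistinguishable`; `1 / 3` is the gap between completeness and soundness.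
  have hsm : 8 * (C.rounds.length : ℝ) * √((8 + C.rounds.length) * q / numValues l α n) < 1 / 3 := by
    refine lt_of_pow_lt_pow_left₀ 2 (by norm_num) ?_
    rw [mul_pow, Real.sq_sqrt (by positivity)]
    linarith
  have hfin : C.acceptProb (Function.update O n (chainPerm (point l hl1 α n) (flipped f ∅ v)))
      (basisState w) - C.acceptProb (Function.update O n (chainPerm (point l hl1 α n)
      (flipped f E v))) (basisState w) ≤ 8 * (C.rounds.length : ℝ) *
      √((8 + C.rounds.length) * q / numValues l α n) := by
    refine hdiff.trans ?_
    have : 2 * ‖WithLp.toLp 2 (C.run (Function.update O n (chainPerm (point l hl1 α n)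
        (flipped f ∅ v))) (basisState w)) - WithLp.toLp 2 (C.run (Function.update O n
        (chainPerm (point l hl1 α n) (flipped f E v))) (basisState w))‖ ≤ 2 * (4 *
        C.rounds.length * √((8 + C.rounds.length) * q / numValues l α n)) :=
      mul_le_mul_of_nonneg_left hdist (by norm_num)
    linarith
  linarith

/-! ### Estimates -/

/-- Up to rounding, `numValues` is `(M - N) / (2 c N)` with `c ≤ 2 ^ (α n)`. The factor `8` collects
a `2` from `M ≤ 2 (M - N)`, a `2` from the floor and the `2` in the denominator. -/
lemma two_rpow_le_numValues {l : ℕ} (hl : 4 ≤ l) {α : ℝ} (hα₀ : 0 < α) (hα : α < 1 / 2) {n : ℕ}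
    (hn : n ≠ 0) : (2 : ℝ) ^ ((l - 1 - α) * n) ≤ 8 * numValues l α n := by
  have hd := numValues_pos hl hα₀ hα hn
  have hb := one_lt_numBuckets hα₀ hn
  set c := numBuckets α n - 1 with hc
  have hc0 : 0 < c := by omega
  have h1 : numValues l α n = (2 ^ (l * n) - 2 ^ n) / (2 * c * 2 ^ n) := by
    rw [numValues, bucketSize, Nat.mul_div_mul_left _ _ (by norm_num), Nat.div_div_eq_div_mul]
  have h2 : 2 ^ (l * n) - 2 ^ n < (numValues l α n + 1) * (2 * c * 2 ^ n) := by
    rw [h1]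
    have := Nat.lt_mul_div_succ (2 ^ (l * n) - 2 ^ n) (b := 2 * c * 2 ^ n) (by positivity)
    linarith
  have h3 : 2 * 2 ^ n ≤ 2 ^ (l * n) := by
    rw [← pow_succ']
    refine Nat.pow_le_pow_right (by norm_num) ?_
    have : 4 * n ≤ l * n := Nat.mul_le_mul_right _ hl
    omega
  have h4 : 2 ^ (l * n) ≤ 2 * ((numValues l α n + 1) * (2 * c * 2 ^ n)) := by omega
  have h5 : (numValues l α n + 1) * (2 * c * 2 ^ n) ≤
      2 * numValues l α n * (2 * c * 2 ^ n) := Nat.mul_le_mul_right _ (by omega)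
  have h6 : (2 : ℝ) ^ (l * n) ≤ 8 * numValues l α n * (c * 2 ^ n) := by
    have : 2 ^ (l * n) ≤ 8 * numValues l α n * (c * 2 ^ n) := by
      calc _ ≤ 2 * (2 * numValues l α n * (2 * c * 2 ^ n)) := by omega
        _ = _ := by ring
    exact_mod_cast this
  have h7 : (c : ℝ) ≤ 2 ^ (α * n) := numBuckets_sub_one_le n
  have h8 : (2 : ℝ) ^ (l * n) ≤ 8 * numValues l α n * (2 ^ (α * n) * 2 ^ n) := by
    refine h6.trans ?_
    gcongr
  have h9 : ((l : ℝ) - 1 - α) * n = ((l * n : ℕ) : ℝ) - (α * n + n) := by push_cast; ring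
  rw [h9, Real.rpow_sub (by norm_num), Real.rpow_natCast, Real.rpow_add (by norm_num),
    Real.rpow_natCast, div_le_iff₀ (by positivity)]
  exact h8

/-- With `T ≤ 2 ^ (α n)` the numerator is at most `576 * 2 ^ ((3 α + β) n)`. The condition on the
exponents leaves a spare factor `2 ^ n` below `8 * numValues`, and `n ≥ 16` suffices because `9 * 8
* 576 < 2 ^ 16`. -/
lemma small_error {l : ℕ} (hl : 4 ≤ l) {α β : ℝ} (hα₀ : 0 < α) (hα : α < 1 / 2)
    (hαβ : β + 5 * α < (l : ℝ) - 2) {n T : ℕ} (hn : 16 ≤ n) (hT : T ≤ numBuckets α n - 2) :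
    (8 * T : ℝ) ^ 2 * ((8 + T) * (2 : ℝ) ^ (β * n) / numValues l α n) < 1 / 9 := by
  have hd := numValues_pos hl hα₀ hα (by omega : n ≠ 0)
  have hd' : (0 : ℝ) < numValues l α n := by exact_mod_cast hd
  have hv := two_rpow_le_numValues hl hα₀ hα (by omega : n ≠ 0)
  have hn0 : (0 : ℝ) ≤ n := Nat.cast_nonneg n
  set t : ℝ := 2 ^ (α * n) with ht
  have ht1 : 1 ≤ t := Real.one_le_rpow (by norm_num) (by positivity)
  have hTt : (T : ℝ) ≤ t := by
    refine le_trans ?_ (numBuckets_sub_one_le n)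
    exact_mod_cast (by omega : T ≤ numBuckets α n - 1)
  have h1 : (8 * T : ℝ) ^ 2 * ((8 + T) * (2 : ℝ) ^ (β * n)) ≤ (8 * t) ^ 2 * ((9 * t) * 2 ^ (β * n)) := by
    gcongr
    linarith
  have h2 : (8 * t) ^ 2 * ((9 * t) * 2 ^ (β * n)) = 576 * 2 ^ ((3 * α + β) * n) := by
    have : (2 : ℝ) ^ ((3 * α + β) * n) = t * t * t * 2 ^ (β * n) := by
      rw [ht, ← Real.rpow_add (by norm_num), ← Real.rpow_add (by norm_num),
        ← Real.rpow_add (by norm_num)]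
      congr 1; ring
    rw [this]; ring
  have h3 : (2 : ℝ) ^ ((3 * α + β) * n) * 2 ^ n ≤ 2 ^ ((l - 1 - α) * n) := by
    rw [← Real.rpow_natCast 2 n, ← Real.rpow_add (by norm_num)]
    refine Real.rpow_le_rpow_of_exponent_le (by norm_num) ?_
    nlinarith
  have h4 : (2 : ℝ) ^ 16 ≤ 2 ^ n := pow_le_pow_right₀ (by norm_num) hn
  rw [← mul_div_assoc, div_lt_iff₀ hd']
  have h5 : (0 : ℝ) < 2 ^ ((3 * α + β) * n) := by positivity
  have h6 : (2 : ℝ) ^ ((3 * α + β) * n) * 2 ^ 16 ≤ 8 * numValues l α n :=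
    (mul_le_mul_of_nonneg_left h4 h5.le).trans (h3.trans hv)
  rw [h2] at h1
  linarith

lemma tendsto_polynomial_div_pow (p : Polynomial ℕ) {r : ℝ} (hr : 1 < r) :
    Tendsto (fun n : ℕ => ((p.eval n : ℕ) : ℝ) / r ^ n) atTop (𝓝 0) := by
  induction p using Polynomial.induction_on' with
  | add p q hp hq => simpa [add_div] using hp.add hq
  | monomial m a =>
    have := (tendsto_pow_const_div_const_pow_of_one_lt m hr).const_mul (a : ℝ)
    simpa [Polynomial.eval_monomial, mul_div_assoc] using this

lemma eventually_polynomial_le (p : Polynomial ℕ) {γ : ℝ} (hγ : 0 < γ) :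
    ∀ᶠ n : ℕ in atTop, ((p.eval n : ℕ) : ℝ) ≤ 2 ^ (γ * n) := by
  have hr : (1 : ℝ) < 2 ^ γ := Real.one_lt_rpow (by norm_num) hγ
  have h := (tendsto_polynomial_div_pow p hr).eventually (eventually_le_nhds (zero_lt_one))
  filter_upwards [h] with n hn
  rw [div_le_one (by positivity)] at hn
  rwa [Real.rpow_mul (by norm_num), Real.rpow_natCast]

/-- For every large input length and every circuit whose queries are bounded as in the theorem,
there is an instance on which the circuit fails. -/
theorem eventually_exists_hard_instance {l : ℕ} (hl : 4 ≤ l) {α β : ℝ} (hα₀ : 0 < α)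
    (hα : α < 1 / 2) (hαβ : β + 5 * α < (l : ℝ) - 2) (p : Polynomial ℕ) :
    ∀ᶠ n : ℕ in atTop, ∀ (O : PermOracle fun n => l * n) (C : Circuit (fun n => l * n) (p.eval n)),
      C.rounds.length ≤ numBuckets α n - 2 →
      (∀ r ∈ C.rounds, (r.1.queries.length : ℝ) ≤ 2 ^ (β * n)) →
      ∃ P : PCInstance l α n,
        (P.IsYes ∧ ∀ w, C.acceptProb (Function.update O n P.perm) (basisState w) < 2 / 3) ∨
        (P.IsNo ∧ ∃ w, 1 / 3 < C.acceptProb (Function.update O n P.perm) (basisState w)) := by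
  filter_upwards [eventually_ge_atTop 16, eventually_polynomial_le (4 * p) one_pos] with n hn hp O C hR hq
  have hn0 : n ≠ 0 := by omega
  refine exists_hard_instance hl hα₀ hα hn0 O C (by positivity) hR hq ?_
    (small_error hl hα₀ hα hαβ hn hR)
  have h1 : 4 * p.eval n ≤ 2 ^ n := by
    rw [one_mul, Real.rpow_natCast] at hp
    have : ((4 * p).eval n : ℕ) = 4 * p.eval n := by simp
    rw [this] at hp
    exact_mod_cast hp
  have h2 : 4 * C.rounds.length ≤ 2 ^ n := by
    have h3 : (C.rounds.length : ℝ) ≤ 2 ^ (α * n) := by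
      refine le_trans ?_ (numBuckets_sub_one_le n)
      exact_mod_cast (by omega : C.rounds.length ≤ numBuckets α n - 1)
    have h4 : (4 : ℝ) * 2 ^ (α * n) ≤ 2 ^ n := by
      have : (4 : ℝ) = 2 ^ (2 : ℝ) := by norm_num
      rw [this, ← Real.rpow_add (by norm_num), ← Real.rpow_natCast]
      refine Real.rpow_le_rpow_of_exponent_le (by norm_num) ?_
      have : (16 : ℝ) ≤ n := by exact_mod_cast hn
      nlinarith
    have : (4 * C.rounds.length : ℝ) ≤ 2 ^ n := by linarith
    exact_mod_cast this
  omega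

end InPlaceSep

namespace InPlaceSep
open Filter Topology

/-! ### Diagonalization -/

/-- All queries of the circuit are to oracles with index less than `s`. -/
def Circuit.QueriesBelow {len : ℕ → ℕ} {k : ℕ} (C : Circuit len k) (s : ℕ) : Prop :=
  ∀ r ∈ C.rounds, ∀ Q ∈ r.1.queries, Q.m < s

lemma Circuit.exists_queriesBelow {len : ℕ → ℕ} {k : ℕ} (C : Circuit len k) :
    ∃ s, C.QueriesBelow s := by
  let ms := C.rounds.flatMap fun r => r.1.queries.map Query.m
  refine ⟨ms.sum + 1, fun r hr Q hQ => Nat.lt_succ_of_le (List.le_sum_of_mem ?_)⟩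
  exact List.mem_flatMap.2 ⟨r, hr, List.mem_map.2 ⟨Q, hQ, rfl⟩⟩

lemma Circuit.acceptProb_congr {len : ℕ → ℕ} {k : ℕ} (C : Circuit len k) {s : ℕ}
    (hs : C.QueriesBelow s) {O O' : PermOracle len} (h : ∀ m < s, O m = O' m) (ψ : QState k) :
    C.acceptProb O ψ = C.acceptProb O' ψ := by
  have hfold : ∀ {β γ : Type} (g g' : β → γ → β) (cs : List γ) (b : β),
      (∀ c ∈ cs, ∀ b, g b c = g' b c) → cs.foldl g b = cs.foldl g' b := fun g g' cs b h =>
    List.foldl_ext g g' b fun b c hc => h c hc b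
  have : C.run O ψ = C.run O' ψ := by
    refine hfold _ _ _ _ fun r hr φ => ?_
    congr 1
    refine hfold _ _ _ _ fun Q hQ φ => ?_
    funext y
    simp only [Query.apply, h Q.m (hs r hr Q hQ)]
  rw [Circuit.acceptProb, this, Circuit.acceptProb]

/-- The verifier fails on some instance of size `n`, whatever the rest of the oracle is. -/
def Verifier.FailsAt {l : ℕ} (α : ℝ) (V : Verifier fun n => l * n) (n : ℕ) : Prop :=
  ∀ O : PermOracle fun n => l * n, ∃ P : PCInstance l α n,
    (P.IsYes ∧ ∀ w, V.acceptProb (Function.update O n P.perm) (List.replicate n true)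
      (basisState w) < 2 / 3) ∨
    (P.IsNo ∧ ∃ w, 1 / 3 < V.acceptProb (Function.update O n P.perm) (List.replicate n true)
      (basisState w))

lemma oracle_update {l : ℕ} {α : ℝ} (P : ∀ n, PCInstance l α n) (n : ℕ) (X : PCInstance l α n) :
    oracle (Function.update P n X) = Function.update (oracle P) n X.perm := by
  funext m
  by_cases h : m = n
  · subst h; simp [oracle]
  · simp [oracle, h]

lemma replicate_mem_lang {l : ℕ} {α : ℝ} (P : ∀ n, PCInstance l α n) (n : ℕ) :
    List.replicate n true ∈ lang P ↔ (P n).IsYes := by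
  constructor
  · rintro ⟨m, hm, h⟩
    have : n = m := by simpa using congrArg List.length hm
    rwa [this]
  · exact fun h => ⟨n, rfl, h⟩

/-- Stage `i` chooses the instance of size `nn i` on which `V i` fails. The sizes grow so fast that
the circuit of `V i` for that input queries no oracle changed at a later stage, so the failure
survives. -/
theorem exists_diagonal {l : ℕ} {α : ℝ} (P₀ : ∀ n, PCInstance l α n)
    (V : ℕ → Verifier fun n => l * n) (hV : ∀ i, ∀ᶠ n in atTop, (V i).FailsAt α n) :
    ∃ P : ∀ n, PCInstance l α n, ∀ i, ¬ (V i).VerifiesQCMA (oracle P) (lang P) := by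
  classical
  choose thr hthr using fun i => eventually_atTop.1 (hV i)
  choose mx hmx using fun i n => ((V i).circ (List.replicate n true)).exists_queriesBelow
  let nn : ℕ → ℕ := fun i => Nat.rec (thr 0)
    (fun i m => max (thr (i + 1)) (max (m + 1) (mx i m))) i
  have hnn : ∀ i, nn (i + 1) = max (thr (i + 1)) (max (nn i + 1) (mx i (nn i))) := fun i => rfl
  have hthr' : ∀ i, thr i ≤ nn i := fun i => by
    cases i with
    | zero => exact le_rfl
    | succ i => rw [hnn]; exact le_max_left _ _
  have hlt : ∀ i, nn i < nn (i + 1) := fun i => by rw [hnn]; omega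
  have hmono : StrictMono nn := strictMono_nat_of_lt_succ hlt
  choose X hX using fun i (F : ∀ n, PCInstance l α n) => hthr i (nn i) (hthr' i) (oracle F)
  let Fam : ℕ → ∀ n, PCInstance l α n := fun i =>
    Nat.rec P₀ (fun i F => Function.update F (nn i) (X i F)) i
  have hFam : ∀ i, Fam (i + 1) = Function.update (Fam i) (nn i) (X i (Fam i)) := fun i => rfl
  have hstable : ∀ m j, ∀ s, (∀ i, j ≤ i → nn i ≠ m) → Fam (j + s) m = Fam j m := by
    intro m j s h
    induction s with
    | zero => rfl
    | succ s ih =>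
      rw [← add_assoc, hFam, Function.update_of_ne (h _ (by omega)).symm, ih]
  -- As `nn` is strictly increasing, `j ≤ nn j`, so the instance of size `n` no longer changes after
  -- stage `n`.
  refine ⟨fun n => Fam (n + 1) n, fun i hver => ?_⟩
  have hP : ∀ m, m < nn (i + 1) → Fam (m + 1) m = Fam (i + 1) m := by
    intro m hm
    rcases le_total m i with hmi | hmi
    · obtain ⟨s, rfl⟩ := Nat.exists_eq_add_of_le hmi
      rw [show m + s + 1 = m + 1 + s by omega, hstable m (m + 1) s]
      intro j hj
      have := hmono.le_apply (x := j)
      omega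
    · obtain ⟨s, rfl⟩ := Nat.exists_eq_add_of_le hmi
      rw [show i + s + 1 = i + 1 + s by omega, hstable (i + s) (i + 1) s]
      intro j hj
      have := hmono.monotone hj
      omega
  set P : ∀ n, PCInstance l α n := fun n => Fam (n + 1) n with hPdef
  have hPn : P (nn i) = X i (Fam i) := by
    have := hP (nn i) (hlt i)
    rw [hFam i, Function.update_self] at this
    exact this
  have hacc : ∀ w, (V i).acceptProb (oracle P) (List.replicate (nn i) true) (basisState w) =
      (V i).acceptProb (Function.update (oracle (Fam i)) (nn i) (X i (Fam i)).perm)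
        (List.replicate (nn i) true) (basisState w) := fun w => by
    rw [← oracle_update]
    refine Circuit.acceptProb_congr _ (hmx i (nn i)) (fun m hm => ?_) _
    have h1 : m < nn (i + 1) := by rw [hnn]; omega
    change (P m).perm = _
    rw [hPdef]
    simp only [hP m h1]
    rfl
  rcases hX i (Fam i) with ⟨hy, hw⟩ | ⟨hno, w, hw⟩
  · have hmem : List.replicate (nn i) true ∈ lang P := by rw [replicate_mem_lang, hPn]; exact hy
    obtain ⟨w, h⟩ := hver.1 _ hmem
    rw [hacc] at h
    exact absurd h (not_le.2 (hw w))
  · have hmem : List.replicate (nn i) true ∉ lang P := by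
      rw [replicate_mem_lang, hPn]
      exact fun h => not_isNo_of_isYes _ h hno
    have h := hver.2 _ hmem w
    rw [hacc] at h
    exact absurd h (not_le.2 hw)

/-- A verifier whose queries are bounded as in the theorem fails on all large input lengths. -/
lemma Verifier.eventually_failsAt {l : ℕ} (hl : 4 ≤ l) {α β : ℝ} (hα₀ : 0 < α)
    (hα : α < 1 / 2) (hαβ : β + 5 * α < (l : ℝ) - 2) (V : Verifier fun n => l * n)
    (hV : ∀ᶠ n : ℕ in atTop, (V.circ (List.replicate n true)).rounds.length ≤ numBuckets α n - 2 ∧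
      ∀ r ∈ (V.circ (List.replicate n true)).rounds, (r.1.queries.length : ℝ) ≤ 2 ^ (β * n)) :
    ∀ᶠ n in atTop, V.FailsAt α n := by
  filter_upwards [hV, eventually_exists_hard_instance hl hα₀ hα hαβ V.wit] with n hn h O
  have hlen : (List.replicate n true).length = n := List.length_replicate
  unfold Verifier.acceptProb
  -- The type of the circuit depends on the input length, so the circuit is generalized before that
  -- length is replaced by `n`.
  generalize V.circ (List.replicate n true) = C at hn
  revert C
  generalize (List.replicate n true).length = n' at hlen
  subst hlen
  exact fun C hn => h O C hn.1 hn.2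

end InPlaceSep

namespace InPlaceSep

/-! ### Circuits are determined by their descriptions -/

/-- A list of numbers in unary. -/
def unary (ns : List ℕ) : List Bool := ns.flatMap fun n => List.replicate n true ++ [false]

lemma unary_cons (n : ℕ) (ns : List ℕ) :
    unary (n :: ns) = List.replicate n true ++ false :: unary ns := by simp [unary]

lemma unary_append (ns ms : List ℕ) : unary (ns ++ ms) = unary ns ++ unary ms := by
  simp [unary]

lemma replicate_append_false_inj (a b : ℕ) (s t : List Bool)
    (h : List.replicate a true ++ false :: s = List.replicate b true ++ false :: t) :
    a = b ∧ s = t := by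
  induction a generalizing b with
  | zero => cases b <;> simp_all [List.replicate_succ]
  | succ a ih =>
    cases b with
    | zero => simp [List.replicate_succ] at h
    | succ b =>
      simp only [List.replicate_succ, List.cons_append, List.cons.injEq, true_and] at h
      exact ⟨by rw [(ih b h).1], (ih b h).2⟩

lemma unary_injective : Function.Injective unary := by
  intro ns
  induction ns with
  | nil =>
    intro ms h
    cases ms with
    | nil => rfl
    | cons m ms => rw [unary_cons] at h; simp [unary] at h
  | cons n ns ih =>
    intro ms h
    cases ms with
    | nil => rw [unary_cons] at h; simp [unary] at h
    | cons m ms =>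
      rw [unary_cons, unary_cons] at h
      obtain ⟨h1, h2⟩ := replicate_append_false_inj _ _ _ _ h
      rw [h1, ih h2]

lemma length_le_length_unary (ns : List ℕ) : ns.length ≤ (unary ns).length := by
  induction ns with
  | nil => simp
  | cons n ns ih => rw [unary_cons]; simp; omega

lemma Circuit.encode_eq {len : ℕ → ℕ} {k : ℕ} (C : Circuit len k) : C.encode = unary C.code := rfl

/-- Codes that start with a nonzero number and can be read off a longer list. -/
lemma flatMap_append_zero_inj {γ : Type} (code : γ → List ℕ)
    (h0 : ∀ a s t, code a ++ s ≠ 0 :: t)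
    (hinj : ∀ a b s t, code a ++ s = code b ++ t → a = b ∧ s = t) (as bs : List γ) (s t : List ℕ)
    (h : as.flatMap code ++ 0 :: s = bs.flatMap code ++ 0 :: t) : as = bs ∧ s = t := by
  induction as generalizing bs with
  | nil =>
    cases bs with
    | nil => simpa using h
    | cons b bs =>
      simp only [List.flatMap_nil, List.nil_append, List.flatMap_cons, List.append_assoc] at h
      exact absurd h.symm (h0 _ _ _)
  | cons a as ih =>
    cases bs with
    | nil =>
      simp only [List.flatMap_nil, List.nil_append, List.flatMap_cons, List.append_assoc] at h
      exact absurd h (h0 _ _ _)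
    | cons b bs =>
      simp only [List.flatMap_cons, List.append_assoc] at h
      obtain ⟨rfl, h2⟩ := hinj _ _ _ _ h
      obtain ⟨rfl, h3⟩ := ih bs h2
      exact ⟨rfl, h3⟩

lemma gate_code_inj {W : ℕ} (g g' : Gate W) (s t : List ℕ) (h : g.code ++ s = g'.code ++ t) :
    g = g' ∧ s = t := by
  cases g <;> cases g' <;> simp_all [Gate.code, Fin.ext_iff]

lemma gatesCode_inj {W : ℕ} (gs gs' : List (Gate W)) (s t : List ℕ)
    (h : gatesCode gs ++ s = gatesCode gs' ++ t) : gs = gs' ∧ s = t := by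
  refine flatMap_append_zero_inj Gate.code (fun g s t => ?_) gate_code_inj gs gs' s t
    (by simpa [gatesCode] using h)
  cases g <;> simp [Gate.code]

/-- The leading oracle index fixes the register length, so the code is self-delimiting. -/
lemma query_code_inj {len : ℕ → ℕ} {W : ℕ} (Q Q' : Query len W) (s t : List ℕ)
    (h : Q.code ++ s = Q'.code ++ t) : Q = Q' ∧ s = t := by
  obtain ⟨m, w⟩ := Q
  obtain ⟨m', w'⟩ := Q'
  simp only [Query.code, List.cons_append, List.cons.injEq] at h
  obtain ⟨rfl, h⟩ := h
  obtain ⟨h1, h2⟩ := List.append_inj h (by simp)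
  refine ⟨?_, h2⟩
  congr 1
  ext j
  exact congrFun (List.ofFn_injective h1) j

lemma layer_code_inj {len : ℕ → ℕ} {W : ℕ} (L L' : QueryLayer len W) (s t : List ℕ)
    (h : L.code ++ s = L'.code ++ t) : L = L' ∧ s = t := by
  obtain ⟨qs, hqs⟩ := L
  obtain ⟨qs', hqs'⟩ := L'
  obtain ⟨rfl, h2⟩ := flatMap_append_zero_inj (fun Q : Query len W => 1 :: Q.code)
    (fun Q s t => by simp) (fun Q Q' s t h => query_code_inj Q Q' s t (by simpa using h)) qs qs' s t
    (by simpa [QueryLayer.code] using h)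
  exact ⟨rfl, h2⟩

lemma Circuit.code_injective {len : ℕ → ℕ} {k : ℕ} :
    Function.Injective (Circuit.code : Circuit len k → List ℕ) := by
  rintro ⟨a, o, i, r⟩ ⟨a', o', i', r'⟩ h
  simp only [Circuit.code, List.cons.injEq] at h
  obtain ⟨rfl, h1, h2⟩ := h
  obtain rfl := Fin.ext h1
  obtain ⟨rfl, h3⟩ := gatesCode_inj _ _ _ _ h2
  obtain ⟨rfl, -⟩ := flatMap_append_zero_inj
    (fun r : QueryLayer len (k + a) × List (Gate (k + a)) => 1 :: (r.1.code ++ gatesCode r.2))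
    (fun Q s t => by simp)
    (fun r r' s t h => by
      simp only [List.cons_append, List.append_assoc, List.cons.injEq, true_and] at h
      obtain ⟨h4, h5⟩ := layer_code_inj _ _ _ _ h
      obtain ⟨h6, h7⟩ := gatesCode_inj _ _ _ _ h5
      exact ⟨Prod.ext h4 h6, h7⟩) r r' [] [] h3
  rfl

lemma Circuit.encode_injective {len : ℕ → ℕ} {k : ℕ} :
    Function.Injective (Circuit.encode : Circuit len k → List Bool) :=
  unary_injective.comp Circuit.code_injective

lemma length_le_length_flatMap {γ : Type} (code : γ → List ℕ) (h : ∀ a, code a ≠ [])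
    (as : List γ) : as.length ≤ (as.flatMap code).length := by
  induction as with
  | nil => simp
  | cons a as ih =>
    have := List.length_pos_iff.2 (h a)
    simp only [List.length_cons, List.flatMap_cons, List.length_append]
    omega

lemma Circuit.length_rounds_le {len : ℕ → ℕ} {k : ℕ} (C : Circuit len k) :
    C.rounds.length ≤ C.encode.length := by
  refine le_trans ?_ (length_le_length_unary C.code)
  have := length_le_length_flatMap (fun r : QueryLayer len (k + C.ancillas) ×
    List (Gate (k + C.ancillas)) => 1 :: (r.1.code ++ gatesCode r.2)) (by simp) C.rounds
  simp only [Circuit.code, List.length_cons, List.length_append]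
  omega

lemma Circuit.length_queries_le {len : ℕ → ℕ} {k : ℕ} (C : Circuit len k) {r} (hr : r ∈ C.rounds) :
    r.1.queries.length ≤ C.encode.length := by
  refine le_trans ?_ (length_le_length_unary C.code)
  have h1 := length_le_length_flatMap (fun Q : Query len (k + C.ancillas) => 1 :: Q.code)
    (by simp) r.1.queries
  have h2 := (List.sublist_flatten_of_mem (List.mem_map.2 ⟨r, hr, rfl⟩ : _ ∈ C.rounds.map
    fun r => 1 :: (r.1.code ++ gatesCode r.2))).length_le
  rw [← List.flatMap_def] at h2
  simp only [Circuit.code, QueryLayer.code, List.length_cons, List.length_append] at h2 ⊢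
  omega

end InPlaceSep

namespace InPlaceSep
open Turing

/-! ### There are countably many computable functions -/

/-- Statements of stack machines over natural numbers, with finite tables as functions. -/
inductive TableStmt : Type
  | push (k : ℕ) (t : ℕ →₀ ℕ) (q : TableStmt) : TableStmt
  | read (pop : Bool) (k : ℕ) (t : ℕ →₀ ℕ) (q : TableStmt) : TableStmt
  | load (t : ℕ →₀ ℕ) (q : TableStmt) : TableStmt
  | branch (t : ℕ →₀ ℕ) (q₁ q₂ : TableStmt) : TableStmt
  | goto (t : ℕ →₀ ℕ) : TableStmt
  | halt : TableStmt

/-- A code of a statement, given codes of the tables. -/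
def TableStmt.code (e : (ℕ →₀ ℕ) → ℕ) : TableStmt → ℕ
  | push k t q => Nat.pair 0 (Nat.pair k (Nat.pair (e t) (q.code e)))
  | read p k t q => Nat.pair 1 (Nat.pair p.toNat (Nat.pair k (Nat.pair (e t) (q.code e))))
  | load t q => Nat.pair 2 (Nat.pair (e t) (q.code e))
  | branch t q₁ q₂ => Nat.pair 3 (Nat.pair (e t) (Nat.pair (q₁.code e) (q₂.code e)))
  | goto t => Nat.pair 4 (e t)
  | halt => Nat.pair 5 0

lemma TableStmt.code_injective (e : (ℕ →₀ ℕ) → ℕ) (he : e.Injective) :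
    Function.Injective (TableStmt.code e) := by
  have hb : ∀ b b' : Bool, b.toNat = b'.toNat → b = b' := by decide
  intro q
  induction q with
  | push k t q ih =>
    intro q' h
    cases q' <;> simp [TableStmt.code, Nat.pair_eq_pair, he.eq_iff] at h ⊢
    exact ⟨h.1, h.2.1, ih h.2.2⟩
  | read p k t q ih =>
    intro q' h
    cases q' <;> simp [TableStmt.code, Nat.pair_eq_pair, he.eq_iff] at h ⊢
    exact ⟨hb _ _ h.1, h.2.1, h.2.2.1, ih h.2.2.2⟩
  | load t q ih =>
    intro q' h
    cases q' <;> simp [TableStmt.code, Nat.pair_eq_pair, he.eq_iff] at h ⊢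
    exact ⟨h.1, ih h.2⟩
  | branch t q₁ q₂ ih₁ ih₂ =>
    intro q' h
    cases q' <;> simp [TableStmt.code, Nat.pair_eq_pair, he.eq_iff] at h ⊢
    exact ⟨h.1, ih₁ h.2.1, ih₂ h.2.2⟩
  | goto t =>
    intro q' h
    cases q' <;> simp [TableStmt.code, Nat.pair_eq_pair, he.eq_iff] at h ⊢
    exact h
  | halt =>
    intro q' h
    cases q' <;> simp [TableStmt.code, Nat.pair_eq_pair] at h ⊢

instance : Countable TableStmt := by
  obtain ⟨e, he⟩ := exists_injective_nat (ℕ →₀ ℕ)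
  exact (TableStmt.code_injective e he).countable

/-- The statement that a table statement stands for. -/
def TableStmt.toStmt : TableStmt → TM2.Stmt (fun _ : ℕ => ℕ) ℕ ℕ
  | push k t q => .push k (fun s => t s) q.toStmt
  | read false k t q => .peek k (fun s o => t (Nat.pair s (o.elim 0 Nat.succ))) q.toStmt
  | read true k t q => .pop k (fun s o => t (Nat.pair s (o.elim 0 Nat.succ))) q.toStmt
  | load t q => .load (fun s => t s) q.toStmt
  | branch t q₁ q₂ => .branch (fun s => decide (t s = 1)) q₁.toStmt q₂.toStmt
  | goto t => .goto fun s => t s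
  | halt => .halt

lemma exists_table {A : Type*} [Finite A] (e h : A → ℕ) (he : e.Injective) :
    ∃ t : ℕ →₀ ℕ, ∀ a, t (e a) = h a := by
  have hfin : (Function.support (Function.extend e h 0)).Finite := by
    refine (Set.finite_range e).subset fun x hx => ?_
    by_contra hn
    exact hx (Function.extend_apply' _ _ _ (by simpa using hn))
  exact ⟨Finsupp.ofSupportFinite _ hfin, fun a => he.extend_apply h 0 a⟩

/-- The symbols that a statement can push. -/
def pushed {K : Type} {Γ : K → Type} {Λ σ : Type} : TM2.Stmt Γ Λ σ → Set (Σ k, Γ k)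
  | .push k f q => Set.range (fun s => ⟨k, f s⟩) ∪ pushed q
  | .peek _ _ q => pushed q
  | .pop _ _ q => pushed q
  | .load _ q => pushed q
  | .branch _ q₁ q₂ => pushed q₁ ∪ pushed q₂
  | .goto _ => ∅
  | .halt => ∅

lemma finite_pushed {K : Type} {Γ : K → Type} {Λ σ : Type} [Finite σ] (q : TM2.Stmt Γ Λ σ) :
    (pushed q).Finite := by
  induction q with
  | push k f q ih => exact (Set.finite_range _).union ih
  | peek _ _ q ih => exact ih
  | pop _ _ q ih => exact ih
  | load _ q ih => exact ih
  | branch _ q₁ q₂ ih₁ ih₂ => exact ih₁.union ih₂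
  | goto _ => exact Set.finite_empty
  | halt => exact Set.finite_empty

/-- A configuration of a machine over natural numbers that represents a given one. -/
def Represents {K : Type} {Γ : K → Type} {Λ σ : Type} (eK : K → ℕ) (eΛ : Λ → ℕ) (eσ : σ → ℕ)
    (U : Set (Σ k, Γ k)) (γ : (Σ k, Γ k) → ℕ) (c : TM2.Cfg Γ Λ σ)
    (c' : TM2.Cfg (fun _ : ℕ => ℕ) ℕ ℕ) : Prop :=
  c'.l = c.l.map eΛ ∧ c'.var = eσ c.var ∧ (∀ k, c'.stk (eK k) = (c.stk k).map fun x => γ ⟨k, x⟩) ∧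
    ∀ k, ∀ x ∈ c.stk k, (⟨k, x⟩ : Σ k, Γ k) ∈ U

/-- Stack alphabets may be infinite, but only symbols of the finite set `U` occur, so every function
in a statement acts as a finite table, and `γ` need only be injective on `U`. -/
lemma exists_tableStmt {K : Type} [DecidableEq K] {Γ : K → Type} {Λ σ : Type} [Finite σ]
    (eK : K → ℕ) (hK : eK.Injective) (eΛ : Λ → ℕ) (eσ : σ → ℕ) (hσ : eσ.Injective)
    (U : Set (Σ k, Γ k)) (hU : U.Finite) (γ : (Σ k, Γ k) → ℕ) (hγ : Set.InjOn γ U)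
    (q : TM2.Stmt Γ Λ σ) (hq : pushed q ⊆ U) :
    ∃ D : TableStmt, ∀ v S S', (∀ k, S' (eK k) = (S k).map fun x => γ ⟨k, x⟩) →
      (∀ k, ∀ x ∈ S k, (⟨k, x⟩ : Σ k, Γ k) ∈ U) →
      Represents eK eΛ eσ U γ (TM2.stepAux q v S) (TM2.stepAux D.toStmt (eσ v) S') := by
  -- In the table of a read, `0` codes the empty stack; symbols are therefore shifted by one.
  have hread : ∀ (k : K) (f : σ → Option (Γ k) → σ), ∃ t : ℕ →₀ ℕ, ∀ s (L : List (Γ k)),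
      (∀ x ∈ L, (⟨k, x⟩ : Σ k, Γ k) ∈ U) →
      t (Nat.pair (eσ s) ((L.map fun x => γ ⟨k, x⟩).head?.elim 0 Nat.succ)) =
        eσ (f s L.head?) := by
    intro k f
    have : Finite {x : Γ k // (⟨k, x⟩ : Σ k, Γ k) ∈ U} :=
      (hU.preimage (sigma_mk_injective.injOn)).to_subtype
    obtain ⟨t, ht⟩ := exists_table
      (fun a : σ × Option {x : Γ k // (⟨k, x⟩ : Σ k, Γ k) ∈ U} =>
        Nat.pair (eσ a.1) (a.2.elim 0 fun x => (γ ⟨k, x⟩).succ))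
      (fun a => eσ (f a.1 (a.2.map Subtype.val))) (by
        rintro ⟨s, o⟩ ⟨s', o'⟩ h
        simp only [Nat.pair_eq_pair] at h
        refine Prod.ext (hσ h.1) ?_
        rcases o with _ | ⟨x, hx⟩ <;> rcases o' with _ | ⟨x', hx'⟩
        · rfl
        · simp at h
        · simp at h
        · have h2 := hγ hx hx' (by simpa using h.2)
          simp only [Sigma.mk.injEq, heq_eq_eq, true_and] at h2
          simp [h2])
    refine ⟨t, fun s L hL => ?_⟩
    cases L with
    | nil => exact ht (s, none)
    | cons x L => exact ht (s, some ⟨x, hL x List.mem_cons_self⟩)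
  induction q with
  | push k f q ih =>
    obtain ⟨D, hD⟩ := ih (Set.subset_union_right.trans hq)
    obtain ⟨t, ht⟩ := exists_table eσ (fun s => γ ⟨k, f s⟩) hσ
    refine ⟨.push (eK k) t D, fun v S S' h1 h2 => hD _ _ _ (fun k' => ?_) fun k' x hx => ?_⟩
    · by_cases hk : k' = k
      · subst hk; simp [ht, h1]
      · simp [hk, hK.eq_iff, h1]
    · by_cases hk : k' = k
      · subst hk
        simp only [Function.update_self, List.mem_cons] at hx
        rcases hx with rfl | hx
        · exact hq (Or.inl ⟨v, rfl⟩)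
        · exact h2 _ _ hx
      · rw [Function.update_of_ne hk] at hx; exact h2 _ _ hx
  | peek k f q ih =>
    obtain ⟨D, hD⟩ := ih hq
    obtain ⟨t, ht⟩ := hread k f
    refine ⟨.read false (eK k) t D, fun v S S' h1 h2 => ?_⟩
    simp only [TableStmt.toStmt, TM2.stepAux]
    rw [h1 k, ht v (S k) (h2 k)]
    exact hD _ _ _ h1 h2
  | pop k f q ih =>
    obtain ⟨D, hD⟩ := ih hq
    obtain ⟨t, ht⟩ := hread k f
    refine ⟨.read true (eK k) t D, fun v S S' h1 h2 => ?_⟩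
    simp only [TableStmt.toStmt, TM2.stepAux]
    rw [h1 k, ht v (S k) (h2 k)]
    refine hD _ _ _ (fun k' => ?_) fun k' x hx => ?_
    · by_cases hk : k' = k
      · subst hk; simp
      · simp [hk, hK.eq_iff, h1]
    · by_cases hk : k' = k
      · subst hk
        rw [Function.update_self] at hx
        exact h2 _ _ (List.mem_of_mem_tail hx)
      · rw [Function.update_of_ne hk] at hx; exact h2 _ _ hx
  | load f q ih =>
    obtain ⟨D, hD⟩ := ih hq
    obtain ⟨t, ht⟩ := exists_table eσ (fun s => eσ (f s)) hσ
    refine ⟨.load t D, fun v S S' h1 h2 => ?_⟩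
    simp only [TableStmt.toStmt, TM2.stepAux, ht]
    exact hD _ _ _ h1 h2
  | branch f q₁ q₂ ih₁ ih₂ =>
    obtain ⟨D₁, hD₁⟩ := ih₁ (Set.subset_union_left.trans hq)
    obtain ⟨D₂, hD₂⟩ := ih₂ (Set.subset_union_right.trans hq)
    obtain ⟨t, ht⟩ := exists_table eσ (fun s => (f s).toNat) hσ
    refine ⟨.branch t D₁ D₂, fun v S S' h1 h2 => ?_⟩
    simp only [TableStmt.toStmt, TM2.stepAux, ht]
    cases f v
    · exact hD₂ _ _ _ h1 h2
    · exact hD₁ _ _ _ h1 h2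
  | goto f =>
    obtain ⟨t, ht⟩ := exists_table eσ (fun s => eΛ (f s)) hσ
    exact ⟨.goto t, fun v S S' h1 h2 => ⟨by simp [TableStmt.toStmt, ht], rfl, h1, h2⟩⟩
  | halt => exact ⟨.halt, fun v S S' h1 h2 => ⟨rfl, rfl, h1, h2⟩⟩

/-- A stack machine over natural numbers: statements, initial label and state, input and output
stacks, input and output symbols. -/
abbrev TableMachine : Type := List TableStmt × (ℕ × ℕ) × (ℕ × ℕ) × (ℕ × ℕ) × (ℕ × ℕ)

/-- The step function of a table machine. -/
def TableMachine.step (D : TableMachine) :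
    TM2.Cfg (fun _ : ℕ => ℕ) ℕ ℕ → Option (TM2.Cfg (fun _ : ℕ => ℕ) ℕ ℕ) :=
  TM2.step fun i => (D.1.getD i .halt).toStmt

/-- The symbol of a bit. -/
def bitSymbol (s : ℕ × ℕ) (b : Bool) : ℕ := if b then s.2 else s.1

/-- The machine outputs `y` on input `x`. -/
def TableMachine.Outputs (D : TableMachine) (x y : List Bool) : Prop :=
  ∃ n c, (flip bind D.step)^[n] (some ⟨some D.2.1.1, D.2.1.2,
      Function.update (fun _ => []) D.2.2.1.1 (x.map (bitSymbol D.2.2.2.1))⟩) = some c ∧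
    c.l = none ∧ c.stk D.2.2.1.2 = y.map (bitSymbol D.2.2.2.2)

lemma iterate_bind_none {A : Type} (f : A → Option A) (n : ℕ) :
    (flip bind f)^[n] none = none := by
  induction n with
  | zero => rfl
  | succ n ih => rw [Function.iterate_succ_apply]; exact ih

lemma le_of_iterate_bind {A : Type} (f : A → Option A) (a c c' : A) (n n' : ℕ)
    (h : (flip bind f)^[n] (some a) = some c) (hc : f c = none)
    (h' : (flip bind f)^[n'] (some a) = some c') : n' ≤ n := by
  by_contra hlt
  obtain ⟨m, rfl⟩ := Nat.exists_eq_add_of_lt (not_le.1 hlt)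
  rw [show n + m + 1 = m + (n + 1) by omega, Function.iterate_add_apply,
    Function.iterate_succ_apply', h] at h'
  have : flip bind f (some c) = none := hc
  rw [this, iterate_bind_none] at h'
  exact absurd h' (by simp)

/-- A halted configuration has no successor, so the halting time and the final stacks are
determined. Distinct output symbols make the decoding of the stack unique. -/
lemma TableMachine.outputs_unique (D : TableMachine) (hD : D.2.2.2.2.1 ≠ D.2.2.2.2.2)
    {x y y' : List Bool} (h : D.Outputs x y) (h' : D.Outputs x y') : y = y' := by
  obtain ⟨n, ⟨_, v, S⟩, h1, rfl, h3⟩ := h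
  obtain ⟨n', ⟨_, v', S'⟩, h1', rfl, h3'⟩ := h'
  have e : n = n' := le_antisymm (le_of_iterate_bind _ _ _ _ _ _ h1' rfl h1)
    (le_of_iterate_bind _ _ _ _ _ _ h1 rfl h1')
  subst e
  rw [h1] at h1'
  simp only [Option.some.injEq, TM2.Cfg.mk.injEq, true_and] at h1'
  rw [← h1'.2, h3] at h3'
  refine List.map_injective_iff.2 ?_ h3'
  intro b b' hb
  cases b <;> cases b' <;> simp_all [bitSymbol]

lemma initList_eq (tm : FinTM2) (s : List (tm.Γ tm.k₀)) :
    initList tm s = ⟨some tm.main, tm.initialState, Function.update (fun _ => []) tm.k₀ s⟩ := by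
  unfold initList
  congr 1
  funext k
  by_cases h : k = tm.k₀
  · subst h; simp
  · simp [h]

lemma haltList_eq (tm : FinTM2) (s : List (tm.Γ tm.k₁)) :
    haltList tm s = ⟨none, tm.initialState, Function.update (fun _ => []) tm.k₁ s⟩ := by
  unfold haltList
  congr 1
  funext k
  by_cases h : k = tm.k₁
  · subst h; simp
  · simp [h]

/-- Stacks, labels, states and relevant symbols are injected into `ℕ`, and `Represents` is preserved
by every step. Machines over arbitrary types thus land in one countable type. -/
theorem exists_tableMachine {f : List Bool → List Bool}
    (h : TM2Computable (id : List Bool → List Bool) (id : List Bool → List Bool) f) :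
    ∃ D : TableMachine, D.2.2.2.2.1 ≠ D.2.2.2.2.2 ∧ ∀ x, D.Outputs x (f x) := by
  obtain ⟨⟨tm, ein, eout⟩, hout⟩ := h
  dsimp only at hout
  have := tm.kFin
  have := tm.ΛFin
  have := tm.σFin
  obtain ⟨eK, hK⟩ := exists_injective_nat tm.K
  obtain ⟨eσ, hσ⟩ := exists_injective_nat tm.σ
  let eΛ : tm.Λ → ℕ := fun a => Fintype.equivFin tm.Λ a
  -- Pushed and input symbols are all that can occur on the stacks; the output symbols are added so
  -- that `γ` separates them.
  let U : Set (Σ k, tm.Γ k) := (⋃ a, pushed (tm.m a)) ∪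
    (Set.range (fun b => ⟨tm.k₀, ein.symm b⟩) ∪ Set.range (fun b => ⟨tm.k₁, eout.symm b⟩))
  have hU : U.Finite := (Set.finite_iUnion fun a => finite_pushed _).union
    ((Set.finite_range _).union (Set.finite_range _))
  obtain ⟨γ, hγ⟩ := Set.countable_iff_exists_injOn.1 hU.countable
  choose T hT using fun a => exists_tableStmt eK hK eΛ eσ hσ U hU γ hγ (tm.m a)
    ((Set.subset_iUnion (fun a => pushed (tm.m a)) a).trans Set.subset_union_left)
  let D : TableMachine := (List.ofFn fun i => T ((Fintype.equivFin tm.Λ).symm i),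
    (eΛ tm.main, eσ tm.initialState), (eK tm.k₀, eK tm.k₁),
    (γ ⟨tm.k₀, ein.symm false⟩, γ ⟨tm.k₀, ein.symm true⟩),
    (γ ⟨tm.k₁, eout.symm false⟩, γ ⟨tm.k₁, eout.symm true⟩))
  have hget : ∀ a, D.1.getD (eΛ a) .halt = T a := fun a => by
    simp [D, eΛ, List.getD]
  have hstep : ∀ c d c', Represents eK eΛ eσ U γ c c' → tm.step c = some d →
      ∃ d', D.step c' = some d' ∧ Represents eK eΛ eσ U γ d d' := by
    rintro ⟨_ | a, v, S⟩ d ⟨a', v', S'⟩ ⟨hl, hv, hS, hSU⟩ hd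
    · simp [FinTM2.step] at hd
    · simp only [Option.map_some] at hl hv hS hSU
      subst hl hv
      obtain rfl := Option.some.inj hd
      refine ⟨_, rfl, ?_⟩
      simp only [hget]
      exact hT a v S S' hS hSU
  refine ⟨D, ?_, fun x => ?_⟩
  · intro he
    have := hγ (Or.inr (Or.inr ⟨_, rfl⟩)) (Or.inr (Or.inr ⟨_, rfl⟩)) he
    simp at this
  · obtain ⟨n, hn⟩ := hout x
    rw [initList_eq] at hn
    simp only [Option.map_some, haltList_eq] at hn
    have hsim : ∀ m c, (flip bind tm.step)^[m] (some ⟨some tm.main, tm.initialState,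
          Function.update (fun _ => []) tm.k₀ (x.map ein.symm)⟩) = some c →
        ∃ c', (flip bind D.step)^[m] (some ⟨some D.2.1.1, D.2.1.2,
          Function.update (fun _ => []) D.2.2.1.1 (x.map (bitSymbol D.2.2.2.1))⟩) = some c' ∧
          Represents eK eΛ eσ U γ c c' := by
      intro m
      induction m with
      | zero =>
        intro c hc
        obtain rfl := Option.some.inj hc
        refine ⟨_, rfl, rfl, rfl, fun k => ?_, fun k s hs => ?_⟩
        · by_cases hk : k = tm.k₀
          · subst hk
            simp only [D, Function.update_self, List.map_map]
            refine List.map_congr_left fun b _ => ?_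
            cases b <;> rfl
          · simp [D, hk, hK.eq_iff]
        · by_cases hk : k = tm.k₀
          · subst hk
            simp only [Function.update_self, List.mem_map] at hs
            obtain ⟨b, -, rfl⟩ := hs
            exact Or.inr (Or.inl ⟨b, rfl⟩)
          · simp [hk] at hs
      | succ m ih =>
        intro c hc
        rw [Function.iterate_succ_apply'] at hc
        obtain ⟨d, hd, hdc⟩ := Option.bind_eq_some_iff.1 hc
        obtain ⟨d', hd', hR⟩ := ih d hd
        obtain ⟨c', hc', hR'⟩ := hstep d c d' hR hdc
        refine ⟨c', ?_, hR'⟩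
        rw [Function.iterate_succ_apply', hd']
        exact hc'
    obtain ⟨c', hc', hR⟩ := hsim n _ hn
    refine ⟨n, c', hc', hR.1, ?_⟩
    refine (hR.2.2.1 tm.k₁).trans ?_
    simp only [Function.update_self, List.map_map]
    refine List.map_congr_left fun b _ => ?_
    cases b <;> rfl

theorem countable_setOf_tm2Computable : {f : List Bool → List Bool |
    Nonempty (TM2Computable (id : List Bool → List Bool) (id : List Bool → List Bool) f)}.Countable := by
  have h : ∀ f : {f : List Bool → List Bool | Nonempty (TM2Computable (id : List Bool → List Bool)
      (id : List Bool → List Bool) f)}, ∃ D : TableMachine, D.2.2.2.2.1 ≠ D.2.2.2.2.2 ∧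
      ∀ x, D.Outputs x (f.1 x) := fun f => exists_tableMachine f.2.some
  choose D hD hDf using h
  have hinj : Function.Injective D := fun f g hfg => Subtype.ext (funext fun x =>
    (D f).outputs_unique (hD f) (hDf f x) (by rw [hfg]; exact hDf g x))
  exact hinj.countable

/-- Only countably many verifiers are uniform. -/
theorem countable_setOf_uniform (len : ℕ → ℕ) : {V : Verifier len | V.Uniform}.Countable := by
  have : Countable (Polynomial ℕ) := by
    refine Function.Injective.countable (β := ℕ →₀ ℕ) (f := fun p =>
      Finsupp.onFinset p.support p.coeff fun n => Polynomial.mem_support_iff.2) fun p q h => ?_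
    ext n
    exact DFunLike.congr_fun h n
  have h1 := (Set.countable_univ (α := Polynomial ℕ)).prod countable_setOf_tm2Computable
  have hmaps : Set.MapsTo (fun V : Verifier len => (V.wit, fun x => (V.circ x).encode))
      {V | V.Uniform} (Set.univ ×ˢ {f : List Bool → List Bool | Nonempty (TM2Computable
        (id : List Bool → List Bool) (id : List Bool → List Bool) f)}) := fun V hV => ⟨trivial, hV⟩
  refine hmaps.countable_of_injOn ?_ h1
  rintro ⟨w, c⟩ - ⟨w', c'⟩ - h
  simp only [Prod.mk.injEq] at h
  obtain ⟨rfl, h2⟩ := h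
  congr 1
  funext x
  exact Circuit.encode_injective (congrFun h2 x)

end InPlaceSep

namespace InPlaceSep
open Turing Filter Topology

/-! ### Output length of polynomial-time machines -/

/-- The largest number of symbols that a statement pushes on the stack `k`. -/
def pushCount {K : Type} [DecidableEq K] {Γ : K → Type} {Λ σ : Type} (k : K) :
    TM2.Stmt Γ Λ σ → ℕ
  | .push _ _ q => pushCount k q + 1
  | .peek _ _ q => pushCount k q
  | .pop _ _ q => pushCount k q
  | .load _ q => pushCount k q
  | .branch _ q₁ q₂ => pushCount k q₁ + pushCount k q₂
  | .goto _ => 0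
  | .halt => 0

lemma length_stepAux_le {K : Type} [DecidableEq K] {Γ : K → Type} {Λ σ : Type} (k : K)
    (q : TM2.Stmt Γ Λ σ) (v : σ) (S : ∀ k, List (Γ k)) :
    ((TM2.stepAux q v S).stk k).length ≤ (S k).length + pushCount k q := by
  induction q generalizing v S with
  | push k' f q ih =>
    refine (ih _ _).trans ?_
    by_cases h : k = k'
    · subst h; simp [pushCount]; omega
    · simp [pushCount, h]
  | peek _ _ q ih => exact ih _ _
  | pop k' f q ih =>
    refine (ih _ _).trans ?_
    by_cases h : k = k'
    · subst h; simp [pushCount]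
    · simp [pushCount, h]
  | load _ q ih => exact ih _ _
  | branch f q₁ q₂ ih₁ ih₂ =>
    simp only [TM2.stepAux, pushCount]
    cases f v
    · exact (ih₂ _ _).trans (by omega)
    · exact (ih₁ _ _).trans (by omega)
  | goto _ => simp [pushCount]
  | halt => simp [pushCount]

/-- Each step pushes at most `B` symbols on the output stack. The summand `X` covers machines whose
input and output stacks coincide. -/
theorem exists_length_le {f : List Bool → List Bool}
    (h : TM2ComputableInPolyTime (id : List Bool → List Bool) (id : List Bool → List Bool) f) :
    ∃ p : Polynomial ℕ, ∀ x, (f x).length ≤ p.eval x.length := by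
  obtain ⟨⟨tm, ein, eout⟩, time, hout⟩ := h
  dsimp only at hout
  have := tm.ΛFin
  obtain ⟨B, hB⟩ : ∃ B, ∀ a, pushCount tm.k₁ (tm.m a) ≤ B :=
    ⟨∑ a, pushCount tm.k₁ (tm.m a), fun a =>
      Finset.single_le_sum (f := fun a => pushCount tm.k₁ (tm.m a)) (fun _ _ => Nat.zero_le _)
        (Finset.mem_univ a)⟩
  refine ⟨Polynomial.X + Polynomial.C B * time, fun x => ?_⟩
  obtain ⟨⟨n, hn⟩, hle⟩ := hout x
  rw [initList_eq] at hn
  simp only [Option.map_some, haltList_eq] at hn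
  have hlen : ∀ m c, (flip Option.bind tm.step)^[m] (some ⟨some tm.main, tm.initialState,
      Function.update (fun _ => []) tm.k₀ (x.map ein.symm)⟩) = some c →
      (c.stk tm.k₁).length ≤ x.length + B * m := by
    intro m
    induction m with
    | zero =>
      intro c hc
      obtain rfl := Option.some.inj hc
      by_cases h : tm.k₁ = tm.k₀
      · dsimp only
        have h2 : ∀ k, k = tm.k₀ → (Function.update (fun _ => []) tm.k₀ (x.map ein.symm) k).length =
            x.length := by rintro k rfl; simp
        rw [h2 _ h]; omega
      · simp [h]
    | succ m ih =>
      intro c hc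
      rw [Function.iterate_succ_apply'] at hc
      obtain ⟨⟨_ | a, v, S⟩, hd, hdc⟩ := Option.bind_eq_some_iff.1 hc
      · simp [FinTM2.step] at hdc
      · obtain rfl := Option.some.inj hdc
        have h1 := length_stepAux_le tm.k₁ (tm.m a) v S
        have h2 := ih _ hd
        have h3 := hB a
        simp only at h2
        rw [Nat.mul_succ]
        omega
  have h1 := hlen n _ hn
  simp only [Function.update_self, List.length_map, id] at h1 hle
  have h2 : B * n ≤ B * time.eval x.length := Nat.mul_le_mul_left _ hle
  simp only [Polynomial.eval_add, Polynomial.eval_X, Polynomial.eval_mul, Polynomial.eval_C]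
  omega

lemma Verifier.PolyTimeUniform.uniform {len : ℕ → ℕ} {V : Verifier len} (h : V.PolyTimeUniform) :
    V.Uniform :=
  h.map fun h => h.toTM2ComputableInTime.toTM2Computable

/-- A polynomial-time uniform verifier satisfies the query bounds on all large inputs. -/
lemma Verifier.PolyTimeUniform.eventually_bounded {l : ℕ} {α β : ℝ} (hα : 0 < α) (hβ : 0 < β)
    {V : Verifier fun n => l * n} (h : V.PolyTimeUniform) :
    ∀ᶠ n : ℕ in atTop, (V.circ (List.replicate n true)).rounds.length ≤ numBuckets α n - 2 ∧
      ∀ r ∈ (V.circ (List.replicate n true)).rounds, (r.1.queries.length : ℝ) ≤ 2 ^ (β * n) := by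
  obtain ⟨p, hp⟩ := exists_length_le h.some
  -- The `+ 2` absorbs the `- 2` of the round bound.
  filter_upwards [eventually_polynomial_le (p + 2) hα, eventually_polynomial_le p hβ] with n h1 h2
  have hpn : (V.circ (List.replicate n true)).encode.length ≤ p.eval n :=
    (hp (List.replicate n true)).trans_eq (by rw [List.length_replicate])
  constructor
  · have h3 := (V.circ (List.replicate n true)).length_rounds_le.trans hpn
    have h4 : ((p + 2).eval n : ℕ) = p.eval n + 2 := by simp
    have h5 : p.eval n + 2 ≤ numBuckets α n := by
      rw [← h4]
      exact_mod_cast h1.trans (Nat.le_ceil _)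
    omega
  · intro r hr
    refine le_trans ?_ h2
    exact_mod_cast (Circuit.length_queries_le _ hr).trans hpn

end InPlaceSep

namespace InPlaceSep

/-! ### The verifier with one query -/

/-- The `j`-th flag wire, with `j ≤ k`; wire `k` is never changed. -/
def flagWire (k j : ℕ) (hj : j ≤ k) : Fin (k + (k + 2)) := ⟨k + 1 + j, by omega⟩

/-- Set the flag `t` if the flag `0` is set and the first `t` wires are `0`. -/
def cascade (k : ℕ) : (t : ℕ) → t ≤ k → List (Gate (k + (k + 2)))
  | 0, _ => []
  | t + 1, h => cascade k t (by omega) ++ [.X ⟨t, by omega⟩,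
      .Toffoli ⟨t, by omega⟩ (flagWire k t (by omega)) (flagWire k (t + 1) h)
        (by simp [flagWire]) (by simp [flagWire]; omega) (by simp [flagWire])]

/-- The verifier: record the parity of the witness, query the oracle, and compare the result with
the uniform superposition of the first `2 ^ n` basis states. -/
def verifierCircuit (l n k : ℕ) (hk : k = l * n) (hn : n ≤ k) (good : Bool) :
    Circuit (fun n => l * n) k where
  ancillas := k + 2
  out := flagWire k k le_rfl
  init := if good then [.CNOT ⟨0, by omega⟩ (flagWire k 0 (by omega))
    (by simp [flagWire])] else []
  rounds := [(⟨[⟨n, ⟨fun j => ⟨j, by have := j.isLt; omega⟩, fun i j h => by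
      simpa [Fin.ext_iff] using h⟩⟩], by simp⟩,
    ((List.finRange n).map fun i : Fin n => Gate.H ⟨i, by have := i.isLt; omega⟩) ++ cascade k k le_rfl)]

/-- The action of a reversible classical gate on the basis states. -/
def Gate.classical {W : ℕ} : Gate W → Bits W → Bits W
  | .H _, y => y
  | .T _, y => y
  | .X i, y => Function.update y i (y i + 1)
  | .CNOT c t _, y => Function.update y t (y t + y c)
  | .Toffoli c₁ c₂ t _ _ _, y => Function.update y t (y t + y c₁ * y c₂)

/-- The gate permutes the basis states. -/
def Gate.IsClassical {W : ℕ} : Gate W → Prop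
  | .H _ => False
  | .T _ => False
  | _ => True

/-- A sum weighted by output probabilities is pulled back along the label map, so the cascade can be
followed on labels instead of amplitudes. -/
lemma sum_classical_gate {W : ℕ} (g : Gate W) (hg : g.IsClassical) (φ : QState W) (F : Bits W → ℝ) :
    ∑ y, F y * ‖g.apply φ y‖ ^ 2 = ∑ y, F (g.classical y) * ‖φ y‖ ^ 2 := by
  obtain ⟨e, he, he'⟩ : ∃ e : Equiv.Perm (Bits W), (∀ y, e y = g.classical y) ∧
      ∀ y, g.apply φ y = φ (e.symm y) := by
    have h2 : ∀ a b : Fin 2, a + b + b = a := by decide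
    have key : ∀ (t : Fin W) (h : Bits W → Fin 2) (hh : ∀ y v, h (Function.update y t v) = h y),
        ∀ y, (addBit t h hh).symm y = Function.update y t (y t + h y) := fun t h hh y => rfl
    cases g with
    | H i => exact hg.elim
    | T i => exact hg.elim
    | X i => exact ⟨addBit i (fun _ => 1) fun _ _ => rfl, fun _ => rfl, fun _ => rfl⟩
    | CNOT c t h =>
      exact ⟨addBit t (fun y => y c) fun y v => by simp [h], fun _ => rfl, fun _ => rfl⟩
    | Toffoli c₁ c₂ t h h₁ h₂ =>
      exact ⟨addBit t (fun y => y c₁ * y c₂) fun y v => by simp [h₁, h₂], fun _ => rfl, fun _ => rfl⟩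
  rw [← Equiv.sum_comp e]
  refine Finset.sum_congr rfl fun y _ => ?_
  rw [he', Equiv.symm_apply_apply, he]

lemma sum_classical_gates {W : ℕ} (gs : List (Gate W)) (hg : ∀ g ∈ gs, g.IsClassical)
    (φ : QState W) (F : Bits W → ℝ) :
    ∑ y, F y * ‖applyGates gs φ y‖ ^ 2 =
      ∑ y, F (gs.foldl (fun y g => g.classical y) y) * ‖φ y‖ ^ 2 := by
  induction gs generalizing φ with
  | nil => rfl
  | cons g gs ih =>
    have h1 := ih (fun g' hg' => hg g' (List.mem_cons_of_mem _ hg')) (g.apply φ)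
    refine h1.trans ?_
    rw [sum_classical_gate g (hg g List.mem_cons_self) φ
      fun y => F (gs.foldl (fun y g => g.classical y) y)]
    rfl

lemma cascade_classical (k t : ℕ) (ht : t ≤ k) : ∀ g ∈ cascade k t ht, g.IsClassical := by
  induction t with
  | zero => simp [cascade]
  | succ t ih =>
    intro g hg
    simp only [cascade, List.mem_append, List.mem_cons, List.not_mem_nil, or_false] at hg
    rcases hg with hg | rfl | rfl
    · exact ih _ g hg
    · trivial
    · trivial

/-- The first two clauses carry the induction: wire `t` is still intact and flag `t + 1` still `0`
when the Toffoli gate multiplies flag `t` by the negated wire. The negation is not undone, since no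
later gate of the cascade uses that wire. -/
lemma cascade_spec (k t : ℕ) (ht : t ≤ k) (z : Bits (k + (k + 2)))
    (hz : ∀ j (hj : j ≤ k), j ≠ 0 → z (flagWire k j hj) = 0) (y : Bits (k + (k + 2)))
    (hy : y = (cascade k t ht).foldl (fun y g => g.classical y) z) :
    (∀ i (hi : i < k), t ≤ i → y ⟨i, by omega⟩ = z ⟨i, by omega⟩) ∧
    (∀ j (hj : j ≤ k), t < j → y (flagWire k j hj) = 0) ∧
    (y (flagWire k t ht) = 1 ↔ z (flagWire k 0 (by omega)) = 1 ∧
      ∀ i (hi : i < t), z ⟨i, by omega⟩ = 0) := by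
  induction t generalizing y with
  | zero =>
    subst hy
    exact ⟨fun _ _ _ => rfl, fun j hj h => hz j hj (by omega), by simp⟩
  | succ t ih =>
    obtain ⟨h1, h2, h3⟩ := ih (by omega) _ rfl
    simp only [cascade, List.foldl_append, List.foldl_cons, List.foldl_nil] at hy
    set x := (cascade k t (by omega)).foldl (fun y g => g.classical y) z with hx
    simp only [Gate.classical] at hy
    subst hy
    have hne : ∀ i j (hi : i < k) (hj : j ≤ k),
        (⟨i, by omega⟩ : Fin (k + (k + 2))) ≠ flagWire k j hj := fun i j hi hj => by
      simp [flagWire]; omega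
    refine ⟨fun i hi hti => ?_, fun j hj htj => ?_, ?_⟩
    · rw [Function.update_of_ne (hne i _ hi ht), Function.update_of_ne (by simp; omega)]
      exact h1 i hi (by omega)
    · rw [Function.update_of_ne (by simp [flagWire]; omega),
        Function.update_of_ne (hne t _ (by omega) _).symm]
      exact h2 j hj (by omega)
    · have e1 := h1 t (by omega) le_rfl
      have e2 := h2 (t + 1) ht (by omega)
      rw [Function.update_self, Function.update_of_ne (hne t _ (by omega) _).symm,
        Function.update_self, Function.update_of_ne (hne t _ (by omega) _).symm, e1, e2]
      have h4 : ∀ a b : Fin 2, (0 + (a + 1) * b = 1 ↔ b = 1 ∧ a = 0) := by decide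
      rw [h4, h3, and_assoc]
      refine and_congr_right fun _ => ?_
      constructor
      · rintro ⟨h5, h6⟩ i hi
        rcases Nat.lt_succ_iff_lt_or_eq.1 hi with h | rfl
        · exact h5 i h
        · exact h6
      · exact fun h => ⟨fun i hi => h i (by omega), h t (by omega)⟩

lemma applyGates_append {W : ℕ} (gs gs' : List (Gate W)) (ψ : QState W) :
    applyGates (gs ++ gs') ψ = applyGates gs' (applyGates gs ψ) := List.foldl_append

/-- The amplitude of Hadamard gates at a label that is `0` on the wires of the gates. -/
lemma hadamards_apply {W : ℕ} (is : List (Fin W)) (hnd : is.Nodup) (φ : QState W) (y : Bits W)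
    (hy : ∀ i ∈ is, y i = 0) :
    applyGates (is.map Gate.H) φ y = (1 / (√2 : ℂ)) ^ is.length *
      ∑ v, if ∀ j, j ∉ is → v j = y j then φ v else 0 := by
  classical
  induction is generalizing φ with
  | nil =>
    simp only [List.map_nil, List.length_nil, pow_zero, one_mul, List.not_mem_nil,
      not_false_eq_true, forall_true_left]
    rw [Finset.sum_eq_single y]
    · simp [applyGates]
    · intro v _ hv; exact if_neg fun h => hv (funext h)
    · simp
  | cons i is ih =>
    rw [List.nodup_cons] at hnd
    have h1 := ih hnd.2 ((Gate.H i).apply φ) fun j hj => hy j (List.mem_cons_of_mem _ hj)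
    have h0 : applyGates ((i :: is).map Gate.H) φ y =
      applyGates (is.map Gate.H) ((Gate.H i).apply φ) y := rfl
    rw [h0, h1, List.length_cons, pow_succ, mul_assoc]
    congr 1
    obtain ⟨e, he⟩ := exists_addBit_x i
    have hyi := hy i List.mem_cons_self
    have h01 : ∀ v : Fin 2, v = 0 ∨ v = 1 := by decide
    have e1 : ∀ v, (if ∀ j, j ∉ is → v j = y j then (Gate.H i).apply φ v else 0) =
        (1 / (√2 : ℂ)) * ((if ∀ j, j ∉ is → v j = y j then φ v else 0) +
          if ∀ j, j ∉ is → v j = y j then φ (e v) else 0) := by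
      intro v
      split_ifs with h
      · have hv : v i = 0 := (h i hnd.1).trans hyi
        have hu : Function.update v i 0 = v := by rw [← hv, Function.update_eq_self]
        simp [Gate.apply, he, hv, hu]
      · simp
    rw [Finset.sum_congr rfl fun v _ => e1 v, ← Finset.mul_sum, Finset.sum_add_distrib]
    congr 1
    have hee : ∀ v, e (e v) = v := fun v => by
      have : ∀ a : Fin 2, a + 1 + 1 = a := by decide
      rw [he, he]; simp [this]
    rw [← Equiv.sum_comp e fun v => if ∀ j, j ∉ is → v j = y j then φ (e v) else 0,
      ← Finset.sum_add_distrib]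
    refine Finset.sum_congr rfl fun v _ => ?_
    rw [hee]
    have hcongr : ∀ j, j ≠ i → e v j = v j := fun j hj => by rw [he, Function.update_of_ne hj]
    have hei : e v i = v i + 1 := by rw [he, Function.update_self]
    have hA : (∀ j, j ∉ is → v j = y j) ↔ (∀ j, j ∉ i :: is → v j = y j) ∧ v i = 0 := by
      constructor
      · exact fun h => ⟨fun j hj => h j fun hj' => hj (List.mem_cons_of_mem _ hj'),
          (h i hnd.1).trans hyi⟩
      · rintro ⟨h, hi⟩ j hj
        by_cases hji : j = i
        · rw [hji, hi, hyi]
        · exact h j (by simp [hji, hj])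
    have hB : (∀ j, j ∉ is → e v j = y j) ↔ (∀ j, j ∉ i :: is → v j = y j) ∧ v i = 1 := by
      have h2 : ∀ a : Fin 2, a + 1 = 0 ↔ a = 1 := by decide
      rw [← h2, ← hei]
      constructor
      · exact fun h => ⟨fun j hj => by
          rw [← hcongr j fun h => hj (by simp [h])]
          exact h j fun hj' => hj (List.mem_cons_of_mem _ hj'), (h i hnd.1).trans hyi⟩
      · rintro ⟨h, hi⟩ j hj
        by_cases hji : j = i
        · rw [hji, hi, hyi]
        · rw [hcongr j hji]; exact h j (by simp [hji, hj])
    simp only [hA, hB]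
    rcases h01 (v i) with hv | hv <;> simp [hv]

lemma hadamards_eq_zero {W : ℕ} (is : List (Fin W)) (φ : QState W) (j : Fin W) (hj : j ∉ is)
    (hφ : ∀ y, y j ≠ 0 → φ y = 0) (y : Bits W) (hy : y j ≠ 0) :
    applyGates (is.map Gate.H) φ y = 0 := by
  induction is generalizing φ with
  | nil => exact hφ y hy
  | cons i is ih =>
    rw [List.mem_cons, not_or] at hj
    refine ih ((Gate.H i).apply φ) hj.2 fun y hy => ?_
    simp only [Gate.apply]
    rw [hφ _ (by rwa [Function.update_of_ne hj.1]), hφ _ (by rwa [Function.update_of_ne hj.1])]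
    simp

/-- `finFunctionFinEquiv` puts the least significant bit first. -/
lemma lt_two_pow_iff {k n : ℕ} (u : Bits k) :
    (finFunctionFinEquiv u : ℕ) < 2 ^ n ↔ ∀ i : Fin k, n ≤ i → u i = 0 := by
  set x := finFunctionFinEquiv u with hx
  have hu : ∀ i, (u i : ℕ) = x / 2 ^ (i : ℕ) % 2 := fun i => by
    have : u = finFunctionFinEquiv.symm x := by simp [hx]
    rw [this]; rfl
  constructor
  · intro h i hi
    refine Fin.ext ?_
    have : (2 : ℕ) ^ n ≤ 2 ^ (i : ℕ) := Nat.pow_le_pow_right (by norm_num) hi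
    rw [hu, Nat.div_eq_of_lt (by omega)]; rfl
  · intro h
    refine Nat.lt_pow_two_of_testBit _ fun i hi => ?_
    by_cases hik : i < k
    · have h1 := hu ⟨i, hik⟩
      rw [h ⟨i, hik⟩ hi] at h1
      rw [Nat.testBit_eq_decide_div_mod_eq]
      simp only [Fin.val_zero] at h1
      simp [← h1]
    · refine Nat.testBit_lt_two_pow (x.isLt.trans_le ?_)
      exact Nat.pow_le_pow_right (by norm_num) (by omega)

lemma even_label_iff {k : ℕ} (u : Bits k) (hk : 0 < k) :
    Even (label (finFunctionFinEquiv u)) ↔ u ⟨0, hk⟩ = 1 := by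
  set x := finFunctionFinEquiv u with hx
  have hu : (u ⟨0, hk⟩ : ℕ) = x / 2 ^ 0 % 2 := by
    have : u = finFunctionFinEquiv.symm x := by simp [hx]
    rw [this]; rfl
  rw [pow_zero, Nat.div_one] at hu
  rw [label, Nat.even_iff, Fin.ext_iff, hu]
  simp only [Fin.val_one]
  omega

end InPlaceSep

/-! ### Amplitudes and acceptance probability of the one-query verifier -/

namespace InPlaceSep

/-- The ancilla label in which only the flag `0` is set. -/
def flagged (k : ℕ) : Fin (k + 2) → Fin 2 := fun j => if (j : ℕ) = 1 then 1 else 0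

lemma flagged_natAdd (k : ℕ) (u : Bits k) (i : Fin (k + (k + 2))) (hi : k ≤ (i : ℕ)) :
    Fin.append u (flagged k) i = if (i : ℕ) = k + 1 then 1 else 0 := by
  obtain ⟨j, rfl⟩ : ∃ j : Fin (k + 2), i = Fin.natAdd k j :=
    ⟨⟨i - k, by omega⟩, Fin.ext (by simp; omega)⟩
  rw [Fin.append_right, flagged]
  congr 1
  simp only [Fin.val_natAdd]
  exact propext (by omega)

/-- The flag is set by the parity before the query. If the input contains a `false`, no gate sets it
and these amplitudes vanish. -/
lemma verifier_init_append {l n k : ℕ} (hk : k = l * n) (hn : n ≤ k) (good : Bool) (ψ : QState k)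
    (u : Bits k) :
    applyGates (verifierCircuit l n k hk hn good).init (withAncillas (k + 2) ψ)
      (Fin.append u (flagged k)) =
      if good = true ∧ Even (label (finFunctionFinEquiv u)) then ψ u else 0 := by
  cases good
  · have h : ¬ ∀ j : Fin (k + 2), Fin.append u (flagged k) (Fin.natAdd k j) = 0 := fun h => by
      simpa [flagged] using h ⟨1, by omega⟩
    simp only [verifierCircuit, Bool.false_eq_true, if_false, false_and]
    exact if_neg h
  · simp only [verifierCircuit, if_true, true_and]
    change withAncillas (k + 2) ψ (Function.update _ _ _) = _
    have hF : Fin.append u (flagged k) (flagWire k 0 (by omega)) = 1 := by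
      rw [flagged_natAdd _ _ _ (Nat.le_add_right k 1)]; simp [flagWire]
    rw [hF]
    by_cases hk0 : 0 < k
    · simp only [even_label_iff u hk0]
      have h0 : Fin.append u (flagged k) ⟨0, by omega⟩ = u ⟨0, hk0⟩ :=
        Fin.append_left u (flagged k) ⟨0, hk0⟩
      rw [h0]
      have hu : ∀ i, Function.update (Fin.append u (flagged k)) (flagWire k 0 (by omega))
          (1 + u ⟨0, hk0⟩) (Fin.castAdd (k + 2) i) = u i := fun i => by
        rw [Function.update_of_ne, Fin.append_left]
        have := i.isLt
        intro h
        have := congrArg Fin.val h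
        simp [flagWire] at this
        omega
      unfold withAncillas
      simp only [hu]
      refine if_congr ?_ rfl rfl
      constructor
      · intro h
        have h1 := h ⟨1, by omega⟩
        have h2 : Fin.natAdd k (⟨1, by omega⟩ : Fin (k + 2)) = flagWire k 0 (by omega) := rfl
        rw [h2, Function.update_self] at h1
        exact (by decide : ∀ a : Fin 2, 1 + a = 0 → a = 1) _ h1
      · intro h j
        by_cases hj : (j : ℕ) = 1
        · have h2 : Fin.natAdd k j = flagWire k 0 (by omega) := Fin.ext (by simp [flagWire, hj])
          rw [h2, Function.update_self, h]; rfl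
        · rw [Function.update_of_ne, Fin.append_right, flagged, if_neg hj]
          intro h
          have := congrArg Fin.val h
          simp [flagWire] at this
          omega
    -- With an empty witness register, the control of the CNOT is the spare ancilla, which is `0`;
    -- this matches the only label `1` being odd.
    · have hk0' : k = 0 := by omega
      subst hk0'
      have h1 : ¬ Even (label (finFunctionFinEquiv u)) := by
        have : (finFunctionFinEquiv u : ℕ) = 0 := by
          simp
        rw [label, this]; decide
      rw [if_neg h1]
      refine if_neg fun h => ?_
      have h3 := h ⟨1, by omega⟩
      have h2 : Fin.natAdd 0 (⟨1, by omega⟩ : Fin (0 + 2)) = flagWire 0 0 (by omega) := rfl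
      rw [h2, Function.update_self, flagged_natAdd _ _ _ (by simp)] at h3
      simp at h3

lemma verifier_init_eq_zero {l n k : ℕ} (hk : k = l * n) (hn : n ≤ k) (good : Bool) (ψ : QState k)
    (y : Bits (k + (k + 2))) (i : Fin (k + (k + 2))) (hi : k ≤ (i : ℕ)) (hi' : (i : ℕ) ≠ k + 1)
    (hy : y i ≠ 0) :
    applyGates (verifierCircuit l n k hk hn good).init (withAncillas (k + 2) ψ) y = 0 := by
  have hA : ∀ y : Bits (k + (k + 2)), y i ≠ 0 → withAncillas (k + 2) ψ y = 0 := fun y hy => by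
    refine if_neg fun h => hy ?_
    have h1 : Fin.natAdd k (⟨i - k, by omega⟩ : Fin (k + 2)) = i := Fin.ext (by simp; omega)
    have := h ⟨i - k, by omega⟩
    rwa [h1] at this
  cases good
  · exact hA y hy
  · have h : i ≠ flagWire k 0 (by omega) := fun h => hi' (by rw [h]; rfl)
    refine hA (Function.update y (flagWire k 0 (by omega)) (y (flagWire k 0 (by omega)) + y ⟨0, by omega⟩)) ?_
    rwa [Function.update_of_ne h]

/-- Isolates the state `φ` right after the query, where the amplitude at `x` is that of the
even-projected witness at the preimage of `x`. -/
lemma verifier_final {l n : ℕ} (hn : n ≤ l * n) (good : Bool)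
    (O : PermOracle fun n => l * n) (ψ : QState (l * n)) :
    ∃ φ : QState (l * n + (l * n + 2)),
      (∀ (y : Bits (l * n + (l * n + 2))) (i : Fin (l * n + (l * n + 2))), l * n ≤ (i : ℕ) →
        (i : ℕ) ≠ l * n + 1 → y i ≠ 0 → φ y = 0) ∧
      (∀ x : Fin (2 ^ (l * n)), φ (Fin.append (finFunctionFinEquiv.symm x) (flagged (l * n))) =
        if good = true ∧ Even (label ((O n).symm x)) then
          ψ (finFunctionFinEquiv.symm ((O n).symm x)) else 0) ∧
      (verifierCircuit l n (l * n) rfl hn good).run O ψ = applyGates (cascade (l * n) (l * n) le_rfl)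
        (applyGates (((List.finRange n).map fun i : Fin n =>
          (⟨i, by have := i.isLt; omega⟩ : Fin (l * n + (l * n + 2)))).map Gate.H) φ) := by
  set Q : Query (fun n => l * n) (l * n + (l * n + 2)) := ⟨n, ⟨fun j => ⟨j, by
    have := j.isLt; omega⟩, fun i j h => by simpa [Fin.ext_iff] using h⟩⟩ with hQ
  set φ₀ := applyGates (verifierCircuit l n (l * n) rfl hn good).init
    (withAncillas (l * n + 2) ψ) with hφ₀
  have happ : ∀ y, Q.apply O φ₀ y = φ₀ (Q.setReg y ((O n).symm (Q.reg y))) := fun y => rfl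
  have hoff : ∀ y v (i : Fin (l * n + (l * n + 2))), l * n ≤ (i : ℕ) → Q.setReg y v i = y i :=
    fun y v i hi => Q.setReg_of_notMem y v i (by
      rintro ⟨j, hj⟩
      have h1 := congrArg Fin.val hj
      have h2 : ((Q.wires j : Fin (l * n + (l * n + 2))) : ℕ) < l * n := j.isLt
      omega)
  refine ⟨Q.apply O φ₀, fun y i hi hi' hy => ?_, fun x => ?_, ?_⟩
  · rw [happ]
    exact verifier_init_eq_zero rfl hn good ψ _ i hi hi' (by rwa [hoff _ _ _ hi])
  · have hreg : Q.reg (Fin.append (finFunctionFinEquiv.symm x) (flagged (l * n))) = x := by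
      have : (fun j => Fin.append (finFunctionFinEquiv.symm x) (flagged (l * n)) (Q.wires j)) =
          finFunctionFinEquiv.symm x := funext fun j =>
        Fin.append_left (finFunctionFinEquiv.symm x) (flagged (l * n)) j
      rw [Query.reg, this, Equiv.apply_symm_apply]
    have hset : ∀ v, Q.setReg (Fin.append (finFunctionFinEquiv.symm x) (flagged (l * n))) v =
        Fin.append (finFunctionFinEquiv.symm v) (flagged (l * n)) := fun v => by
      funext i
      refine Fin.addCases (fun j => ?_) (fun j => ?_) i
      · rw [Fin.append_left]
        exact Q.wires.injective.extend_apply _ _ j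
      · rw [hoff _ _ _ (by simp), Fin.append_right, Fin.append_right]
    rw [happ, hreg, hset]
    refine (verifier_init_append rfl hn good ψ _).trans ?_
    rw [Equiv.apply_symm_apply]
  · rw [← applyGates_append, List.map_map]
    rfl

/-- The acceptance probability of the verifier: the witness is projected to the even labels, and the
result of the query to the uniform superposition. -/
theorem verifier_acceptProb {l n : ℕ} (hn : n ≤ l * n) (good : Bool)
    (O : PermOracle fun n => l * n) (ψ : QState (l * n)) :
    (verifierCircuit l n (l * n) rfl hn good).acceptProb O ψ = (1 / 2) ^ n *
      ‖∑ x : Fin (2 ^ (l * n)), if good = true ∧ Even (label x) ∧ label (O n x) ≤ 2 ^ n then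
        ψ (finFunctionFinEquiv.symm x) else 0‖ ^ 2 := by
  classical
  obtain ⟨φ, hφ0, hφ, hrun⟩ := verifier_final hn good O ψ
  set is := (List.finRange n).map fun i : Fin n =>
    (⟨i, by have := i.isLt; omega⟩ : Fin ((l * n) + ((l * n) + 2))) with his
  have hmem : ∀ i, i ∈ is ↔ (i : ℕ) < n := fun i => by
    simp only [his, List.mem_map, List.mem_finRange, true_and]
    constructor
    · rintro ⟨j, rfl⟩; exact j.isLt
    · exact fun h => ⟨⟨i, h⟩, rfl⟩
  have hnd : is.Nodup := (List.nodup_finRange n).map fun i j h => by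
    simpa [Fin.ext_iff] using h
  have hlen : is.length = n := by simp [his]
  set φ₂ := applyGates (is.map Gate.H) φ with hφ₂
  set zs : Bits ((l * n) + ((l * n) + 2)) := Fin.append 0 (flagged (l * n)) with hzs
  have hzs' : ∀ i : Fin ((l * n) + ((l * n) + 2)), zs i = if (i : ℕ) = (l * n) + 1 then 1 else 0 := fun i => by
    by_cases hi : (l * n) ≤ (i : ℕ)
    · exact flagged_natAdd (l * n) 0 i hi
    · rw [if_neg (by omega)]
      exact Fin.append_left 0 (flagged (l * n)) ⟨i, by omega⟩
  -- Pulled back through the cascade, the only accepting label in the support of `φ₂` is `zs`, with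
  -- a zero witness register and only flag `0` set.
  have hacc : (verifierCircuit l n (l * n) rfl hn good).acceptProb O ψ = ‖φ₂ zs‖ ^ 2 := by
    have h1 : (verifierCircuit l n (l * n) rfl hn good).acceptProb O ψ =
        ∑ y : Bits ((l * n) + ((l * n) + 2)), (if y (flagWire (l * n) (l * n) le_rfl) = 1 then (1 : ℝ) else 0) *
          ‖applyGates (cascade (l * n) (l * n) le_rfl) φ₂ y‖ ^ 2 := by
      simp only [Circuit.acceptProb, hrun, ite_mul, one_mul, zero_mul]
      rfl
    rw [h1, sum_classical_gates _ (cascade_classical (l * n) (l * n) le_rfl) φ₂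
      fun y => if y (flagWire (l * n) (l * n) le_rfl) = 1 then (1 : ℝ) else 0]
    have hspec : ∀ z : Bits ((l * n) + ((l * n) + 2)), (∀ i : Fin ((l * n) + ((l * n) + 2)), (l * n) ≤ (i : ℕ) → (i : ℕ) ≠ (l * n) + 1 →
        z i = 0) →
        ((cascade (l * n) (l * n) le_rfl).foldl (fun y g => g.classical y) z (flagWire (l * n) (l * n) le_rfl) = 1 ↔
          z = zs) := fun z hz => by
      rw [(cascade_spec (l * n) (l * n) le_rfl z (fun j hj hj0 => hz _ (by simp [flagWire]; omega)
        (by simp [flagWire]; omega)) _ rfl).2.2]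
      constructor
      · rintro ⟨h2, h3⟩
        funext i
        rw [hzs']
        by_cases hi : (i : ℕ) = (l * n) + 1
        · rw [if_pos hi, ← h2]; congr 1; exact Fin.ext (by simp [flagWire, hi])
        · rw [if_neg hi]
          by_cases hik : (i : ℕ) < (l * n)
          · exact h3 i hik
          · exact hz i (by omega) hi
      · rintro rfl
        exact ⟨by rw [hzs']; simp [flagWire], fun i hi => by
          rw [hzs']; exact if_neg (by simp only; omega)⟩
    rw [Finset.sum_eq_single zs]
    · rw [if_pos ((hspec zs fun i hi hi' => by rw [hzs', if_neg hi']).2 rfl), one_mul]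
    · intro z _ hne
      by_cases hz : ∀ i : Fin ((l * n) + ((l * n) + 2)), (l * n) ≤ (i : ℕ) → (i : ℕ) ≠ (l * n) + 1 → z i = 0
      · rw [if_neg fun h => hne ((hspec z hz).1 h), zero_mul]
      · push Not at hz
        obtain ⟨i, hi, hi', hzi⟩ := hz
        rw [hφ₂, hadamards_eq_zero is φ i (fun h => by rw [hmem] at h; omega)
          (fun y hy => hφ0 y i hi hi' hy) z hzi]
        simp
    · simp
  -- Labels that agree with `zs` off the first `n` wires are the values below `2 ^ n`; reindexing by
  -- the permutation turns them into their preimages.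
  have hsum : ∑ v, (if ∀ j, j ∉ is → v j = zs j then φ v else 0) =
      ∑ x : Fin (2 ^ (l * n)), if good = true ∧ Even (label x) ∧ label (O n x) ≤ 2 ^ n then
        ψ (finFunctionFinEquiv.symm x) else 0 := by
    rw [← Equiv.sum_comp (Fin.appendEquiv (α := Fin 2) (l * n) ((l * n) + 2)), Fintype.sum_prod_type]
    have h1 : ∀ u : Bits (l * n), ∑ a : Fin ((l * n) + 2) → Fin 2,
        (if ∀ j, j ∉ is → Fin.appendEquiv (l * n) ((l * n) + 2) (u, a) j = zs j then
          φ (Fin.appendEquiv (l * n) ((l * n) + 2) (u, a)) else 0) =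
        if ∀ i : Fin (l * n), n ≤ i → u i = 0 then φ (Fin.append u (flagged (l * n))) else 0 := by
      intro u
      rw [Finset.sum_eq_single (flagged (l * n))]
      · refine if_congr ⟨fun h i hi => ?_, fun h j hj => ?_⟩ rfl rfl
        · have h2 := h (Fin.castAdd ((l * n) + 2) i) (fun h => by rw [hmem] at h; simp at h; omega)
          rw [hzs, Fin.append_left] at h2
          simpa [Fin.appendEquiv] using h2
        · rw [hmem] at hj
          change Fin.append u (flagged (l * n)) j = _
          by_cases hjk : (l * n) ≤ (j : ℕ)
          · rw [hzs', flagged_natAdd _ _ _ hjk]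
          · rw [hzs', if_neg (by omega)]
            exact (Fin.append_left u (flagged (l * n)) ⟨j, by omega⟩).trans (h ⟨j, by omega⟩ (by simpa using hj))
      · intro a _ ha
        refine if_neg fun h => ha (funext fun j => ?_)
        have h2 := h (Fin.natAdd (l * n) j) (fun h => by rw [hmem] at h; simp at h; omega)
        rw [hzs, Fin.append_right] at h2
        simpa [Fin.appendEquiv] using h2
      · simp
    rw [Finset.sum_congr rfl fun u _ => h1 u]
    rw [← Equiv.sum_comp finFunctionFinEquiv.symm, ← Equiv.sum_comp (O n)]
    refine Finset.sum_congr rfl fun x _ => ?_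
    rw [hφ (O n x), Equiv.symm_apply_apply]
    have h3 : (∀ i : Fin (l * n), n ≤ i → (finFunctionFinEquiv.symm (O n x) : Bits (l * n)) i = 0) ↔
        label (O n x) ≤ 2 ^ n := by
      rw [← lt_two_pow_iff, Equiv.apply_symm_apply, label, Nat.succ_le_iff]
    simp only [h3]
    by_cases h4 : label (O n x) ≤ 2 ^ n <;> simp [h4]
  rw [hacc, hφ₂, hadamards_apply is hnd φ zs fun i hi => by
    rw [hmem] at hi; rw [hzs', if_neg (by omega)], hsum, hlen, norm_mul, mul_pow, norm_pow, norm_div,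
    norm_one, Complex.norm_real, Real.norm_eq_abs, abs_of_nonneg (Real.sqrt_nonneg _), ← pow_mul,
    mul_comm n 2, pow_mul, div_pow, Real.sq_sqrt (by norm_num), one_pow]

end InPlaceSep

namespace InPlaceSep

/-! ### Completeness and soundness of the verifier -/

lemma PointerChain.label_perm_le_iff {l : ℕ} {α : ℝ} {n : ℕ} (C : PointerChain l α n)
    (last : Fin (numBuckets α n)) (h : (last : ℕ) + 1 = numBuckets α n) (x : Fin (2 ^ (l * n))) :
    label (C.perm x) ≤ 2 ^ n ↔ ∃ j, C.f last j = x := by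
  constructor
  · intro hx
    have hj : (C.perm x : ℕ) < 2 ^ n := hx
    refine ⟨⟨C.perm x, hj⟩, C.perm.injective (Fin.ext ?_)⟩
    have := C.perm_last last ⟨C.perm x, hj⟩ h
    simpa [label] using this
  · rintro ⟨j, rfl⟩
    rw [C.perm_last last j h]
    exact j.isLt

lemma PointerChain.card_label_perm_le {l : ℕ} {α : ℝ} {n : ℕ} (C : PointerChain l α n) :
    (Finset.univ.filter fun x => label (C.perm x) ≤ 2 ^ n).card = 2 ^ n := by
  have hb := numBuckets_eq α n
  have hl : (numBuckets α n - 1) < numBuckets α n := by omega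
  have : (Finset.univ.filter fun x => label (C.perm x) ≤ 2 ^ n) =
      Finset.univ.image (C.f ⟨numBuckets α n - 1, hl⟩) := by
    ext x
    simp [C.label_perm_le_iff ⟨numBuckets α n - 1, hl⟩ hb.symm]
  rw [this, Finset.card_image_of_injective _ (C.f_injective _), Finset.card_univ, Fintype.card_fin]

lemma PointerChain.evenCount_eq_card {l : ℕ} {α : ℝ} {n : ℕ} (C : PointerChain l α n) :
    C.evenCount =
      (Finset.univ.filter fun x => Even (label x) ∧ label (C.perm x) ≤ 2 ^ n).card := by
  have hb := numBuckets_eq α n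
  have hl : (numBuckets α n - 1) < numBuckets α n := by omega
  rw [evenCount, ← Set.ncard_coe_finset]
  congr 1
  ext x
  simp only [Set.mem_ofPred_eq, Finset.coe_filter, Finset.mem_univ, true_and,
    C.label_perm_le_iff ⟨numBuckets α n - 1, hl⟩ hb.symm]
  rw [and_comm]
  refine and_congr_right fun _ => ?_
  constructor
  · rintro ⟨i, j, h1, h2⟩
    obtain rfl : i = ⟨numBuckets α n - 1, hl⟩ := Fin.ext (by simp; omega)
    exact ⟨j, h2⟩
  · rintro ⟨j, h⟩
    exact ⟨_, j, hb.symm, h⟩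

lemma norm_sum_ite_sq_le {ι : Type*} [Fintype ι] (p : ι → Prop) [DecidablePred p] (φ : ι → ℂ) :
    ‖∑ x, if p x then φ x else 0‖ ^ 2 ≤ (Finset.univ.filter p).card * ∑ x, ‖φ x‖ ^ 2 := by
  rw [← Finset.sum_filter]
  calc ‖∑ x ∈ Finset.univ.filter p, φ x‖ ^ 2
      ≤ (∑ x ∈ Finset.univ.filter p, ‖φ x‖) ^ 2 := by gcongr; exact norm_sum_le _ _
    _ ≤ (Finset.univ.filter p).card * ∑ x ∈ Finset.univ.filter p, ‖φ x‖ ^ 2 :=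
        sq_sum_le_card_mul_sum_sq
    _ ≤ _ := by
        refine mul_le_mul_of_nonneg_left ?_ (Nat.cast_nonneg _)
        exact Finset.sum_le_univ_sum_of_nonneg fun _ => sq_nonneg _

/-- By Cauchy–Schwarz the probability is at most the number of contributing labels over `2 ^ n`: at
most `1 / 2` for a NO instance, and `0` for an input that is not unary. -/
lemma verifier_sound {l n k : ℕ} {α : ℝ} (hk : k = l * n) (hn : n ≤ k) (good : Bool)
    (O : PermOracle fun n => l * n) (C : PointerChain l α n) (hC : O n = C.perm)
    (h : good = true → C.IsNo) (ψ : QState k) (hψ : ψ.IsUnit) :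
    (verifierCircuit l n k hk hn good).acceptProb O ψ ≤ 9 / 10 := by
  subst hk
  rw [verifier_acceptProb hn, hC]
  have h1 := norm_sum_ite_sq_le
    (fun x : Fin (2 ^ (l * n)) => good = true ∧ Even (label x) ∧ label (C.perm x) ≤ 2 ^ n)
    fun x => ψ (finFunctionFinEquiv.symm x)
  have hu : ∑ x : Fin (2 ^ (l * n)), ‖ψ (finFunctionFinEquiv.symm x)‖ ^ 2 = 1 :=
    (Equiv.sum_comp finFunctionFinEquiv.symm fun y => ‖ψ y‖ ^ 2).trans hψ
  rw [hu, mul_one] at h1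
  refine (mul_le_mul_of_nonneg_left h1 (by positivity)).trans ?_
  cases good
  · simp; norm_num
  · simp only [true_and]
    have h2 : 2 * C.evenCount ≤ 2 ^ n := h rfl
    rw [← C.evenCount_eq_card]
    have h3 : (2 : ℝ) * C.evenCount ≤ 2 ^ n := by exact_mod_cast h2
    have h4 : ((1 : ℝ) / 2) ^ n * 2 ^ n = 1 := by rw [← mul_pow]; norm_num
    have h5 := mul_le_mul_of_nonneg_left h3 (by positivity : (0 : ℝ) ≤ (1 / 2) ^ n)
    linarith

lemma PointerChain.mem_preimage {l : ℕ} {α : ℝ} {n : ℕ} (C : PointerChain l α n)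
    (x : Fin (2 ^ (l * n))) : (x : ℕ) ∈ C.preimage ↔ label (C.perm x) ≤ 2 ^ n := by
  simp [preimage, Fin.val_inj]

lemma PointerChain.card_preimage {l : ℕ} {α : ℝ} {n : ℕ} (C : PointerChain l α n) :
    C.preimage.card = 2 ^ n := by
  rw [preimage, Finset.card_image_of_injective _ Fin.val_injective, C.card_label_perm_le]

lemma uniformState_symm_apply {l n : ℕ} {α : ℝ} (C : PointerChain l α n)
    (x : Fin (2 ^ (l * n))) : uniformState (l * n) C.preimage (finFunctionFinEquiv.symm x) =
      if label (C.perm x) ≤ 2 ^ n then 1 / (√(2 ^ n) : ℂ) else 0 := by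
  simp [uniformState, C.mem_preimage, C.card_preimage]

lemma isUnit_uniformState {l n k : ℕ} {α : ℝ} (hk : k = l * n) (C : PointerChain l α n) :
    (uniformState k C.preimage).IsUnit := by
  subst hk
  rw [QState.IsUnit, ← Equiv.sum_comp finFunctionFinEquiv.symm]
  have : ∀ x : Fin (2 ^ (l * n)),
      ‖uniformState (l * n) C.preimage (finFunctionFinEquiv.symm x)‖ ^ 2 =
        if label (C.perm x) ≤ 2 ^ n then ((2 : ℝ) ^ n)⁻¹ else 0 := fun x => by
    rw [uniformState_symm_apply]
    split_ifs
    · rw [norm_div, norm_one, Complex.norm_real, Real.norm_of_nonneg (Real.sqrt_nonneg _), div_pow,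
        Real.sq_sqrt (by positivity), one_pow, one_div]
    · simp
  rw [Finset.sum_congr rfl fun x _ => this x, ← Finset.sum_filter, Finset.sum_const,
    C.card_label_perm_le]
  simp

/-- In a YES instance the parity test discards nothing, and `N` amplitudes `1 / √N` sum to `√N`,
whose square cancels `2 ^ (-n)`. -/
lemma verifier_complete {l n k : ℕ} {α : ℝ} (hk : k = l * n) (hn : n ≤ k)
    (O : PermOracle fun n => l * n) (C : PointerChain l α n) (hC : O n = C.perm) (h : C.IsYes) :
    (verifierCircuit l n k hk hn true).acceptProb O (uniformState k C.preimage) = 1 := by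
  subst hk
  rw [verifier_acceptProb hn, hC]
  have heven : (Finset.univ.filter fun x => Even (label x) ∧ label (C.perm x) ≤ 2 ^ n) =
      Finset.univ.filter fun x => label (C.perm x) ≤ 2 ^ n :=
    Finset.eq_of_subset_of_card_le (fun x => by simp) (by
      rw [C.card_label_perm_le, ← C.evenCount_eq_card]; exact h.ge)
  have hx : ∀ x : Fin (2 ^ (l * n)),
      (if true = true ∧ Even (label x) ∧ label (C.perm x) ≤ 2 ^ n then
        uniformState (l * n) C.preimage (finFunctionFinEquiv.symm x) else 0) =
      if label (C.perm x) ≤ 2 ^ n then 1 / (√(2 ^ n) : ℂ) else 0 := fun x => by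
    have := Finset.ext_iff.1 heven x
    simp only [Finset.mem_filter, Finset.mem_univ, true_and] at this
    simp only [true_and, this, uniformState_symm_apply]
    split_ifs <;> rfl
  rw [Finset.sum_congr rfl fun x _ => hx x, ← Finset.sum_filter, Finset.sum_const,
    C.card_label_perm_le, nsmul_eq_mul, norm_mul, mul_pow, norm_div, norm_one, Complex.norm_real,
    Real.norm_of_nonneg (Real.sqrt_nonneg _), div_pow (1 : ℝ) (√_), Real.sq_sqrt (by positivity)]
  simp only [Nat.cast_pow, Nat.cast_ofNat, norm_pow, Complex.norm_ofNat, div_pow, one_pow]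
  field_simp

/-- The verifier that checks the parity of the last pointers. -/
noncomputable def pointerVerifier (l : ℕ) (hl : 4 ≤ l) : Verifier fun n => l * n where
  wit := Polynomial.C l * Polynomial.X
  circ x := verifierCircuit l x.length _ (by simp) (by simpa using Nat.le_mul_of_pos_left _ (by omega))
    (x.all id)

lemma pointerVerifier_queryBound (l : ℕ) (hl : 4 ≤ l) :
    (pointerVerifier l hl).QueryBound (fun _ => 1) fun _ => 1 := by
  intro x
  refine ⟨le_rfl, fun r hr => ?_⟩
  obtain rfl := List.mem_singleton.1 hr
  exact le_rfl

lemma pointerVerifier_sound {l : ℕ} (hl : 4 ≤ l) {α : ℝ} (P : ∀ n, PCInstance l α n) (x : List Bool)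
    (hx : x ∉ lang P) (ψ) (hψ : QState.IsUnit ψ) :
    (pointerVerifier l hl).acceptProb (oracle P) x ψ ≤ 9 / 10 := by
  refine verifier_sound (by simp [pointerVerifier])
    (by simpa [pointerVerifier] using Nat.le_mul_of_pos_left _ (by omega)) (x.all id) _
    (P x.length).toPointerChain rfl (fun hg => ?_) ψ hψ
  refine (P x.length).promise.resolve_left fun hy => hx ⟨x.length, ?_, hy⟩
  refine List.eq_replicate_iff.2 ⟨rfl, fun b hb => ?_⟩
  exact List.all_eq_true.1 hg b hb

lemma pointerVerifier_complete {l : ℕ} (hl : 4 ≤ l) {α : ℝ} (P : ∀ n, PCInstance l α n) (n : ℕ)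
    (h : (P n).IsYes) :
    QState.IsUnit (uniformState ((pointerVerifier l hl).wit.eval (List.replicate n true).length)
      (P n).preimage) ∧
    (pointerVerifier l hl).acceptProb (oracle P) (List.replicate n true)
      (uniformState _ (P n).preimage) = 1 := by
  have key : ∀ (m : ℕ) (hm : m = n) (k : ℕ) (hk : k = l * m) (hmk : m ≤ k),
      (verifierCircuit l m k hk hmk true).acceptProb (oracle P)
        (uniformState k (P n).preimage) = 1 := by
    rintro m rfl k hk hmk
    exact verifier_complete hk hmk _ (P m).toPointerChain rfl h
  refine ⟨isUnit_uniformState (by simp [pointerVerifier]) _, ?_⟩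
  have := key (List.replicate n true).length (by simp)
    ((pointerVerifier l hl).wit.eval (List.replicate n true).length) (by simp [pointerVerifier])
    (by simpa [pointerVerifier] using Nat.le_mul_of_pos_left _ (by omega))
  rw [← this]
  simp [Verifier.acceptProb, pointerVerifier]

lemma pointerVerifier_verifiesQMA1 {l : ℕ} (hl : 4 ≤ l) {α : ℝ} (P : ∀ n, PCInstance l α n) :
    (pointerVerifier l hl).VerifiesQMA1 (oracle P) (lang P) := by
  -- The constant polynomial `9` encodes the bound `1 - 1 / (9 + 1) = 9 / 10`.
  refine ⟨?_, Polynomial.C 9, fun x hx ψ hψ => ?_⟩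
  · rintro x ⟨n, rfl, h⟩
    exact ⟨_, pointerVerifier_complete hl P n h⟩
  · refine (pointerVerifier_sound hl P x hx ψ hψ).trans ?_
    norm_num

end InPlaceSep

namespace InPlaceSep
open Turing

/-! ### A programming language for stack machines -/

/-- Programs that manipulate stacks of bits: `loop k p q` pops bits from the stack `k` until it is
empty, and executes `p` for each `true` and `q` for each `false`. -/
inductive Prog (K : Type) : Type
  | push (k : K) (L : List Bool) : Prog K
  | seq (p q : Prog K) : Prog K
  | loop (k : K) (p q : Prog K) : Prog K

namespace Prog

variable {K : Type} [DecidableEq K]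

/-- `p.Runs S t S'`: started on the stacks `S`, the program `p` ends with the stacks `S'` after at
most `t` steps. -/
inductive Runs : Prog K → (K → List Bool) → ℕ → (K → List Bool) → Prop
  | push (k : K) (L : List Bool) (S : K → List Bool) :
      Runs (push k L) S 1 (Function.update S k (L ++ S k))
  | seq {p q : Prog K} {S S' S'' : K → List Bool} {t t' : ℕ} :
      Runs p S t S' → Runs q S' t' S'' → Runs (seq p q) S (t + t') S''
  | loop_nil {k : K} {p q : Prog K} {S : K → List Bool} : S k = [] → Runs (loop k p q) S 1 S
  | loop_true {k : K} {p q : Prog K} {S S' S'' : K → List Bool} {L : List Bool} {t t' : ℕ} :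
      S k = true :: L → Runs p (Function.update S k L) t S' → Runs (loop k p q) S' t' S'' →
      Runs (loop k p q) S (1 + t + t') S''
  | loop_false {k : K} {p q : Prog K} {S S' S'' : K → List Bool} {L : List Bool} {t t' : ℕ} :
      S k = false :: L → Runs q (Function.update S k L) t S' → Runs (loop k p q) S' t' S'' →
      Runs (loop k p q) S (1 + t + t') S''
  | mono {p : Prog K} {S S' : K → List Bool} {t t' : ℕ} : t ≤ t' → Runs p S t S' → Runs p S t' S'

/-- The labels of the machine that executes a program. -/
def Label : Prog K → Type
  | push _ _ => Unit
  | seq p q => Label p ⊕ Label q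
  | loop _ p q => Unit ⊕ (Label p ⊕ Label q)

instance fintypeLabel : (p : Prog K) → Fintype (Label p)
  | push _ _ => inferInstanceAs (Fintype Unit)
  | seq p q => @instFintypeSum _ _ (fintypeLabel p) (fintypeLabel q)
  | loop _ p q =>
    @instFintypeSum _ _ _ (@instFintypeSum _ _ (fintypeLabel p) (fintypeLabel q))

/-- The label at which the execution begins. -/
def entry : (p : Prog K) → Label p
  | push _ _ => ()
  | seq p _ => Sum.inl (entry p)
  | loop _ _ _ => Sum.inl ()

/-- Push a list. -/
def pushStmt {Λ : Type} (k : K) :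
    List Bool → TM2.Stmt (fun _ : K => Bool) Λ (Option Bool) →
      TM2.Stmt (fun _ : K => Bool) Λ (Option Bool)
  | [], s => s
  | b :: L, s => pushStmt k L (.push k (fun _ => b) s)

/-- The statements that execute a program whose labels are embedded by `e`, continuing at `exit`. -/
def stmt {Λ : Type} : (p : Prog K) → (Label p → Λ) → Λ → Label p →
    TM2.Stmt (fun _ : K => Bool) Λ (Option Bool)
  | push k L, _, exit, _ => pushStmt k L (.goto fun _ => exit)
  | seq p q, e, exit, a => Sum.elim (stmt p (fun a => e (Sum.inl a)) (e (Sum.inr (entry q))))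
      (stmt q (fun a => e (Sum.inr a)) exit) a
  | loop k p q, e, exit, a => Sum.elim
      (fun _ => .pop k (fun _ o => o) (.branch (fun v => v == none) (.goto fun _ => exit)
        (.branch (fun v => v == some true) (.goto fun _ => e (Sum.inr (Sum.inl (entry p))))
          (.goto fun _ => e (Sum.inr (Sum.inr (entry q)))))))
      (Sum.elim (stmt p (fun a => e (Sum.inr (Sum.inl a))) (e (Sum.inl ())))
        (stmt q (fun a => e (Sum.inr (Sum.inr a))) (e (Sum.inl ())))) a

lemma stepAux_pushStmt {Λ : Type} (k : K) (L : List Bool)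
    (s : TM2.Stmt (fun _ : K => Bool) Λ (Option Bool)) (v : Option Bool) (S : K → List Bool) :
    TM2.stepAux (pushStmt k L s) v S = TM2.stepAux s v (Function.update S k (L ++ S k)) := by
  induction L generalizing s with
  | nil => simp [pushStmt]
  | cons b L ih =>
    rw [pushStmt, ih]
    simp [TM2.stepAux]

/-- The machine `m` moves from one label and stacks to others in at most `t` steps. -/
def Moves {Λ : Type} (m : Λ → TM2.Stmt (fun _ : K => Bool) Λ (Option Bool)) (a : Λ)
    (S : K → List Bool) (t : ℕ) (a' : Λ) (S' : K → List Bool) : Prop :=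
  ∀ v, ∃ v', ∃ s ≤ t, (flip Option.bind (TM2.step m))^[s] (some ⟨some a, v, S⟩) =
    some ⟨some a', v', S'⟩

lemma Moves.trans {Λ : Type} {m : Λ → TM2.Stmt (fun _ : K => Bool) Λ (Option Bool)} {a a' a'' : Λ}
    {S S' S'' : K → List Bool} {t t' : ℕ} (h : Moves m a S t a' S') (h' : Moves m a' S' t' a'' S'') :
    Moves m a S (t + t') a'' S'' := by
  intro v
  obtain ⟨v', s, hs, h1⟩ := h v
  obtain ⟨v'', s', hs', h2⟩ := h' v'
  refine ⟨v'', s' + s, by omega, ?_⟩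
  rw [Function.iterate_add_apply, h1, h2]

lemma Moves.of_stepAux {Λ : Type} {m : Λ → TM2.Stmt (fun _ : K => Bool) Λ (Option Bool)}
    {a a' : Λ} {S S' : K → List Bool}
    (h : ∀ v, ∃ v', TM2.stepAux (m a) v S = ⟨some a', v', S'⟩) : Moves m a S 1 a' S' := by
  intro v
  obtain ⟨v', h⟩ := h v
  exact ⟨v', 1, le_rfl, congrArg some h⟩

/-- The exit label is kept general because a loop body continues at the label of its own loop. -/
theorem Runs.moves {p : Prog K} {S S' : K → List Bool} {t : ℕ} (h : p.Runs S t S') {Λ : Type}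
    {m : Λ → TM2.Stmt (fun _ : K => Bool) Λ (Option Bool)} (e : p.Label → Λ) (exit : Λ)
    (hm : ∀ a, m (e a) = p.stmt e exit a) : Moves m (e p.entry) S t exit S' := by
  induction h generalizing exit with
  | push k L S =>
    refine Moves.of_stepAux fun v => ⟨v, ?_⟩
    rw [hm, stmt, stepAux_pushStmt]
    rfl
  | @seq p q S S' S'' t t' _ _ ih₁ ih₂ =>
    exact (ih₁ (fun a => e (Sum.inl a)) _ fun a => hm (Sum.inl a)).trans
      (ih₂ (fun a => e (Sum.inr a)) exit fun a => hm (Sum.inr a))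
  | @loop_nil k p q S hS =>
    refine Moves.of_stepAux fun v => ⟨none, ?_⟩
    have : Function.update S k [] = S := by rw [← hS, Function.update_eq_self]
    rw [hm]
    simp [stmt, entry, TM2.stepAux, hS, this]
  | @loop_true k p q S S' S'' L t t' hS _ _ ih₁ ih₂ =>
    refine (Moves.trans (Moves.of_stepAux fun v => ⟨some true, ?_⟩)
      (ih₁ (fun a => e (Sum.inr (Sum.inl a))) _ fun a => hm (Sum.inr (Sum.inl a)))).trans
      (ih₂ e exit hm)
    rw [hm]
    simp [stmt, entry, TM2.stepAux, hS]
  | @loop_false k p q S S' S'' L t t' hS _ _ ih₁ ih₂ =>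
    refine (Moves.trans (Moves.of_stepAux fun v => ⟨some false, ?_⟩)
      (ih₁ (fun a => e (Sum.inr (Sum.inr a))) _ fun a => hm (Sum.inr (Sum.inr a)))).trans
      (ih₂ e exit hm)
    rw [hm]
    simp [stmt, entry, TM2.stepAux, hS]
  | mono htt' _ ih =>
    intro v
    obtain ⟨v', s, hs, h⟩ := ih e exit hm v
    exact ⟨v', s, hs.trans htt', h⟩

/-- The machine that executes a program. -/
def machine [Fintype K] (p : Prog K) (k₀ k₁ : K) : FinTM2 where
  K := K
  k₀ := k₀
  k₁ := k₁
  Γ _ := Bool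
  Λ := Option p.Label
  main := some p.entry
  σ := Option Bool
  initialState := none
  Γk₀Fin := inferInstanceAs (Fintype Bool)
  m a := a.elim (.load (fun _ => none) .halt) (p.stmt some none)

/-- A halting configuration must have the initial state and empty stacks apart from the output. The
label `none` resets the state, which costs the one extra step. -/
theorem nonempty_tm2ComputableInPolyTime [Fintype K] (p : Prog K) (k₀ k₁ : K)
    (f : List Bool → List Bool) (time : Polynomial ℕ)
    (h : ∀ x, p.Runs (Function.update (fun _ => []) k₀ x) (time.eval x.length)
      (Function.update (fun _ => []) k₁ (f x))) :
    Nonempty (TM2ComputableInPolyTime (id : List Bool → List Bool) (id : List Bool → List Bool)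
      f) := by
  have key : ∀ x : List Bool, ∃ s : ℕ, s ≤ time.eval x.length + 1 ∧
      (flip bind (machine p k₀ k₁).step)^[s] (some (initList (machine p k₀ k₁) x)) =
        some (haltList (machine p k₀ k₁) (f x)) := by
    intro x
    obtain ⟨v', s, hs, h1⟩ := (h x).moves (m := (machine p k₀ k₁).m) some none (fun a => rfl) none
    refine ⟨1 + s, by omega, ?_⟩
    have e1 := initList_eq (machine p k₀ k₁) x
    have e2 := haltList_eq (machine p k₀ k₁) (f x)
    refine (congrArg (fun c => (flip bind (machine p k₀ k₁).step)^[1 + s] (some c)) e1).trans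
      (Eq.trans ?_ (congrArg some e2).symm)
    rw [Function.iterate_add_apply]
    exact (congrArg _ h1).trans rfl
  choose s hs hsx using key
  exact ⟨{
    tm := machine p k₀ k₁
    inputAlphabet := Equiv.refl Bool
    outputAlphabet := Equiv.refl Bool
    time := time + 1
    outputsFun := fun x => {
      steps := s x
      evals_in_steps := by
        have h1 : ∀ L : List Bool, L.map (Equiv.refl Bool).invFun = L := fun L => List.map_id L
        refine Eq.trans ?_ ((hsx x).trans ?_)
        · exact congrArg (fun L => (flip bind (machine p k₀ k₁).step)^[s x]
            (some (initList (machine p k₀ k₁) L))) (h1 x)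
        · exact congrArg (fun L => some (haltList (machine p k₀ k₁) L)) (h1 (f x)).symm
      steps_le_m := (hs x).trans (by rw [Polynomial.eval_add, Polynomial.eval_one]; rfl) } }⟩

end Prog

end InPlaceSep

namespace InPlaceSep
open Turing

/-! ### The program that prints the circuits of the verifier -/

/-- The stacks of the printing program: the input, the output, the length of the input, the length
of the witness, a flag, a loop counter, and a temporary stack. -/
inductive Reg : Type
  | inp | out | size | wits | good | idx | tmp
  deriving DecidableEq

instance : Fintype Reg := ⟨{.inp, .out, .size, .wits, .good, .idx, .tmp}, fun x => by
  cases x <;> simp⟩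

namespace Prog

/-- Do nothing. -/
def skip : Prog Reg := push .tmp []

/-- Add the content of the counter `r` to the stack `d`. -/
def copy (r d : Reg) : Prog Reg :=
  seq (loop r (seq (push d [true]) (push .tmp [true])) skip) (loop .tmp (push r [true]) skip)

/-- `F i` describes the stacks with `i` iterations left. Each iteration pays one step for its pop,
and one more step detects the empty stack. -/
lemma runs_loop_replicate {K : Type} [DecidableEq K] {k : K} {p q : Prog K} {t : ℕ}
    (F : ℕ → K → List Bool) (a : ℕ) (hF : ∀ i ≤ a, F i k = List.replicate i true)
    (hp : ∀ i < a, p.Runs (Function.update (F (i + 1)) k (List.replicate i true)) t (F i)) :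
    (loop k p q).Runs (F a) (a * (t + 1) + 1) (F 0) := by
  induction a with
  | zero => exact .mono (by omega) (.loop_nil (hF 0 le_rfl))
  | succ a ih =>
    exact .mono (by ring_nf; omega) (.loop_true (hF (a + 1) le_rfl) (hp a (by omega))
      (ih (fun i hi => hF i (by omega)) fun i hi => hp i (by omega)))

lemma Runs.congr {K : Type} [DecidableEq K] {p : Prog K} {S S' T T' : K → List Bool} {t : ℕ}
    (h : p.Runs S t S') (h₁ : ∀ x, T x = S x) (h₂ : ∀ x, T' x = S' x) : p.Runs T t T' := by
  rwa [funext h₁, funext h₂]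

/-- Reading a stack destroys it, so `r` is drained into both `d` and `.tmp`, and then restored from
`.tmp`. -/
lemma runs_copy {r d : Reg} (hrd : r ≠ d) (hr : r ≠ .tmp) (hd : d ≠ .tmp) (S : Reg → List Bool)
    (a : ℕ) (hS : S r = List.replicate a true) (hT : S .tmp = []) :
    (copy r d).Runs S (5 * a + 2) (Function.update S d (List.replicate a true ++ S d)) := by
  have h1 := runs_loop_replicate (k := r) (p := seq (push d [true]) (push .tmp [true])) (q := skip)
    (t := 2) (fun i => Function.update (Function.update (Function.update S r (List.replicate i true))
      d (List.replicate (a - i) true ++ S d)) .tmp (List.replicate (a - i) true)) a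
    (fun i _ => by simp [hrd, hr]) fun i hi => by
      refine (Runs.seq (Runs.push d [true] _) (Runs.push .tmp [true] _)).congr (fun _ => rfl)
        fun x => ?_
      have e : a - i = (a - (i + 1)) + 1 := by omega
      simp only [Function.update_apply, e, List.replicate_succ]
      split_ifs <;> simp_all
  have h2 := runs_loop_replicate (k := .tmp) (p := push r [true]) (q := skip)
    (t := 1) (fun i => Function.update (Function.update (Function.update S r
      (List.replicate (a - i) true)) d (List.replicate a true ++ S d)) .tmp (List.replicate i true)) a
    (fun i _ => by simp) fun i hi => by
      refine (Runs.push r [true] _).congr (fun _ => rfl) fun x => ?_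
      have e : a - i = (a - (i + 1)) + 1 := by omega
      simp only [Function.update_apply, e, List.replicate_succ]
      split_ifs <;> simp_all
  refine .mono (t := a * (2 + 1) + 1 + (a * (1 + 1) + 1)) (by omega) (.seq
    (h1.congr (fun x => ?_) fun _ => rfl) (h2.congr (fun x => ?_) fun x => ?_)) <;>
  simp only [Function.update_apply, Nat.sub_self, Nat.sub_zero, List.replicate_zero,
    List.nil_append] <;> split_ifs <;> simp_all

/-- On the stacks `S`, the program `p` puts the list `L` on the output stack. -/
def Prints (p : Prog Reg) (S : Reg → List Bool) (L : List Bool) (t : ℕ) : Prop :=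
  ∀ o, p.Runs (Function.update S .out o) t (Function.update S .out (L ++ o))

/-- The output is a stack: what is printed last stands first, so the order of the programs is
reversed. -/
lemma Prints.seq {p q : Prog Reg} {S : Reg → List Bool} {L L' : List Bool} {t t' : ℕ}
    (hp : Prints p S L t) (hq : Prints q S L' t') : Prints (seq q p) S (L ++ L') (t + t') := by
  intro o
  rw [add_comm, List.append_assoc]
  exact .seq (hq o) (hp _)

lemma Prints.mono {p : Prog Reg} {S : Reg → List Bool} {L : List Bool} {t t' : ℕ} (h : t ≤ t')
    (hp : Prints p S L t) : Prints p S L t' := fun o => .mono h (hp o)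

lemma prints_push (S : Reg → List Bool) (L : List Bool) : Prints (push .out L) S L 1 := by
  intro o
  convert Runs.push (K := Reg) .out L _ using 1
  simp

/-- All stacks but the output hold numbers in unary, at most `m`, and the temporary one `0`. -/
def Counters (S : Reg → List Bool) (m : ℕ) : Prop :=
  S .tmp = [] ∧ ∀ r, r ≠ .out → ∃ a ≤ m, S r = List.replicate a true

lemma Counters.eq_replicate {S : Reg → List Bool} {m : ℕ} (h : Counters S m) {r : Reg}
    (hr : r ≠ .out) : S r = List.replicate (S r).length true ∧ (S r).length ≤ m := by
  obtain ⟨a, ha, h⟩ := h.2 r hr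
  rw [h]
  simpa using ha

lemma Counters.update_idx {S : Reg → List Bool} {m i : ℕ} (h : Counters S m) (hi : i ≤ m) :
    Counters (Function.update S .idx (List.replicate i true)) m := by
  refine ⟨by simpa using h.1, fun r hr => ?_⟩
  by_cases hri : r = .idx
  · subst hri; exact ⟨i, hi, by simp⟩
  · rw [Function.update_of_ne hri]; exact h.2 r hr

lemma prints_copy {S : Reg → List Bool} {m : ℕ} (h : Counters S m) {r : Reg} (hr : r ≠ .out)
    (hr' : r ≠ .tmp) :
    Prints (copy r .out) S (List.replicate (S r).length true) (5 * m + 2) := by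
  intro o
  obtain ⟨h1, h2⟩ := h.eq_replicate hr
  have h3 := runs_copy hr hr' (by decide) (Function.update S .out o) _
    (by rw [Function.update_of_ne hr]; exact h1) (by rw [Function.update_of_ne (by decide)]; exact h.1)
  rw [Function.update_idem, Function.update_self] at h3
  exact .mono (by omega) h3

/-- A number that is the sum of some counters and a constant. -/
abbrev Term : Type := List Reg × ℕ

/-- The value of a term. -/
def Term.value (S : Reg → List Bool) (e : Term) : ℕ := (e.1.map fun r => (S r).length).sum + e.2

/-- Print the sum of some counters and the constant `c`. -/
def printTerm (c : ℕ) : List Reg → Prog Reg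
  | [] => push .out (List.replicate c true ++ [false])
  | r :: rs => seq (printTerm c rs) (copy r .out)

lemma prints_printTerm {S : Reg → List Bool} {m : ℕ} (h : Counters S m) (c : ℕ) (rs : List Reg)
    (hrs : ∀ r ∈ rs, r ≠ .out ∧ r ≠ .tmp) :
    Prints (printTerm c rs) S (unary [Term.value S (rs, c)]) (rs.length * (5 * m + 2) + 1) := by
  induction rs with
  | nil => simpa [printTerm, Term.value, unary] using prints_push S (List.replicate c true ++ [false])
  | cons r rs ih =>
    have h1 := (prints_copy h (hrs r List.mem_cons_self).1 (hrs r List.mem_cons_self).2).seq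
      (ih fun r' hr' => hrs r' (List.mem_cons_of_mem _ hr'))
    have h2 : unary [Term.value S (r :: rs, c)] =
        List.replicate (S r).length true ++ unary [Term.value S (rs, c)] := by
      simp only [Term.value, unary, List.map_cons, List.sum_cons, add_assoc, List.replicate_add,
        List.flatMap_singleton, List.append_assoc]
    rw [h2]
    exact h1.mono (by rw [List.length_cons]; ring_nf; omega)

/-- Print some numbers. -/
def printTerms : List Term → Prog Reg
  | [] => skip
  | e :: es => seq (printTerms es) (printTerm e.2 e.1)

/-- At most two counters, which are not the output or the temporary stack. -/
def Term.Valid (e : Term) : Prop := e.1.length ≤ 2 ∧ ∀ r ∈ e.1, r ≠ .out ∧ r ≠ .tmp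

instance : DecidablePred Term.Valid := fun e => by unfold Term.Valid; infer_instance

lemma prints_skip {S : Reg → List Bool} : Prints skip S [] 1 := by
  intro o
  refine (Runs.push Reg.tmp [] _).congr (fun _ => rfl) fun x => ?_
  simp only [List.nil_append, Function.update_eq_self]

lemma prints_printTerms {S : Reg → List Bool} {m : ℕ} (h : Counters S m) (es : List Term)
    (hes : ∀ e ∈ es, e.Valid) :
    Prints (printTerms es) S (unary (es.map (Term.value S))) (es.length * (10 * m + 5) + 1) := by
  induction es with
  | nil => simpa [printTerms, unary] using prints_skip
  | cons e es ih =>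
    have he := hes e List.mem_cons_self
    have h1 := ((prints_printTerm h e.2 e.1 he.2).mono
      (Nat.add_le_add_right (Nat.mul_le_mul_right _ he.1) 1)).seq
      (ih fun e' he' => hes e' (List.mem_cons_of_mem _ he'))
    rw [← unary_append] at h1
    exact h1.mono (by rw [List.length_cons]; ring_nf; omega)

/-- Print some numbers for each value of the loop counter that is smaller than the counter `r`. -/
def forEach (r : Reg) (es : List Term) : Prog Reg :=
  seq (copy r .idx) (loop .idx (printTerms es) skip)

/-- The counter runs downwards, which on an output stack yields increasing order. -/
lemma prints_forEach {S : Reg → List Bool} {m : ℕ} (h : Counters S m) (hS : S .idx = []) (r : Reg)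
    (hr : r ≠ .out ∧ r ≠ .tmp ∧ r ≠ .idx) (es : List Term) (hes : ∀ e ∈ es, e.Valid) :
    Prints (forEach r es) S (unary ((List.range (S r).length).flatMap fun i =>
      es.map (Term.value (Function.update S .idx (List.replicate i true)))))
      (5 * m + 2 + (m * (es.length * (10 * m + 5) + 1 + 1) + 1)) := by
  intro o
  obtain ⟨h1, h2⟩ := h.eq_replicate hr.1
  set a := (S r).length with ha
  have h3 := runs_copy hr.2.2 hr.2.1 (by decide) (Function.update S .out o) a
    (by rw [Function.update_of_ne hr.1]; exact h1) (by rw [Function.update_of_ne (by decide)]; exact h.1)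
  rw [Function.update_of_ne (by decide), hS, List.append_nil] at h3
  refine .seq (.mono (by omega) h3) ?_
  set f : ℕ → List ℕ := fun i =>
    es.map (Term.value (Function.update S .idx (List.replicate i true)))
  have h4 := runs_loop_replicate (k := .idx) (p := printTerms es) (q := skip)
    (t := es.length * (10 * m + 5) + 1) (fun i => Function.update (Function.update S .idx
      (List.replicate i true)) .out (unary ((List.range' i (a - i)).flatMap f) ++ o)) a
    (fun i _ => by simp) fun i hi => by
      have h5 := prints_printTerms (h.update_idx (i := i) (by omega)) es hes
        (unary ((List.range' (i + 1) (a - (i + 1))).flatMap f) ++ o)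
      have e : a - i = (a - (i + 1)) + 1 := by omega
      rw [e, List.range'_succ, List.flatMap_cons, unary_append, List.append_assoc]
      convert h5 using 1
      rw [Function.update_comm (by decide), Function.update_idem, Function.update_comm (by decide)]
  refine .mono (t := a * (es.length * (10 * m + 5) + 1 + 1) + 1)
    (Nat.add_le_add_right (Nat.mul_le_mul_right _ h2) 1) ?_
  convert h4 using 1
  · rw [Function.update_comm (by decide)]
    simp [unary]
  · have : Function.update S .idx [] = S := by rw [← hS, Function.update_eq_self]
    simp [List.range_eq_range', this]

end Prog

end InPlaceSep

/-! ### Code of the verifier circuit and correctness of its printer -/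

namespace InPlaceSep
open Turing

lemma gatesCode_cascade (k t : ℕ) (ht : t ≤ k) :
    (cascade k t ht).flatMap Gate.code =
      (List.range t).flatMap fun i => [3, i, 5, i, k + i + 1, k + i + 2] := by
  induction t with
  | zero => rfl
  | succ t ih =>
    rw [cascade, List.flatMap_append, ih, List.range_succ, List.flatMap_append]
    simp [Gate.code, flagWire]
    omega

lemma verifierCircuit_code (l n k : ℕ) (hk : k = l * n) (hn : n ≤ k) (good : Bool) :
    (verifierCircuit l n k hk hn good).code = [k + 2, k + k + 1] ++
      (((List.range good.toNat).flatMap fun _ => [4, 0, k + 1]) ++ ([0, 1, 1, n] ++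
        (((List.range k).flatMap fun i => [i]) ++ ([0] ++
          (((List.range n).flatMap fun i => [1, i]) ++
            (((List.range k).flatMap fun i => [3, i, 5, i, k + i + 1, k + i + 2]) ++ [0, 0])))))) := by
  have h1 : (List.ofFn fun j : Fin (l * n) => (j : ℕ)) = (List.range k).flatMap fun i => [i] := by
    subst hk
    rw [List.flatMap_singleton']
    exact List.ext_getElem (by simp) (by simp)
  have h2 : (((List.finRange n).map fun i : Fin n =>
      (Gate.H ⟨i, by have := i.isLt; omega⟩ : Gate (k + (k + 2)))).flatMap Gate.code) =
      (List.range n).flatMap fun i => [1, i] := by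
    rw [List.flatMap_map, ← List.map_coe_finRange_eq_range, List.flatMap_map]
    rfl
  have h3 : gatesCode (verifierCircuit l n k hk hn good).init =
      ((List.range good.toNat).flatMap fun _ => [4, 0, k + 1]) ++ [0] := by
    cases good <;> simp [verifierCircuit, gatesCode, Gate.code, flagWire]
  have h4 : (verifierCircuit l n k hk hn good).code = (k + 2) :: (k + 1 + k) ::
      (gatesCode (verifierCircuit l n k hk hn good).init ++
        (((1 :: ((1 :: n :: (List.ofFn fun j : Fin (l * n) => (j : ℕ))) ++ [] ++ [0] ++
          ((((List.finRange n).map fun i : Fin n =>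
      (Gate.H ⟨i, by have := i.isLt; omega⟩ : Gate (k + (k + 2)))) ++ cascade k k le_rfl).flatMap
            Gate.code ++ [0]))) ++ []) ++ [0])) := rfl
  rw [h4, h3, h1, List.flatMap_append, h2, gatesCode_cascade]
  simp
  omega

namespace Prog

lemma Prints.of_eq {p : Prog Reg} {S : Reg → List Bool} {L L' : List Bool} {t t' : ℕ}
    (hp : Prints p S L t) (hL : L = L') (ht : t = t') : Prints p S L' t' := by rwa [← hL, ← ht]

/-- The stacks with a given input, a given output, and given values of three counters. -/
def state (inp out : List Bool) (n k g : ℕ) : Reg → List Bool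
  | .inp => inp
  | .out => out
  | .size => List.replicate n true
  | .wits => List.replicate k true
  | .good => List.replicate g true
  | .idx => []
  | .tmp => []

/-- Count the bits of the input, `l` times for the length of the witness, and clear the flag if one
of them is `false`. -/
def setup (l : ℕ) : Prog Reg :=
  loop .inp (seq (push .size [true]) (push .wits (List.replicate l true)))
    (seq (seq (push .size [true]) (push .wits (List.replicate l true))) (loop .good skip skip))

lemma runs_clear (r : Reg) (S : Reg → List Bool) (a : ℕ) (hS : S r = List.replicate a true) :
    (loop r skip skip).Runs S (2 * a + 1) (Function.update S r []) := by
  have h := runs_loop_replicate (k := r) (p := skip) (q := skip) (t := 1)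
    (fun i => Function.update S r (List.replicate i true)) a (fun i _ => by simp) fun i hi => by
      refine (Runs.push Reg.tmp [] _).congr (fun _ => rfl) fun x => ?_
      simp only [List.nil_append, Function.update_eq_self, Function.update_idem]
  exact .mono (by omega) (h.congr (fun x => by rw [← hS, Function.update_eq_self]) fun _ => rfl)

/-- Six steps per bit suffice: one pop, two pushes, and at most three to clear a flag of size at
most one. -/
lemma runs_setup (l : ℕ) (x : List Bool) (n k g : ℕ) (hg : g ≤ 1) :
    (setup l).Runs (state x [] n k g) (6 * x.length + 1)
      (state [] [] (n + x.length) (k + l * x.length) (if x.all id then g else 0)) := by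
  unfold setup
  induction x generalizing n k g with
  | nil => simpa using Runs.loop_nil rfl
  | cons b x ih =>
    have hpq : (seq (push .size [true]) (push Reg.wits (List.replicate l true))).Runs
        (Function.update (state (b :: x) [] n k g) .inp x) 2 (state x [] (n + 1) (k + l) g) := by
      refine (Runs.seq (Runs.push Reg.size [true] _) (Runs.push Reg.wits _ _)).congr (fun _ => rfl)
        fun r => ?_
      cases r <;> simp [state, List.replicate_succ, add_comm k l]
    have e1 : n + (b :: x).length = n + 1 + x.length := by rw [List.length_cons]; omega
    have e2 : k + l * (b :: x).length = k + l + l * x.length := by rw [List.length_cons]; ring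
    cases b with
    | true =>
      refine (Runs.mono ?_ (Runs.loop_true (k := Reg.inp) rfl hpq (ih (n + 1) (k + l) g hg))).congr (fun _ => rfl)
        fun r => ?_
      · rw [List.length_cons]; omega
      · rw [e1, e2]; rfl
    | false =>
      have h2 := (runs_clear .good (state x [] (n + 1) (k + l) g) g rfl).congr
        (T' := state x [] (n + 1) (k + l) 0) (fun _ => rfl) fun r => by
          cases r <;> simp [state]
      refine (Runs.mono ?_ (Runs.loop_false (k := Reg.inp) rfl (hpq.seq h2) (ih (n + 1) (k + l) 0 (by omega)))).congr
        (fun _ => rfl) fun r => ?_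
      · rw [List.length_cons]; omega
      · rw [e1, e2, ite_self]; rfl

/-- Print the code of the circuit, from the end to the beginning. -/
def printCircuit : Prog Reg :=
  seq (seq (seq (seq (seq (seq (seq (printTerms [([], 0), ([], 0)])
    (forEach .wits [([], 3), ([.idx], 0), ([], 5), ([.idx], 0), ([.wits, .idx], 1),
      ([.wits, .idx], 2)]))
    (forEach .size [([], 1), ([.idx], 0)]))
    (printTerms [([], 0)]))
    (forEach .wits [([.idx], 0)]))
    (printTerms [([], 0), ([], 1), ([], 1), ([.size], 0)]))
    (forEach .good [([], 4), ([], 0), ([.wits], 1)]))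
    (printTerms [([.wits], 2), ([.wits, .wits], 1)])

lemma prints_printCircuit (l n k : ℕ) (hk : k = l * n) (hn : n ≤ k) (good : Bool) (m : ℕ)
    (hm : k + 1 ≤ m) :
    Prints printCircuit (state [] [] n k good.toNat)
      (verifierCircuit l n k hk hn good).encode (120 * m ^ 2 + 178 * m + 61) := by
  have hg : good.toNat ≤ 1 := Bool.toNat_le good
  have hC : Counters (state [] [] n k good.toNat) m := by
    refine ⟨rfl, fun r hr => ?_⟩
    cases r
    · exact ⟨0, by omega, rfl⟩
    · exact absurd rfl hr
    · exact ⟨n, by omega, rfl⟩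
    · exact ⟨k, by omega, rfl⟩
    · exact ⟨good.toNat, by omega, rfl⟩
    · exact ⟨0, by omega, rfl⟩
    · exact ⟨0, by omega, rfl⟩
  rw [Circuit.encode_eq, verifierCircuit_code]
  simp only [unary_append _ _]
  have h := (prints_printTerms hC [([.wits], 2), ([.wits, .wits], 1)] (by decide)).seq
    ((prints_forEach hC rfl .good (by decide) [([], 4), ([], 0), ([.wits], 1)] (by decide)).seq
    ((prints_printTerms hC [([], 0), ([], 1), ([], 1), ([.size], 0)] (by decide)).seq
    ((prints_forEach hC rfl .wits (by decide) [([.idx], 0)] (by decide)).seq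
    ((prints_printTerms hC [([], 0)] (by decide)).seq
    ((prints_forEach hC rfl .size (by decide) [([], 1), ([.idx], 0)] (by decide)).seq
    ((prints_forEach hC rfl .wits (by decide) [([], 3), ([.idx], 0), ([], 5), ([.idx], 0),
      ([.wits, .idx], 1), ([.wits, .idx], 2)] (by decide)).seq
    (prints_printTerms hC [([], 0), ([], 0)] (by decide))))))))
  refine h.of_eq ?_ ?_
  · simp [Term.value, state, Function.update_apply]
  · simp only [List.length_cons, List.length_nil]
    ring

/-- Print the circuit for the input, and clear all other stacks. -/
def printVerifier (l : ℕ) : Prog Reg :=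
  seq (push .good [true]) (seq (setup l) (seq printCircuit
    (seq (loop .size skip skip) (seq (loop .wits skip skip) (loop .good skip skip)))))

lemma runs_printVerifier (l : ℕ) (x : List Bool) (k : ℕ) (hk : k = l * x.length)
    (hn : x.length ≤ k) :
    (printVerifier l).Runs (Function.update (fun _ => []) .inp x)
      (120 * (k + 1) ^ 2 + 180 * (k + 1) + 8 * x.length + 68)
      (Function.update (fun _ => []) .out (verifierCircuit l x.length k hk hn (x.all id)).encode) := by
  set L := (verifierCircuit l x.length k hk hn (x.all id)).encode with hL
  have h1 : (push .good [true]).Runs (Function.update (fun _ => []) .inp x) 1 (state x [] 0 0 1) :=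
    (Runs.push Reg.good [true] _).congr (fun _ => rfl) fun r => by
      cases r <;> simp [state]
  have h2 : (setup l).Runs (state x [] 0 0 1) (6 * x.length + 1)
      (state [] [] x.length k (x.all id).toNat) := by
    have := runs_setup l x 0 0 1 le_rfl
    rw [zero_add, zero_add, ← hk] at this
    exact this.congr (fun _ => rfl) fun r => by cases x.all id <;> rfl
  have h3 : printCircuit.Runs (state [] [] x.length k (x.all id).toNat)
      (120 * (k + 1) ^ 2 + 178 * (k + 1) + 61) (state [] L x.length k (x.all id).toNat) :=
    (prints_printCircuit l x.length k hk hn (x.all id) (k + 1) le_rfl []).congr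
      (fun r => by cases r <;> simp [state]) fun r => by cases r <;> simp [state, hL]
  have h4 : (loop .size skip skip).Runs (state [] L x.length k (x.all id).toNat)
      (2 * x.length + 1) (state [] L 0 k (x.all id).toNat) :=
    (runs_clear .size _ _ rfl).congr (fun _ => rfl) fun r => by cases r <;> simp [state]
  have h5 : (loop .wits skip skip).Runs (state [] L 0 k (x.all id).toNat)
      (2 * k + 1) (state [] L 0 0 (x.all id).toNat) :=
    (runs_clear .wits _ _ rfl).congr (fun _ => rfl) fun r => by cases r <;> simp [state]
  have h6 : (loop .good skip skip).Runs (state [] L 0 0 (x.all id).toNat) 3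
      (Function.update (fun _ => []) .out L) :=
    .mono (by have := Bool.toNat_le (x.all id); omega)
      ((runs_clear .good _ _ rfl).congr (fun _ => rfl) fun r => by cases r <;> simp [state])
  exact .mono (by ring_nf; omega) (h1.seq (h2.seq (h3.seq (h4.seq (h5.seq h6)))))

end Prog

theorem pointerVerifier_polyTimeUniform (l : ℕ) (hl : 4 ≤ l) :
    (pointerVerifier l hl).PolyTimeUniform := by
  refine (Prog.printVerifier l).nonempty_tm2ComputableInPolyTime .inp .out _
    (120 * (Polynomial.C l * Polynomial.X + 1) ^ 2 + 180 * (Polynomial.C l * Polynomial.X + 1) +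
      8 * Polynomial.X + 68) fun x => ?_
  have h : Polynomial.eval x.length (120 * (Polynomial.C l * Polynomial.X + 1) ^ 2 +
      180 * (Polynomial.C l * Polynomial.X + 1) + 8 * Polynomial.X + 68) =
      120 * (Polynomial.eval x.length (Polynomial.C l * Polynomial.X) + 1) ^ 2 +
        180 * (Polynomial.eval x.length (Polynomial.C l * Polynomial.X) + 1) + 8 * x.length + 68 := by
    simp
  rw [h]
  exact Prog.runs_printVerifier l x _ (by simp)
    (by simpa using Nat.le_mul_of_pos_left _ (by omega))

end InPlaceSep

/-! ### Assembly of the separation -/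

namespace InPlaceSep
open Filter

lemma pointerVerifier_mem_QMA1Bounded {l : ℕ} (hl : 4 ≤ l) {α : ℝ} (P : ∀ n, PCInstance l α n) :
    lang P ∈ QMA1Bounded (oracle P) (fun _ => 1) fun _ => 1 :=
  ⟨pointerVerifier l hl, pointerVerifier_polyTimeUniform l hl, pointerVerifier_queryBound l hl,
    pointerVerifier_verifiesQMA1 hl P⟩

/-- One family of instances defeats all uniform verifiers that make few queries on all large
inputs. -/
theorem exists_hard_family {l : ℕ} (hl : 4 ≤ l) {α β : ℝ} (hα₀ : 0 < α) (hα₁ : α < 1 / 2)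
    (hβ : 0 < β) (hαβ : β + 5 * α < (l : ℝ) - 2) :
    ∃ P : ∀ n, PCInstance l α n, ∀ V : Verifier fun n => l * n, V.Uniform →
      (∀ᶠ n : ℕ in atTop,
        (V.circ (List.replicate n true)).rounds.length ≤ numBuckets α n - 2 ∧
        ∀ r ∈ (V.circ (List.replicate n true)).rounds, (r.1.queries.length : ℝ) ≤ 2 ^ (β * n)) →
      ¬ V.VerifiesQCMA (oracle P) (lang P) := by
  set 𝒱 : Set (Verifier fun n => l * n) := {V | V.Uniform ∧ ∀ᶠ n : ℕ in atTop,
    (V.circ (List.replicate n true)).rounds.length ≤ numBuckets α n - 2 ∧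
    ∀ r ∈ (V.circ (List.replicate n true)).rounds, (r.1.queries.length : ℝ) ≤ 2 ^ (β * n)}
  have hcount : 𝒱.Countable := (countable_setOf_uniform _).mono fun V hV => hV.1
  have hV := pointerVerifier_polyTimeUniform l hl
  -- Enumeration by `ℕ` needs a nonempty class; the one-query verifier is itself a member.
  obtain ⟨V, h𝒱⟩ := hcount.exists_eq_range ⟨_, hV.uniform, hV.eventually_bounded hα₀ hβ⟩
  obtain ⟨P, hP⟩ := exists_diagonal
    (fun n => (nonempty_pcInstance hl hα₀ hα₁ n).some) V fun i => by
      have hi : V i ∈ 𝒱 := h𝒱 ▸ Set.mem_range_self i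
      exact Verifier.eventually_failsAt hl hα₀ hα₁ hαβ (V i) hi.2
  refine ⟨P, fun W hW hb => ?_⟩
  obtain ⟨i, rfl⟩ : W ∈ Set.range V := h𝒱 ▸ ⟨hW, hb⟩
  exact hP i

end InPlaceSep

theorem mainTheorem1 (l : ℕ) (hl : 4 ≤ l) (α β : ℝ) (hα₀ : 0 < α) (hα₁ : α < 1 / 2) (hβ : 0 ≤ β)
    (hαβ : β + 5 * α < (l : ℝ) - 2) :
    (∃ V : InPlaceSep.Verifier (fun n => l * n),
      V.PolyTimeUniform ∧ V.QueryBound (fun _ => 1) (fun _ => 1) ∧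
      (∀ n, V.wit.eval n = l * n) ∧
      ∀ P : ∀ n, InPlaceSep.PCInstance l α n,
        (∀ n, (P n).IsYes →
          InPlaceSep.QState.IsUnit (InPlaceSep.uniformState
            (V.wit.eval (List.replicate n true).length) (P n).preimage) ∧
          V.acceptProb (InPlaceSep.oracle P) (List.replicate n true)
            (InPlaceSep.uniformState _ (P n).preimage) = 1) ∧
        ∀ x ∉ InPlaceSep.lang P, ∀ ψ, InPlaceSep.QState.IsUnit ψ →
          V.acceptProb (InPlaceSep.oracle P) x ψ ≤ 9 / 10) ∧
    (∀ P : ∀ n, InPlaceSep.PCInstance l α n,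
      InPlaceSep.lang P ∈ InPlaceSep.QMA1Bounded (InPlaceSep.oracle P) (fun _ => 1) (fun _ => 1)) ∧
    ∃ P : ∀ n, InPlaceSep.PCInstance l α n,
      (∀ q : ℕ → ℕ, (∀ n, (q n : ℝ) ≤ (2 : ℝ) ^ (β * n)) →
        InPlaceSep.lang P ∉ InPlaceSep.QCMABounded (InPlaceSep.oracle P)
          (fun n => InPlaceSep.numBuckets α n - 2) q) ∧
      InPlaceSep.lang P ∈ InPlaceSep.QMA1 (InPlaceSep.oracle P) ∧
      InPlaceSep.lang P ∉ InPlaceSep.QCMA (InPlaceSep.oracle P) ∧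
      ¬ InPlaceSep.QMA1 (InPlaceSep.oracle P) ⊆ InPlaceSep.QCMA (InPlaceSep.oracle P) := by
  refine ⟨⟨InPlaceSep.pointerVerifier l hl, InPlaceSep.pointerVerifier_polyTimeUniform l hl,
    InPlaceSep.pointerVerifier_queryBound l hl, fun n => by simp [InPlaceSep.pointerVerifier], fun P =>
      ⟨fun n h => InPlaceSep.pointerVerifier_complete hl P n h, InPlaceSep.pointerVerifier_sound hl P⟩⟩,
    InPlaceSep.pointerVerifier_mem_QMA1Bounded hl, ?_⟩
  -- For `β = 0` the bound `2 ^ (β n) = 1` would not cover polynomially many queries. A slightly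
  -- larger exponent does for large `n`, so one family defeats both classes of verifiers.
  obtain ⟨γ, hγ, hγα⟩ : ∃ γ, β < γ ∧ γ + 5 * α < (l : ℝ) - 2 :=
    ⟨(β + (l - 2 - 5 * α)) / 2, by linarith, by linarith⟩
  obtain ⟨P, hP⟩ := InPlaceSep.exists_hard_family hl hα₀ hα₁ (hβ.trans_lt hγ) hγα
  have hQMA : InPlaceSep.lang P ∈ InPlaceSep.QMA1 (InPlaceSep.oracle P) := by
    obtain ⟨V, h1, -, h2⟩ := InPlaceSep.pointerVerifier_mem_QMA1Bounded hl P
    exact ⟨V, h1, h2⟩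
  have hQCMA : InPlaceSep.lang P ∉ InPlaceSep.QCMA (InPlaceSep.oracle P) := by
    rintro ⟨V, h1, h2⟩
    exact hP V h1.uniform (h1.eventually_bounded hα₀ (hβ.trans_lt hγ)) h2
  refine ⟨P, ?_, hQMA, hQCMA, fun h => hQCMA (h hQMA)⟩
  rintro q hq ⟨V, h1, h2, h3⟩
  refine hP V h1 (Filter.Eventually.of_forall fun n => ?_) h3
  obtain ⟨h4, h5⟩ := h2 (List.replicate n true)
  have hn : (List.replicate n true).length = n := List.length_replicate
  refine ⟨h4.trans_eq (congrArg (fun n => InPlaceSep.numBuckets α n - 2) hn), fun r hr =>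
    (Nat.cast_le.2 ((h5 r hr).trans_eq (congrArg q hn))).trans ((hq n).trans ?_)⟩
  exact Real.rpow_le_rpow_of_exponent_le (by norm_num)
    (mul_le_mul_of_nonneg_right hγ.le (Nat.cast_nonneg n))
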